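/- **Setting.** Let $G$ be a finite simple triangulation of the sphere, given with its clockwise cyclic order of edges around each vertex, and let $\xi$ be a corner of $G$ (the root corner). The face incident to $\xi$ is the root face, and $G$ is drawn in the plane with the root face unbounded; its vertices in clockwise order are $v,A,B$ with $v$ incident to $\xi$. A 3-orientation of $(G,\xi)$ is an orientation of the edges in which $A,B,v$ have outdegrees $0,1,2$ and every other vertex has outdegree $3$; it is minimal if every directed cycle has $\xi$ on its left. Let $\overrightarrow{E}$ be the minimal 3-orientation of $(G,\xi)$. For $e=uw\in\overrightarrow{E}$, the leftmost path $P(e)=(u_0,u_1,\dots,u_\ell)$ from $e$ to $A$ is the directed path with $u_0=u$, $u_1=w$, $u_\ell=A$ such that, for $1\le i\le \ell-1$, $u_iu_{i+1}$ is the first outgoing edge at $u_i$ in clockwise order starting from $\{u_{i-1},u_i\}$. **Labels.** Let $T'$ be the spanning tree of $V(G)\setminus\{A,B\}$, with all edges oriented in $\overrightarrow{E}$ towards $v$, such that every $xy\in\overrightarrow{E}$ with $\{x,y\}\notin E(T')$ and $y\notin\{A,B\}$ is met at $x$ before it is met at $y$ in the clockwise contour exploration of $T'$ inside $G$ starting from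 $\xi$. Attach a stem ending at a bud to $x$ in place of each $xy\in\overrightarrow{E}$ with $\{x,y\}\notin E(T')$ and $x\neq B$; the result is the balanced blossoming tree $\mathrm T$ whose closure is $(G,\xi)$. Label the corners of $\mathrm T$ along its clockwise contour exploration from $\xi$: the label of $\xi$ is $2$; it decreases by $1$ on passing from a non-bud to a non-bud, is unchanged on passing from a non-bud to a bud, and increases by $1$ on passing from a bud to a non-bud. For $y\in V(G)\setminus\{A,B\}$ let $Y_{\mathrm T}(y)$ be the smallest label of a corner of $\mathrm T$ at $y$, and put $Y_{\mathrm T}(A)=1$, $Y_{\mathrm T}(B)=2$. **Winding number.** For $e=uw\in\overrightarrow{E}$ and a simple path $Q$ from $u$ to $A$, let $w(Q,e)$ be the winding number (counterclockwise turns counted positively) of the closed curve that follows $Q$ from $u$ to $A$ and then $P(e)$ backwards from $A$ to $u$, around a point in the face of $G$ on the right of $uw$, where the reference point (the point at infinity) is in the root face. **Sides of a cycle.** For a simple cycle $C$ of $G$ with a direction of traversal (which need not agree with $\overrightarrow{E}$), let $V^l(C)$, resp. $V^r(C)$, be the set of vertices lying on or to the left, resp. on or to the right, of $C$. Write $|Q|$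 for the number of vertices of a path $Q$, and $G[W]$ for the subgraph of $G$ induced by $W$. **Proposition.** Let $e=uw\in\overrightarrow{E}$ and let $Q$ be a shortest path in $G$ from $u$ to $A$. If $w(Q,e)<-2$, then there is an oriented simple cycle $C$ in $G$, of length (number of edges) at most $$\frac{6(|Q|-1)}{-w(Q,e)-2},$$ such that $G[V^l(C)]$ and $G[V^r(C)]$ each have diameter at least $\lfloor -w(Q,e)/3\rfloor-2$, and such that for $h\in\{l,r\}$ $$\max_{y\in V^h(C)}Y_{\mathrm T}(y)-\min_{y\in V^h(C)}Y_{\mathrm T}(y)\ \ge\ \lfloor -w(Q,e)/3\rfloor .$$ -/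

import Mathlib

/-- A connected simple graph together with, around every vertex, a cyclic order of the incident
edges. A dart is an oriented edge; `rot d` is the dart that follows `d` in clockwise order around
the tail `d.fst` of `d`. -/
structure RotationSystem (V : Type*) where
  graph : SimpleGraph V
  connected : graph.Connected
  rot : Equiv.Perm graph.Dart
  rot_fst : ∀ d, (rot d).fst = d.fst
  rot_sameCycle : ∀ d d' : graph.Dart, d.fst = d'.fst → rot.SameCycle d d'

namespace RotationSystem

variable {V : Type*} (M : RotationSystem V)

/-- The next dart along the boundary of the face on the left of `d`: arriving at the head of `d`,
take the edge that follows `d` clockwise around that vertex. -/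
def faceNext : Equiv.Perm M.graph.Dart :=
  (SimpleGraph.Dart.symm_involutive (G := M.graph)).toPerm.trans M.rot

/-- The faces are the orbits of `faceNext`. -/
def Face : Type _ := Quotient (Equiv.Perm.SameCycle.setoid M.faceNext)

/-- The face on the left of a dart. Corners of the map correspond to darts: the dart `d` stands for
the corner at `d.fst` lying just before `d` in clockwise order (that is, on the left of `d`), and
this corner is incident to `M.leftFace d`. -/
def leftFace (d : M.graph.Dart) : M.Face := Quotient.mk _ d

/-- The face on the right of a dart. -/
def rightFace (d : M.graph.Dart) : M.Face := M.leftFace d.symm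

/-- Two faces are adjacent off `C` if they are the two sides of an edge not traversed by `C`. -/
def AdjOff {a : V} (C : M.graph.Walk a a) (f g : M.Face) : Prop :=
  ∃ d : M.graph.Dart, d.edge ∉ C.edges ∧ M.leftFace d = f ∧ M.rightFace d = g

/-- The faces on the left of an oriented cycle `C`: those that can be reached, without crossing
`C`, from a face lying immediately on the left of an edge of `C`. -/
def leftFaces {a : V} (C : M.graph.Walk a a) : Set M.Face :=
  {f | ∃ d ∈ C.darts, Relation.ReflTransGen (M.AdjOff C) (M.leftFace d) f}

/-- The faces on the right of an oriented cycle. -/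
def rightFaces {a : V} (C : M.graph.Walk a a) : Set M.Face :=
  {f | ∃ d ∈ C.darts, Relation.ReflTransGen (M.AdjOff C) (M.rightFace d) f}

/-- The vertices lying on, or to the left of, an oriented cycle. -/
def leftVertices {a : V} (C : M.graph.Walk a a) : Set V :=
  {v | v ∈ C.support ∨ ∃ d : M.graph.Dart, d.fst = v ∧ M.leftFace d ∈ M.leftFaces C}

/-- The vertices lying on, or to the right of, an oriented cycle. -/
def rightVertices {a : V} (C : M.graph.Walk a a) : Set V :=
  {v | v ∈ C.support ∨ ∃ d : M.graph.Dart, d.fst = v ∧ M.leftFace d ∈ M.rightFaces C}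

open Classical in
/-- `h f` is the winding number of the closed walk `C` around the points of the face `f`, where
the reference point (the point at infinity) is in the face `r`. It vanishes in `r`, and crossing a
dart from its right to its left increases it by the net number of times that `C` follows the
dart; so a counterclockwise turn counts `+1`. On the sphere there is exactly one such function. -/
def IsWindingFunction {a : V} (C : M.graph.Walk a a) (r : M.Face) (h : M.Face → ℤ) : Prop :=
  h r = 0 ∧ ∀ d : M.graph.Dart,
    h (M.leftFace d) - h (M.rightFace d) = (C.darts.count d : ℤ) - (C.darts.count d.symm : ℤ)

open Classical in
/-- The winding number of the closed walk `C` around a point of the face `x`, relative to a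
reference point in the face `r`. -/
noncomputable def wind {a : V} (r x : M.Face) (C : M.graph.Walk a a) : ℤ :=
  if h : ∃ f, M.IsWindingFunction C r f then h.choose x else 0

end RotationSystem

/-- A planar map (with at least one edge), up to orientation-preserving homeomorphism: a rotation
system whose faces satisfy Euler's formula for the sphere. -/
structure PlanarMap (V : Type*) extends RotationSystem V where
  euler : Nat.card V + Nat.card toRotationSystem.Face = Nat.card graph.edgeSet + 2

/-- A planted simple triangulation of the sphere. As there are no loops, `triangle` says that all
faces have degree three. The root corner is the one on the left of the dart `root`. -/
structure PlantedTriangulation (V : Type*) extends PlanarMap V where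
  triangle : ∀ d, toRotationSystem.faceNext
    (toRotationSystem.faceNext (toRotationSystem.faceNext d)) = d
  root : graph.Dart

namespace PlantedTriangulation

variable {V : Type*} (G : PlantedTriangulation V)

/-- The face incident to the root corner. -/
def rootFace : G.Face := G.leftFace G.root

/-- When `G` is drawn in the plane with the root face unbounded, the vertices of the root face are,
in clockwise order, `rootVertex`, `A`, `B`. -/
def rootVertex : V := G.root.fst

/-- The vertex `A` of the root face. -/
def A : V := G.root.snd

/-- The vertex `B` of the root face. -/
def B : V := (G.faceNext G.root).snd

/-- `E` contains exactly one orientation of each edge; `A`, `B` and the root vertex have outdegrees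
`0`, `1` and `2`, and all other vertices have outdegree `3`. -/
structure IsThreeOrientation (E : Set G.graph.Dart) : Prop where
  orientation : ∀ d, d.symm ∈ E ↔ d ∉ E
  outdeg_A : {d | d ∈ E ∧ d.fst = G.A}.ncard = 0
  outdeg_B : {d | d ∈ E ∧ d.fst = G.B}.ncard = 1
  outdeg_root : {d | d ∈ E ∧ d.fst = G.rootVertex}.ncard = 2
  outdeg : ∀ v, v ≠ G.A → v ≠ G.B → v ≠ G.rootVertex → {d | d ∈ E ∧ d.fst = v}.ncard = 3

/-- A 3-orientation is minimal if it has no counterclockwise directed cycle, i.e. if every directed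
cycle has the root corner on its left. -/
structure IsMinimalThreeOrientation (E : Set G.graph.Dart) : Prop extends
    G.IsThreeOrientation E where
  minimal : ∀ (a : V) (C : G.graph.Walk a a), C.IsCycle → (∀ d ∈ C.darts, d ∈ E) →
    G.rootFace ∈ G.leftFaces C

/-- `d'` is the first outgoing dart after `d`, when the edges at the head of `d` are considered in
clockwise order starting from `d`. -/
def IsFirstOutgoing (E : Set G.graph.Dart) (d d' : G.graph.Dart) : Prop :=
  d' ∈ E ∧ ∃ k : ℕ, 1 ≤ k ∧ (G.rot ^ k) d.symm = d' ∧
    ∀ j : ℕ, 1 ≤ j → j < k → (G.rot ^ j) d.symm ∉ E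

/-- `P` is the leftmost path from the oriented edge `e` to `A`. -/
def IsLeftmostPath (E : Set G.graph.Dart) (e : G.graph.Dart) (P : G.graph.Walk e.fst G.A) : Prop :=
  P.darts.head? = some e ∧ P.darts.IsChain (G.IsFirstOutgoing E)

/-- The winding number of `Q` around `e`: the winding number of the closed curve that follows `Q`
and then the leftmost path `P` backwards, around a point in the face on the right of `e`, the
reference point being in the root face. -/
noncomputable def windingNumber {e : G.graph.Dart} (P Q : G.graph.Walk e.fst G.A) : ℤ :=
  G.wind G.rootFace (G.rightFace e) (Q.append P.reverse)

section Tree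

variable (T : Set G.graph.Dart)

open Classical in
/-- One step of the clockwise contour exploration of the tree with edge set `T` inside `G`. The
dart `d` stands for the current corner, so the edge of `d` is considered next: if it is a tree edge
it is followed, and otherwise it is passed over, the exploration staying at the same vertex. -/
noncomputable def contourNext (d : G.graph.Dart) : G.graph.Dart :=
  if d ∈ T ∨ d.symm ∈ T then G.rot d.symm else G.rot d

/-- The clockwise contour exploration, from the root corner. -/
noncomputable def contour (t : ℕ) : G.graph.Dart := (G.contourNext T)^[t] G.root

/-- The number of steps after which the contour exploration is back at the root corner. -/
noncomputable def contourLength : ℕ := Function.minimalPeriod (G.contourNext T) G.root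

/-- `T` (whose darts point from child to parent) is the set of inner edges of the balanced
blossoming tree whose closure is `G`: it is a spanning tree of `V ∖ {A, B}` in which all edges are
oriented towards the root vertex in `E`, and each edge of `E` outside `T` is met by the
contour exploration at its tail before it is met at its head (if its head is in the tree at all).
The stems of the blossoming tree are the darts of `E` outside `T`, attached to their tails, except
the dart from `B` to `A`. -/
structure IsBlossomingTree (E : Set G.graph.Dart) : Prop where
  oriented : T ⊆ E
  avoids : ∀ d ∈ T, d.fst ≠ G.A ∧ d.fst ≠ G.B ∧ d.snd ≠ G.A ∧ d.snd ≠ G.B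
  root_no_parent : ∀ d ∈ T, d.fst ≠ G.rootVertex
  parent_unique : ∀ d ∈ T, ∀ d' ∈ T, d.fst = d'.fst → d = d'
  reaches_root : ∀ v, v ≠ G.A → v ≠ G.B →
    Relation.ReflTransGen (fun x y => ∃ d ∈ T, d.fst = x ∧ d.snd = y) v G.rootVertex
  tail_first : ∀ d ∈ E, d ∉ T → d.snd ≠ G.A → d.snd ≠ G.B →
    ∃ s t : ℕ, s < t ∧ t < G.contourLength T ∧ G.contour T s = d ∧ G.contour T t = d.symm

variable (E : Set G.graph.Dart)

open Classical in
/-- The labels of the corners of the blossoming tree, in the order of its contour exploration. The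
label starts at `2`, decreases by one along an inner edge, and increases by one after the visit of
a bud (it is unchanged on the way to the bud and increases on the way back). An edge
that is neither in the tree nor a stem at the current vertex is not there in the blossoming tree,
and the label does not change when it is passed over. -/
noncomputable def cornerLabel : ℕ → ℤ
  | 0 => 2
  | t + 1 =>
      if G.contour T t ∈ T ∨ (G.contour T t).symm ∈ T then cornerLabel t - 1
      else if G.contour T t ∈ E then cornerLabel t + 1
      else cornerLabel t

open Classical in
/-- The vertex labels `Y`: `1` at `A`, `2` at `B`, and elsewhere the smallest label of a corner of
the blossoming tree at the vertex. -/
noncomputable def label (v : V) : ℤ :=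
  if v = G.A then 1
  else if v = G.B then 2
  else sInf {l | ∃ t < G.contourLength T, (G.contour T t).fst = v ∧ G.cornerLabel T E t = l}

/-- The difference between the largest and the smallest label in a (finite nonempty) set of
vertices. -/
noncomputable def labelSpan (S : Set V) : ℤ :=
  sSup (G.label T E '' S) - sInf (G.label T E '' S)

end Tree

end PlantedTriangulation

/-! Cut the geodesic `Q` at its visits to the leftmost path `P`. Between consecutive visits, at
positions `s < t` of `Q` and `i`, `j` of `P`, the two pieces form a simple cycle, directed along `Q`
(or they are the same edge). From one visit to the next the winding number changes by the difference
of the cycle's side indicator at `G.rightFace e` and at the root face, hence by at most one, and it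
drops only if the root face is on the left and `G.rightFace e` on the right.

Such drops are rigid. If the root face is on the left of a cycle, Euler's formula on the right side
and outdegree 3 at the inner vertices show that exactly length minus 3 edges leave the cycle into
its right side (`IsThreeOrientation.ncard_rightOut`). Since `P` always takes the first outgoing
edge, its other outgoing edges lie on a known side. If the cycle follows `P` forwards (`j < i`),
they lie on the right and are too many for a geodesic (`IsExcursion.not_lt`); if it follows `P`
backwards, they lie on the left, which forces `j - i ≤ t - s + 2` (`IsExcursion.le_add_two`). The
same count shows that `P` is simple (`IsLeftmost.isPath`).

Let the winding number be `-k` and `m = k / 3`. The descents from level `-m` to level `-2m` are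
disjoint and at least `m` steps away from both ends of `Q`, so the shortest of them satisfies `m *
(t - s) + 2 * m ≤ Q.length` (`exists_short_descent`). Its cycle has length at most `2 * (t - s) +
2`. Its left side contains `A` and the vertex of `Q` at `s`, its right side the tail of `e` and the
vertex of `Q` at `t`; both pairs are at distance at least `m`, which bounds the diameters.

For the label spans, `IsLeftmost.le_label_sub` shows that labels drop along `P` at least by the
number of steps minus two. Behind it is the fact that the two corners at an oriented edge with head
outside `{A, B}` have labels differing by one (`IsBlossomingTree.visitLabel_symm`), obtained from
the triangles: every face but the root face contains exactly one reversed stem.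

The topology comes from linear algebra. Coboundaries of face functions and of vertex functions are
orthogonal, and by Euler's formula they span all edge functions, so every circulation is the
coboundary of a face function (`PlanarMap.exists_isPotential`). This yields winding functions and
the Jordan curve theorem. -/

open Finset

/-! ### Faces, orientations and orthogonality of coboundaries -/

namespace RotationSystem

variable {V : Type*} (M : RotationSystem V)

instance finite_dart [Finite V] : Finite M.graph.Dart :=
  Finite.of_injective (fun d : M.graph.Dart => d.toProd) (SimpleGraph.Dart.toProd_injective)

noncomputable instance fintypeDart [Finite V] : Fintype M.graph.Dart := Fintype.ofFinite _

instance finite_face [Finite V] : Finite M.Face :=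
  Quotient.finite _

theorem leftFace_surjective : Function.Surjective M.leftFace := Quotient.mk_surjective

theorem faceNext_apply (d : M.graph.Dart) : M.faceNext d = M.rot d.symm := rfl

theorem faceNext_fst (d : M.graph.Dart) : (M.faceNext d).fst = d.snd := by
  rw [faceNext_apply, M.rot_fst]; rfl

theorem leftFace_faceNext (d : M.graph.Dart) : M.leftFace (M.faceNext d) = M.leftFace d :=
  Quotient.sound (s := Equiv.Perm.SameCycle.setoid M.faceNext)
    (show M.faceNext.SameCycle _ _ from Equiv.Perm.sameCycle_apply_left.2 (.refl _ _))

theorem leftFace_eq_iff {d d' : M.graph.Dart} :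
    M.leftFace d = M.leftFace d' ↔ M.faceNext.SameCycle d d' :=
  Quotient.eq (r := Equiv.Perm.SameCycle.setoid M.faceNext)

theorem leftFace_rot (d : M.graph.Dart) : M.leftFace (M.rot d) = M.rightFace d := by
  have := M.leftFace_faceNext d.symm
  rwa [faceNext_apply, SimpleGraph.Dart.symm_symm] at this

theorem rightFace_symm (d : M.graph.Dart) : M.rightFace d.symm = M.leftFace d := by
  simp [rightFace]

theorem leftFace_symm (d : M.graph.Dart) : M.leftFace d.symm = M.rightFace d := rfl

theorem rot_pow_fst (d : M.graph.Dart) (n : ℕ) : ((M.rot ^ n) d).fst = d.fst := by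
  induction n with
  | zero => rfl
  | succ n ih => rw [pow_succ', Equiv.Perm.mul_apply, M.rot_fst, ih]

/-- If a dart with tail `x` has some property closed under `rot`, all darts with tail `x` do. -/
theorem rot_induction [Finite V] {p : M.graph.Dart → Prop} {d d' : M.graph.Dart} (hd : p d)
    (h : d.fst = d'.fst) (step : ∀ g, g.fst = d.fst → p g → p (M.rot g)) : p d' := by
  obtain ⟨n, rfl⟩ := (M.rot_sameCycle d d' h).exists_nat_pow_eq
  clear h
  induction n with
  | zero => exact hd
  | succ n ih => rw [pow_succ', Equiv.Perm.mul_apply]; exact step _ (M.rot_pow_fst _ _) ih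

/-- Functions on the faces that agree across all edges are constant. -/
theorem const_of_leftFace_eq_rightFace [Finite V] {α : Type*} (h : M.Face → α)
    (hh : ∀ d, h (M.leftFace d) = h (M.rightFace d)) (f f' : M.Face) : h f = h f' := by
  have key : ∀ x y : V, M.graph.Reachable x y → ∀ d d' : M.graph.Dart, d.fst = x → d'.fst = y →
      h (M.leftFace d) = h (M.leftFace d') := by
    rintro x y ⟨W⟩
    -- Rotating past a dart moves from its left face to its right face, so the value is the same at
    -- all corners of a vertex.
    have vert : ∀ d d' : M.graph.Dart, d.fst = d'.fst →
        h (M.leftFace d) = h (M.leftFace d') := fun d d' hd =>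
      M.rot_induction (p := fun g => h (M.leftFace d) = h (M.leftFace g)) rfl hd
        (fun g _ hg => by rw [hg, M.leftFace_rot, hh])
    induction W with
    | nil => intro d d' hd hd'; exact vert _ _ (hd.trans hd'.symm)
    | cons hadj W ih =>
      intro d d' hd hd'
      rw [← ih (SimpleGraph.Dart.mk (_, _) hadj).symm d' rfl hd']
      rw [M.leftFace_symm, ← hh]
      exact vert _ _ hd
  obtain ⟨d, rfl⟩ := M.leftFace_surjective f
  obtain ⟨d', rfl⟩ := M.leftFace_surjective f'
  exact key _ _ (M.connected.preconnected _ _) d d' rfl rfl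

/-- `E` contains exactly one of the two darts of every edge. -/
def IsOrientation (E : Set M.graph.Dart) : Prop := ∀ d : M.graph.Dart, d.symm ∈ E ↔ d ∉ E

variable {M} {E : Set M.graph.Dart}

theorem IsOrientation.ncard_eq [Finite V] (hE : M.IsOrientation E) :
    E.ncard = Nat.card M.graph.edgeSet := by
  rw [← Nat.card_coe_set_eq]
  refine Nat.card_congr (Equiv.ofBijective
    (fun d : E => (⟨d.1.edge, d.1.edge_mem⟩ : M.graph.edgeSet)) ⟨?_, ?_⟩)
  · rintro ⟨d, hd⟩ ⟨d', hd'⟩ h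
    simp only [Subtype.mk.injEq, SimpleGraph.dart_edge_eq_iff] at h ⊢
    rcases h with h | h
    · exact h
    · subst h
      exact absurd hd' ((hE d').1 hd)
  · rintro ⟨e, he⟩
    induction e with
    | _ x y =>
      let d : M.graph.Dart := ⟨(x, y), he⟩
      by_cases hd : d ∈ E
      · exact ⟨⟨d, hd⟩, rfl⟩
      · exact ⟨⟨d.symm, (hE d).2 hd⟩, Subtype.ext (SimpleGraph.Dart.edge_symm d)⟩

open Classical in
theorem IsOrientation.sum_eq [Finite V] (hE : M.IsOrientation E)
    (F : M.graph.Dart → ℚ) (hF : ∀ d, F d.symm = F d) :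
    ∑ d, F d = 2 * ∑ d with d ∈ E, F d := by
  rw [← Finset.sum_filter_add_sum_filter_not univ (· ∈ E), two_mul]
  congr 1
  refine Finset.sum_bij' (fun d _ => d.symm) (fun d _ => d.symm) ?_ ?_ ?_ ?_ ?_
  · intro d hd; simpa [hE d] using hd
  · intro d hd; simpa [hE d] using hd
  · simp
  · simp
  · simp [hF]

open Classical in
/-- Coboundaries of functions on the faces are orthogonal to coboundaries of functions on the
vertices. -/
theorem IsOrientation.sum_mul_eq_zero [Finite V] (hE : M.IsOrientation E)
    (h : M.Face → ℚ) (g : V → ℚ) :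
    ∑ d with d ∈ E, (h (M.leftFace d) - h (M.rightFace d)) * (g d.snd - g d.fst) = 0 := by
  have h1 := hE.sum_eq (fun d => (h (M.leftFace d) - h (M.rightFace d)) * (g d.snd - g d.fst))
    (fun d => by
      rw [M.leftFace_symm, M.rightFace_symm]
      change _ * (g d.fst - g d.snd) = _
      ring)
  have h2 : ∑ d, h (M.rightFace d) * (g d.snd - g d.fst) =
      - ∑ d, h (M.leftFace d) * (g d.snd - g d.fst) := by
    rw [← Finset.sum_neg_distrib]
    refine Fintype.sum_equiv (SimpleGraph.Dart.symm_involutive.toPerm) _ _ (fun d => ?_)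
    change _ = - (h (M.leftFace d.symm) * (g d.fst - g d.snd))
    rw [M.leftFace_symm]; ring
  -- Around a face the head of each dart is the tail of the next, so the sum telescopes face by
  -- face.
  have h3 : ∑ d, h (M.leftFace d) * g d.snd = ∑ d, h (M.leftFace d) * g d.fst := by
    refine Fintype.sum_equiv M.faceNext _ _ (fun d => ?_)
    rw [M.leftFace_faceNext, M.faceNext_fst]
  have h4 : ∑ d, h (M.leftFace d) * (g d.snd - g d.fst) = 0 := by
    simp only [mul_sub, Finset.sum_sub_distrib, h3, sub_self]
  simp only [sub_mul, Finset.sum_sub_distrib] at h1 ⊢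
  rw [h2, h4] at h1
  linarith

/-- The conditions on a set `R` of faces and a set `U` of vertices under which the coboundary
maps of functions supported on `R` and on `U` are jointly injective up to constants. -/
structure IsRegion (E : Set M.graph.Dart) (R : Set M.Face) (U : Set V) (f₀ : M.Face) : Prop where
  compl : ∃ x, x ∉ U
  star : ∀ d ∈ E, (d.fst ∈ U ∨ d.snd ∈ U) → M.leftFace d ∈ R ∧ M.rightFace d ∈ R
  conn : ∀ h : M.Face → ℚ, (∀ d ∈ E, M.leftFace d ∈ R → M.rightFace d ∈ R →
    h (M.leftFace d) = h (M.rightFace d)) → ∀ f ∈ R, h f = h f₀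

theorem IsOrientation.const_of_fst_eq_snd (hE : M.IsOrientation E) {α : Type*} (g : V → α)
    (hg : ∀ d ∈ E, g d.fst = g d.snd) (x y : V) : g x = g y := by
  obtain ⟨W⟩ := M.connected.preconnected x y
  induction W with
  | nil => rfl
  | cons hadj W ih =>
    rw [← ih]
    by_cases hd : (⟨(_, _), hadj⟩ : M.graph.Dart) ∈ E
    · exact hg _ hd
    · exact (hg _ ((hE _).2 hd)).symm

/-- The two coboundaries cancel wherever the one of `g` can be nonzero (this is `star`), and they
are orthogonal; hence the coboundary of `g` is orthogonal to itself and vanishes. Then both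
functions are locally constant, and `compl` and the base face fix the constants to be zero. -/
theorem IsRegion.eq_zero [Finite V] (hE : M.IsOrientation E) {R : Set M.Face} {U : Set V}
    {f₀ : M.Face} (hR : M.IsRegion E R U f₀) {h : M.Face → ℚ} {g : V → ℚ}
    (hh : ∀ f ∉ R, h f = 0) (hg : ∀ x ∉ U, g x = 0)
    (heq : ∀ d ∈ E, M.leftFace d ∈ R → M.rightFace d ∈ R →
      h (M.leftFace d) - h (M.rightFace d) + (g d.snd - g d.fst) = 0) (h0 : h f₀ = 0) :
    h = 0 ∧ g = 0 := by
  classical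
  have hz : ∀ d ∈ E, g d.snd - g d.fst = 0 := by
    have hs := hE.sum_mul_eq_zero h g
    have hs' : ∑ d with d ∈ E, (g d.snd - g d.fst) ^ 2 = 0 := by
      rw [← neg_eq_zero, ← Finset.sum_neg_distrib, ← hs]
      refine Finset.sum_congr rfl fun d hd => ?_
      have hd : d ∈ E := by simpa using hd
      by_cases hU : d.fst ∈ U ∨ d.snd ∈ U
      · obtain ⟨h1, h2⟩ := hR.star d hd hU
        have := heq d hd h1 h2
        have : h (M.leftFace d) - h (M.rightFace d) = - (g d.snd - g d.fst) := by linarith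
        rw [this]; ring
      · push Not at hU
        rw [hg _ hU.1, hg _ hU.2]; ring
    intro d hd
    have := (Finset.sum_eq_zero_iff_of_nonneg (fun d _ => sq_nonneg _)).1 hs' d (by simpa using hd)
    exact pow_eq_zero_iff (two_ne_zero) |>.1 this
  obtain ⟨x₀, hx₀⟩ := hR.compl
  refine ⟨funext fun f => ?_, funext fun x => ?_⟩
  · by_cases hf : f ∈ R
    · rw [hR.conn h (fun d hd h1 h2 => by linarith [heq d hd h1 h2, hz d hd]) f hf, h0]; rfl
    · exact hh f hf
  · rw [hE.const_of_fst_eq_snd g (fun d hd => by linarith [hz d hd]) x x₀, hg x₀ hx₀]; rfl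

open Classical in
/-- The coboundary map of a region, together with the value at the base face. -/
noncomputable def coboundary (E : Set M.graph.Dart) (R : Set M.Face) (U : Set V) (f₀ : M.Face) :
    (R → ℚ) × (U → ℚ) →ₗ[ℚ]
      ({d | d ∈ E ∧ M.leftFace d ∈ R ∧ M.rightFace d ∈ R} → ℚ) × ℚ where
  toFun p :=
    let h := Function.extend Subtype.val p.1 (0 : M.Face → ℚ)
    let g := Function.extend Subtype.val p.2 (0 : V → ℚ)
    (fun d => h (M.leftFace d.1) - h (M.rightFace d.1) + (g d.1.snd - g d.1.fst), h f₀)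
  map_add' p q := by
    have h1 := Function.extend_add (Subtype.val : R → M.Face) p.1 q.1 0 0
    have h2 := Function.extend_add (Subtype.val : U → V) p.2 q.2 0 0
    simp only [add_zero] at h1 h2
    simp only [Prod.fst_add, Prod.snd_add, h1, h2, Pi.add_apply]
    refine Prod.ext (funext fun d => ?_) rfl
    simp only [Prod.fst_add, Pi.add_apply]; ring
  map_smul' c p := by
    have h1 := Function.extend_smul c (Subtype.val : R → M.Face) p.1 0
    have h2 := Function.extend_smul c (Subtype.val : U → V) p.2 0
    simp only [smul_zero] at h1 h2
    simp only [Prod.smul_fst, Prod.smul_snd, h1, h2, Pi.smul_apply, smul_eq_mul]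
    refine Prod.ext (funext fun d => ?_) rfl
    simp; ring

theorem IsRegion.coboundary_injective [Finite V] (hE : M.IsOrientation E) {R : Set M.Face}
    {U : Set V} {f₀ : M.Face} (hR : M.IsRegion E R U f₀) :
    Function.Injective (coboundary E R U f₀) := by
  rw [← LinearMap.ker_eq_bot, LinearMap.ker_eq_bot']
  rintro ⟨h, g⟩ hp
  have h1 := congrArg Prod.fst hp
  have h2 := congrArg Prod.snd hp
  obtain ⟨ha, hb⟩ := hR.eq_zero hE (h := Function.extend Subtype.val h 0)
    (g := Function.extend Subtype.val g 0)
    (fun f hf => Function.extend_apply' _ _ _ (by simpa using hf))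
    (fun f hf => Function.extend_apply' _ _ _ (by simpa using hf))
    (fun d hd hl hr => congrFun h1 ⟨d, hd, hl, hr⟩) h2
  refine Prod.ext (funext fun f => ?_) (funext fun x => ?_)
  · have := congrFun ha f.1
    rwa [Subtype.val_injective.extend_apply] at this
  · have := congrFun hb x.1
    rwa [Subtype.val_injective.extend_apply] at this

/-- Dimension count for the injective map `coboundary`; the `+ 1` is the coordinate at the base
face. This is one half of Euler's formula for the region. -/
theorem IsRegion.ncard_add_ncard_le [Finite V] (hE : M.IsOrientation E) {R : Set M.Face}
    {U : Set V} {f₀ : M.Face} (hR : M.IsRegion E R U f₀) :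
    R.ncard + U.ncard ≤ {d | d ∈ E ∧ M.leftFace d ∈ R ∧ M.rightFace d ∈ R}.ncard + 1 := by
  classical
  have := Fintype.ofFinite M.Face
  have := Fintype.ofFinite V
  have := LinearMap.finrank_le_finrank_of_injective (hR.coboundary_injective hE)
  simp only [Module.finrank_prod, Module.finrank_fintype_fun_eq_card, Module.finrank_self] at this
  simpa only [← Nat.card_coe_set_eq, Nat.card_eq_fintype_card] using this

variable (M) in
/-- A function on the darts is the coboundary of a function on the faces. -/
def IsPotential (φ : M.graph.Dart → ℤ) (h : M.Face → ℤ) : Prop :=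
  ∀ d, h (M.leftFace d) - h (M.rightFace d) = φ d

end RotationSystem

/-! ### Circulations on the sphere -/

namespace PlanarMap

open RotationSystem

variable {V : Type*} (M : PlanarMap V) {E : Set M.graph.Dart}

open Classical in
/-- On the sphere, every circulation is the coboundary of a function on the faces. -/
theorem exists_isPotential [Finite V] (hE : M.IsOrientation E)
    (φ : M.graph.Dart → ℤ) (hanti : ∀ d, φ d.symm = - φ d)
    (hφ : ∀ g : V → ℚ, ∑ d with d ∈ E, (φ d : ℚ) * (g d.snd - g d.fst) = 0) :
    ∃ h, M.IsPotential φ h := by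
  have := Fintype.ofFinite M.Face
  have := Fintype.ofFinite V
  obtain ⟨x₀⟩ := M.connected.nonempty
  by_cases hne : Nonempty M.graph.Dart
  swap
  · exact ⟨0, fun d => (hne ⟨d⟩).elim⟩
  obtain ⟨d₀⟩ := hne
  -- The region is the whole sphere; one vertex is left out to fix the additive constant of the
  -- vertex function.
  have hR : M.IsRegion E Set.univ {x₀}ᶜ (M.leftFace d₀) :=
    { compl := ⟨x₀, by simp⟩
      star := fun _ _ _ => ⟨trivial, trivial⟩
      conn := fun h hh f _ => M.const_of_leftFace_eq_rightFace h (fun d => by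
        by_cases hd : d ∈ E
        · exact hh d hd trivial trivial
        · have := hh _ ((hE d).2 hd) trivial trivial
          rwa [M.leftFace_symm, M.rightFace_symm, eq_comm] at this) _ _ }
  have hinj := hR.coboundary_injective hE
  -- By Euler's formula the dimensions agree, so the injective map is onto.
  have hcard : Module.finrank ℚ ((↥(Set.univ : Set M.Face) → ℚ) × (↥({x₀}ᶜ : Set V) → ℚ)) =
      Module.finrank ℚ (({d | d ∈ E ∧ M.leftFace d ∈ Set.univ ∧ M.rightFace d ∈ Set.univ} :
        Set M.graph.Dart) → ℚ) + Module.finrank ℚ ℚ := by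
    have h1 := M.euler
    have h2 := hE.ncard_eq
    have h3 : ({x₀}ᶜ : Set V).ncard + 1 = Nat.card V := by
      rw [← Set.ncard_singleton x₀, add_comm, Set.ncard_add_ncard_compl]
    have h4 : (Set.univ : Set M.Face).ncard = Nat.card M.Face := Set.ncard_univ _
    have h5 : ({d | d ∈ E ∧ M.leftFace d ∈ Set.univ ∧ M.rightFace d ∈ Set.univ} :
        Set M.graph.Dart).ncard = E.ncard := by simp
    simp only [Module.finrank_prod, Module.finrank_fintype_fun_eq_card, Module.finrank_self,
      ← Nat.card_eq_fintype_card, Nat.card_coe_set_eq]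
    omega
  have hsurj : Function.Surjective (coboundary E (Set.univ : Set M.Face) {x₀}ᶜ (M.leftFace d₀)) :=
    (LinearMap.injective_iff_surjective_of_finrank_eq_finrank
      (by rw [hcard, Module.finrank_prod])).1 hinj
  obtain ⟨⟨a, b⟩, hab⟩ := hsurj (fun d => (φ d.1 : ℚ), 0)
  have h1 := congrArg Prod.fst hab
  have h2 := congrArg Prod.snd hab
  set h := Function.extend Subtype.val a (0 : M.Face → ℚ) with hdef
  set g := Function.extend Subtype.val b (0 : V → ℚ) with gdef
  have h1' : ∀ d ∈ E, h (M.leftFace d) - h (M.rightFace d) + (g d.snd - g d.fst) = φ d :=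
    fun d hd => congrFun h1 ⟨d, hd, trivial, trivial⟩
  have h2' : h (M.leftFace d₀) = 0 := h2
  -- Both `φ` and the face part are orthogonal to vertex coboundaries, so the vertex part is
  -- orthogonal to itself.
  have hg : ∀ d ∈ E, g d.snd - g d.fst = 0 := by
    have hs := hE.sum_mul_eq_zero h g
    have hs' : ∑ d with d ∈ E, (g d.snd - g d.fst) ^ 2 = 0 := by
      rw [← hφ g, ← sub_zero (∑ d with d ∈ E, (φ d : ℚ) * (g d.snd - g d.fst)), ← hs,
        ← Finset.sum_sub_distrib]
      refine Finset.sum_congr rfl fun d hd => ?_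
      rw [← h1' d (by simpa using hd)]; ring
    intro d hd
    have := (Finset.sum_eq_zero_iff_of_nonneg (fun d _ => sq_nonneg _)).1 hs' d (by simpa using hd)
    exact pow_eq_zero_iff (two_ne_zero) |>.1 this
  have hpot : ∀ d, h (M.leftFace d) - h (M.rightFace d) = φ d := by
    intro d
    by_cases hd : d ∈ E
    · linarith [h1' d hd, hg d hd]
    · have hd' := (hE d).2 hd
      have := h1' _ hd'
      rw [M.leftFace_symm, M.rightFace_symm, hanti] at this
      push_cast at this
      linarith [hg _ hd']
  -- The value at the base face is 0 and adjacent values differ by integers.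
  have hint : ∀ f, ∃ z : ℤ, h f = z := by
    intro f
    refine (M.const_of_leftFace_eq_rightFace (fun f => ∃ z : ℤ, h f = z) (fun d => ?_)
      (M.leftFace d₀) f).mp ⟨0, by simpa using h2'⟩
    refine propext ⟨fun ⟨z, hz⟩ => ⟨z - φ d, ?_⟩, fun ⟨z, hz⟩ => ⟨z + φ d, ?_⟩⟩
    · push_cast; linarith [hpot d]
    · push_cast; linarith [hpot d]
  choose h' hh' using hint
  refine ⟨h', fun d => ?_⟩
  have := hpot d
  rw [hh', hh'] at this
  exact_mod_cast this

end PlanarMap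

/-! ### Flows of walks and the faces next to a simple cycle -/

namespace RotationSystem

variable {V : Type*} (M : RotationSystem V)

open Classical in
/-- The net number of times that a walk follows a dart. -/
noncomputable def flow {a b : V} (W : M.graph.Walk a b) (d : M.graph.Dart) : ℤ :=
  (W.darts.count d : ℤ) - (W.darts.count d.symm : ℤ)

variable {M} {a b c : V}

theorem flow_symm (W : M.graph.Walk a b) (d : M.graph.Dart) : M.flow W d.symm = - M.flow W d := by
  simp [flow]

theorem flow_append (W : M.graph.Walk a b) (W' : M.graph.Walk b c) (d : M.graph.Dart) :
    M.flow (W.append W') d = M.flow W d + M.flow W' d := by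
  simp only [flow, SimpleGraph.Walk.darts_append, List.count_append]
  push_cast; ring

theorem flow_cons (h : M.graph.Adj a b) (W : M.graph.Walk b c) (d : M.graph.Dart) :
    M.flow (.cons h W) d = M.flow (.cons h .nil) d + M.flow W d :=
  flow_append (.cons h .nil) W d

theorem flow_reverse (W : M.graph.Walk a b) (d : M.graph.Dart) :
    M.flow W.reverse d = - M.flow W d := by
  classical
  have key : ∀ g : M.graph.Dart, (W.darts.map SimpleGraph.Dart.symm).count g =
      W.darts.count g.symm := by
    intro g
    conv_lhs => rw [← SimpleGraph.Dart.symm_symm g]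
    exact List.count_map_of_injective _ _ SimpleGraph.Dart.symm_involutive.injective _
  simp only [flow, SimpleGraph.Walk.darts_reverse, List.count_reverse, key,
    SimpleGraph.Dart.symm_symm]
  ring

@[simp]
theorem flow_nil (d : M.graph.Dart) : M.flow (.nil : M.graph.Walk a a) d = 0 := by
  simp [flow]

@[simp]
theorem flow_copy {a' b' : V} (W : M.graph.Walk a b) (h : a = a') (h' : b = b') :
    M.flow (W.copy h h') = M.flow W := by
  subst h h'; rfl

variable {E : Set M.graph.Dart}

-- The pairing telescopes along the walk. For a closed walk it vanishes, which is the circulation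
-- condition of `PlanarMap.exists_isPotential`.
open Classical in
theorem IsOrientation.sum_flow [Finite V] (hE : M.IsOrientation E) (W : M.graph.Walk a b)
    (g : V → ℚ) : ∑ d with d ∈ E, (M.flow W d : ℚ) * (g d.snd - g d.fst) = g b - g a := by
  induction W with
  | nil => simp
  | @cons x y z h W ih =>
    have : ∑ d with d ∈ E, (M.flow (.cons h .nil : M.graph.Walk x y) d : ℚ) *
        (g d.snd - g d.fst) = g y - g x := by
      let d₀ : M.graph.Dart := ⟨(x, y), h⟩
      have hne : d₀ ≠ d₀.symm := (SimpleGraph.Dart.symm_ne _).symm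
      have hf : ∀ d, M.flow (.cons h .nil : M.graph.Walk x y) d =
          (if d = d₀ then 1 else 0) - (if d = d₀.symm then 1 else 0) := by
        intro d
        have e : d = d₀.symm ↔ d.symm = d₀ :=
          ⟨fun h => by rw [h, SimpleGraph.Dart.symm_symm], fun h => by
            rw [← h, SimpleGraph.Dart.symm_symm]⟩
        simp only [flow, SimpleGraph.Walk.darts_cons, SimpleGraph.Walk.darts_nil,
          List.count_singleton, e]
        simp only [beq_iff_eq, eq_comm (a := d₀), Nat.cast_ite, Nat.cast_one, Nat.cast_zero, d₀]
      simp only [hf]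
      push_cast
      simp only [sub_mul, ite_mul, one_mul, zero_mul, Finset.sum_sub_distrib,
        Finset.sum_ite_eq', Finset.mem_filter, Finset.mem_univ, true_and]
      by_cases hd : d₀ ∈ E
      · have hd' : d₀.symm ∉ E := fun h => (hE _).1 h hd
        simp only [hd, hd', if_true, if_false, sub_zero]; rfl
      · have hd' : d₀.symm ∈ E := (hE _).2 hd
        simp only [hd, hd', if_true, if_false]
        change _ - (g x - g y) = _
        ring
    have e : ∀ d, (M.flow (.cons h W) d : ℚ) * (g d.snd - g d.fst) =
        (M.flow (.cons h .nil : M.graph.Walk x y) d : ℚ) * (g d.snd - g d.fst) +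
        (M.flow W d : ℚ) * (g d.snd - g d.fst) := by
      intro d; rw [flow_cons]; push_cast; ring
    simp only [e, Finset.sum_add_distrib, this, ih]
    ring

/-- Potentials of the same flow differ by a constant, so winding numbers relative to the root face
do not depend on the choice of the potential. -/
theorem IsPotential.sub_eq [Finite V] {φ : M.graph.Dart → ℤ} {h h' : M.Face → ℤ}
    (hh : M.IsPotential φ h) (hh' : M.IsPotential φ h') (f f' : M.Face) :
    h f - h f' = h' f - h' f' := by
  have := M.const_of_leftFace_eq_rightFace (fun f => h f - h' f)
    (fun d => by linarith [hh d, hh' d]) f f'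
  linarith

section Cycle

variable {C : M.graph.Walk a a}

theorem _root_.SimpleGraph.Walk.IsCycle.eq_of_snd_eq (hC : C.IsCycle) {d d' : M.graph.Dart}
    (hd : d ∈ C.darts) (hd' : d' ∈ C.darts) (h : d.snd = d'.snd) : d = d' := by
  have := hC.support_nodup
  rw [← SimpleGraph.Walk.map_snd_darts] at this
  exact List.inj_on_of_nodup_map this hd hd' h

theorem _root_.SimpleGraph.Walk.IsCycle.eq_of_fst_eq (hC : C.IsCycle) {d d' : M.graph.Dart}
    (hd : d ∈ C.darts) (hd' : d' ∈ C.darts) (h : d.fst = d'.fst) : d = d' := by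
  have := hC.nodup_dropLast_support
  rw [← SimpleGraph.Walk.map_fst_darts] at this
  exact List.inj_on_of_nodup_map this hd hd' h

theorem _root_.SimpleGraph.Walk.IsCycle.symm_notMem (hC : C.IsCycle) {d : M.graph.Dart}
    (hd : d ∈ C.darts) : d.symm ∉ C.darts := by
  intro hd'
  have := List.inj_on_of_nodup_map hC.edges_nodup hd hd' (SimpleGraph.Dart.edge_symm d).symm
  exact SimpleGraph.Dart.symm_ne d this.symm

theorem _root_.SimpleGraph.Walk.IsCycle.exists_dart_snd (hC : C.IsCycle) {x : V}
    (hx : x ∈ C.support) : ∃ d ∈ C.darts, d.snd = x := by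
  have h : x ∈ C.support.tail := by
    rw [← SimpleGraph.Walk.cons_tail_support] at hx
    rcases List.mem_cons.1 hx with rfl | h
    · exact SimpleGraph.Walk.end_mem_tail_support hC.not_nil
    · exact h
  rw [← SimpleGraph.Walk.map_snd_darts] at h
  simpa using h

theorem _root_.SimpleGraph.Walk.IsCycle.exists_dart_fst (hC : C.IsCycle) {x : V}
    (hx : x ∈ C.support) : ∃ d ∈ C.darts, d.fst = x := by
  obtain ⟨d, hd, rfl⟩ := hC.reverse.exists_dart_snd (x := x) (by simpa using hx)
  refine ⟨d.symm, by simpa using hd, rfl⟩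

theorem mem_edges_iff {W : M.graph.Walk a b} {d : M.graph.Dart} :
    d.edge ∈ W.edges ↔ d ∈ W.darts ∨ d.symm ∈ W.darts := by
  constructor
  · intro h
    obtain ⟨g, hg, he⟩ := List.mem_map.1 h
    rcases (SimpleGraph.dart_edge_eq_iff g d).1 he with rfl | rfl
    · exact Or.inl hg
    · exact Or.inr hg
  · rintro (h | h)
    · exact List.mem_map_of_mem h
    · rw [← SimpleGraph.Dart.edge_symm]; exact List.mem_map_of_mem h

theorem _root_.SimpleGraph.Walk.IsCycle.flow_eq_one (hC : C.IsCycle) {d : M.graph.Dart}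
    (hd : d ∈ C.darts) : M.flow C d = 1 := by
  classical
  rw [flow, List.count_eq_zero_of_not_mem (hC.symm_notMem hd),
    List.count_eq_one_of_mem (hC.edges_nodup.of_map _) hd]
  simp

theorem flow_eq_zero {W : M.graph.Walk a b} {d : M.graph.Dart} (hd : d.edge ∉ W.edges) :
    M.flow W d = 0 := by
  classical
  rw [mem_edges_iff, not_or] at hd
  rw [flow, List.count_eq_zero_of_not_mem hd.1, List.count_eq_zero_of_not_mem hd.2]
  simp

theorem AdjOff.symm {W : M.graph.Walk a a} {f g : M.Face} (h : M.AdjOff W f g) :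
    M.AdjOff W g f := by
  obtain ⟨d, hd, rfl, rfl⟩ := h
  exact ⟨d.symm, by rwa [SimpleGraph.Dart.edge_symm], rfl, by simp [M.rightFace_symm]⟩

theorem reflTransGen_adjOff_symm {W : M.graph.Walk a a} {f g : M.Face}
    (h : Relation.ReflTransGen (M.AdjOff W) f g) : Relation.ReflTransGen (M.AdjOff W) g f :=
  have : Std.Symm (M.AdjOff W) := ⟨fun _ _ h => h.symm⟩
  Relation.ReflTransGen.stdSymm.symm _ _ h

theorem adjOff_reverse (W : M.graph.Walk a a) : M.AdjOff W.reverse = M.AdjOff W := by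
  ext f g; simp [AdjOff]

theorem leftFaces_reverse (W : M.graph.Walk a a) : M.leftFaces W.reverse = M.rightFaces W := by
  ext f
  simp only [leftFaces, rightFaces, adjOff_reverse, Set.mem_ofPred_eq]
  constructor
  · rintro ⟨d, hd, h⟩
    exact ⟨d.symm, by simpa using hd, by rwa [M.rightFace_symm]⟩
  · rintro ⟨d, hd, h⟩
    exact ⟨d.symm, by simpa using hd, h⟩

/-- Rotating clockwise at the common vertex from `d.symm` to `d'` crosses only edges off the cycle
and sweeps exactly the corners on its left. -/
theorem _root_.SimpleGraph.Walk.IsCycle.reflTransGen_leftFace_succ [Finite V] (hC : C.IsCycle)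
    {d d' : M.graph.Dart} (hd : d ∈ C.darts) (hd' : d' ∈ C.darts) (h : d.snd = d'.fst) :
    Relation.ReflTransGen (M.AdjOff C) (M.leftFace d) (M.leftFace d') := by
  have hfst : (M.rot.symm d').fst = d'.fst := by
    rw [← M.rot_fst (M.rot.symm d'), Equiv.apply_symm_apply]
  have hrot : M.leftFace (M.rot d.symm) = M.leftFace d := M.leftFace_faceNext d
  have key := M.rot_induction (d := d.symm) (d' := M.rot.symm d')
    -- The first alternative records that `d'` has already been met, since the induction runs around
    -- the whole vertex.
    (p := fun g => Relation.ReflTransGen (M.AdjOff C) (M.leftFace d) (M.leftFace d') ∨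
      Relation.ReflTransGen (M.AdjOff C) (M.leftFace d) (M.leftFace (M.rot g)))
    (Or.inr (by rw [hrot])) (by rw [hfst, ← h]; rfl) ?_
  · rcases key with key | key
    · exact key
    · rwa [Equiv.apply_symm_apply] at key
  · rintro g hg (h1 | h1)
    · exact Or.inl h1
    · by_cases h2 : M.rot g = d'
      · exact Or.inl (h2 ▸ h1)
      by_cases h3 : M.rot g = d.symm
      · rw [h3, hrot]; exact Or.inr .refl
      refine Or.inr (h1.tail ⟨M.rot g, ?_, rfl, (M.leftFace_rot _).symm⟩)
      rw [mem_edges_iff]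
      have hg' : (M.rot g).fst = d.snd := by rw [M.rot_fst, hg]; rfl
      rintro (h4 | h4)
      · exact h2 (hC.eq_of_fst_eq h4 hd' (hg'.trans h))
      · exact h3 (by rw [← hC.eq_of_snd_eq h4 hd hg', SimpleGraph.Dart.symm_symm])

theorem _root_.SimpleGraph.Walk.IsCycle.reflTransGen_leftFace [Finite V] (hC : C.IsCycle)
    {d d' : M.graph.Dart} (hd : d ∈ C.darts) (hd' : d' ∈ C.darts) :
    Relation.ReflTransGen (M.AdjOff C) (M.leftFace d) (M.leftFace d') := by
  have hl : 0 < C.darts.length := List.length_pos_of_mem hd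
  have key : ∀ k (hk : k < C.darts.length), Relation.ReflTransGen (M.AdjOff C)
      (M.leftFace C.darts[0]) (M.leftFace C.darts[k]) := by
    intro k
    induction k with
    | zero => intro _; exact .refl
    | succ k ih =>
      intro hk
      exact (ih (by omega)).trans (hC.reflTransGen_leftFace_succ (List.getElem_mem _)
        (List.getElem_mem _) (List.isChain_iff_getElem.1 C.isChain_dartAdj_darts k hk))
  obtain ⟨k, hk, rfl⟩ := List.getElem_of_mem hd
  obtain ⟨k', hk', rfl⟩ := List.getElem_of_mem hd'
  exact (reflTransGen_adjOff_symm (key k hk)).trans (key k' hk')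

theorem _root_.SimpleGraph.Walk.IsCycle.reflTransGen_leftFace_of_mem [Finite V] (hC : C.IsCycle)
    {d : M.graph.Dart} (hd : d ∈ C.darts) {f : M.Face} (hf : f ∈ M.leftFaces C) :
    Relation.ReflTransGen (M.AdjOff C) (M.leftFace d) f := by
  obtain ⟨d', hd', h⟩ := hf
  exact (hC.reflTransGen_leftFace hd hd').trans h

theorem _root_.SimpleGraph.Walk.IsCycle.exists_dart (hC : C.IsCycle) : ∃ d, d ∈ C.darts :=
  (hC.exists_dart_snd C.start_mem_support).imp fun _ h => h.1

/-- The union of the two sides is closed under crossing edges: an edge of `C` has one face on each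
side, and any other edge preserves the side by definition. The dual graph is connected. -/
theorem mem_leftFaces_or_mem_rightFaces [Finite V] (hC : C.IsCycle) (f : M.Face) :
    f ∈ M.leftFaces C ∨ f ∈ M.rightFaces C := by
  obtain ⟨d, hd⟩ := hC.exists_dart
  have step : ∀ d : M.graph.Dart, M.leftFace d ∈ M.leftFaces C ∨ M.leftFace d ∈ M.rightFaces C →
      M.rightFace d ∈ M.leftFaces C ∨ M.rightFace d ∈ M.rightFaces C := by
    intro d h
    by_cases hdC : d.edge ∈ C.edges
    · rcases mem_edges_iff.1 hdC with h1 | h1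
      · exact Or.inr ⟨d, h1, .refl⟩
      · exact Or.inl ⟨d.symm, h1, .refl⟩
    · rcases h with ⟨g, hg, h⟩ | ⟨g, hg, h⟩
      · exact Or.inl ⟨g, hg, h.tail ⟨d, hdC, rfl, rfl⟩⟩
      · exact Or.inr ⟨g, hg, h.tail ⟨d, hdC, rfl, rfl⟩⟩
  refine (M.const_of_leftFace_eq_rightFace
    (fun f => f ∈ M.leftFaces C ∨ f ∈ M.rightFaces C) (fun d => ?_) (M.leftFace d) f).mp
      (Or.inl ⟨d, hd, .refl⟩)
  refine propext ⟨step d, fun h => ?_⟩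
  have := step d.symm h
  rwa [M.rightFace_symm] at this

end Cycle

end RotationSystem

/-! ### The Jordan curve theorem -/

namespace PlanarMap

open RotationSystem

variable {V : Type*} {M : PlanarMap V} {E : Set M.graph.Dart} {a : V} {C : M.graph.Walk a a}

variable (M) in
/-- `h` is the indicator function of the left side of the simple cycle `C`. -/
structure IsSide (C : M.graph.Walk a a) (h : M.Face → ℤ) : Prop where
  pot : M.IsPotential (M.flow C) h
  left : ∀ f, f ∈ M.leftFaces C ↔ h f = 1
  right : ∀ f, f ∈ M.rightFaces C ↔ h f = 0

/-- The Jordan curve theorem for planar maps. -/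
theorem exists_isSide [Finite V] (hE : M.IsOrientation E) (hC : C.IsCycle) :
    ∃ h, M.IsSide C h := by
  obtain ⟨h, hh⟩ := M.exists_isPotential hE (M.flow C) (flow_symm C)
    (fun g => by rw [hE.sum_flow, sub_self])
  obtain ⟨d, hd⟩ := hC.exists_dart
  have hadj : ∀ f g, Relation.ReflTransGen (M.AdjOff C) f g → h f = h g := by
    intro f g hfg
    induction hfg with
    | refl => rfl
    | tail _ hg ih =>
      obtain ⟨d, hd, rfl, rfl⟩ := hg
      rw [ih]; linarith [hh d, flow_eq_zero hd]
  have hl : ∀ f ∈ M.leftFaces C, h f = h (M.leftFace d) := fun f hf =>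
    (hadj _ _ (hC.reflTransGen_leftFace_of_mem hd hf)).symm
  have hr : ∀ f ∈ M.rightFaces C, h f = h (M.leftFace d) - 1 := by
    rintro f ⟨d', hd', h'⟩
    rw [← hadj _ _ h', ← hl _ ⟨d', hd', .refl⟩]
    linarith [hh d', hC.flow_eq_one hd']
  refine ⟨fun f => h f - h (M.leftFace d) + 1, fun d' => by linarith [hh d'], fun f => ?_,
    fun f => ?_⟩
  · refine ⟨fun hf => by linarith [hl f hf], fun hf => ?_⟩
    rcases mem_leftFaces_or_mem_rightFaces hC f with h1 | h1
    · exact h1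
    · linarith [hr f h1]
  · refine ⟨fun hf => by linarith [hr f hf], fun hf => ?_⟩
    rcases mem_leftFaces_or_mem_rightFaces hC f with h1 | h1
    · linarith [hl f h1]
    · exact h1

theorem IsSide.eq_one_or [Finite V] {h : M.Face → ℤ} (hs : M.IsSide C h) (hC : C.IsCycle)
    (f : M.Face) : h f = 1 ∨ h f = 0 :=
  (mem_leftFaces_or_mem_rightFaces hC f).imp (hs.left f).1 (hs.right f).1

end PlanarMap

/-! ### Euler's formula on one side of a cycle -/

theorem Set.ncard_eq_sum_fiber {α β : Type*} [Finite α] (S : Set α) (f : α → β) (t : Finset β)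
    (h : ∀ a ∈ S, f a ∈ t) : S.ncard = ∑ b ∈ t, {a | a ∈ S ∧ f a = b}.ncard := by
  classical
  have := Fintype.ofFinite α
  rw [Set.ncard_eq_toFinset_card' S,
    Finset.card_eq_sum_card_fiberwise (f := f) (t := t) (fun a ha => h a (by simpa using ha))]
  refine Finset.sum_congr rfl fun b _ => ?_
  rw [Set.ncard_eq_toFinset_card']
  congr 1
  ext a; simp

namespace RotationSystem

variable {V : Type*} (M : RotationSystem V)

/-- The vertices all of whose corners lie in the set of faces `R`. -/
def innerVertices (R : Set M.Face) : Set V := {x | ∀ d : M.graph.Dart, d.fst = x → M.leftFace d ∈ R}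

/-- The darts of `E` that have a face of `R` on both sides. -/
def innerDarts (E : Set M.graph.Dart) (R : Set M.Face) : Set M.graph.Dart :=
  {d | d ∈ E ∧ M.leftFace d ∈ R ∧ M.rightFace d ∈ R}

variable {M} {E : Set M.graph.Dart}

theorem IsOrientation.ncard_symm_closed [Finite V] (hE : M.IsOrientation E)
    {S : Set M.graph.Dart} (hS : ∀ d ∈ S, d.symm ∈ S) : S.ncard = 2 * (E ∩ S).ncard := by
  have h1 : S = (E ∩ S) ∪ SimpleGraph.Dart.symm '' (E ∩ S) := by
    ext d
    constructor
    · intro hd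
      by_cases h : d ∈ E
      · exact Or.inl ⟨h, hd⟩
      · exact Or.inr ⟨d.symm, ⟨(hE d).2 h, hS d hd⟩, SimpleGraph.Dart.symm_symm d⟩
    · rintro (h | ⟨g, h, rfl⟩)
      · exact h.2
      · exact hS g h.2
  have h2 : Disjoint (E ∩ S) (SimpleGraph.Dart.symm '' (E ∩ S)) := by
    rw [Set.disjoint_left]
    rintro _ ⟨h, -⟩ ⟨g, hg, rfl⟩
    exact (hE g).1 h hg.1
  conv_lhs => rw [h1]
  rw [Set.ncard_union_eq h2,
    Set.ncard_image_of_injective _ SimpleGraph.Dart.symm_involutive.injective, two_mul]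

theorem IsOrientation.ncard_edges [Finite V] (hE : M.IsOrientation E) {a : V}
    {C : M.graph.Walk a a} (hC : C.IsCycle) : {d | d ∈ E ∧ d.edge ∈ C.edges}.ncard = C.length := by
  classical
  have h1 : (C.darts.toFinset : Set M.graph.Dart).ncard = C.length := by
    rw [Set.ncard_coe_finset, List.toFinset_card_of_nodup (hC.edges_nodup.of_map _),
      SimpleGraph.Walk.length_darts]
  rw [← h1]
  refine Set.ncard_congr (fun d _ => if d ∈ C.darts then d else d.symm) ?_ ?_ ?_
  · rintro d ⟨-, hd⟩
    rw [mem_edges_iff] at hd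
    split_ifs with h
    · simpa using h
    · simpa using hd.resolve_left h
  · rintro d g ⟨hd, hd'⟩ ⟨hg, hg'⟩ h
    have hn : d ≠ g.symm := fun h => (hE g).1 (h ▸ hd) hg
    split_ifs at h with h1 h2 h2
    · exact h
    · exact absurd h hn
    · exact absurd (by rw [← h, SimpleGraph.Dart.symm_symm]) hn
    · exact SimpleGraph.Dart.symm_involutive.injective h
  · intro d hd
    have hd : d ∈ C.darts := by simpa using hd
    by_cases hdE : d ∈ E
    · exact ⟨d, ⟨hdE, mem_edges_iff.2 (Or.inl hd)⟩, by rw [if_pos hd]⟩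
    · refine ⟨d.symm, ⟨(hE d).2 hdE, mem_edges_iff.2 (Or.inr (by simpa using hd))⟩, ?_⟩
      rw [if_neg (hC.symm_notMem hd), SimpleGraph.Dart.symm_symm]

end RotationSystem

namespace PlanarMap

open RotationSystem

variable {V : Type*} {M : PlanarMap V} {E : Set M.graph.Dart} {a : V} {C : M.graph.Walk a a}

/-- The left side is connected across edges off `C` because the faces immediately left of `C` are
joined by `IsCycle.reflTransGen_leftFace`. A vertex of `C` has a corner on the right, so it serves
as the vertex outside the inner ones. -/
theorem isRegion_leftFaces [Finite V] (hE : M.IsOrientation E) (hC : C.IsCycle)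
    {d : M.graph.Dart} (hd : d ∈ C.darts) :
    M.IsRegion E (M.leftFaces C) (M.innerVertices (M.leftFaces C)) (M.leftFace d) := by
  obtain ⟨h, hs⟩ := exists_isSide hE hC
  refine ⟨⟨d.fst, fun hx => ?_⟩, ?_, ?_⟩
  · have h1 := (hs.left _).1 (hx (M.rot d) (M.rot_fst d))
    rw [M.leftFace_rot] at h1
    have h2 := (hs.right (M.rightFace d)).1 ⟨d, hd, .refl⟩
    omega
  · rintro g - (hg | hg)
    · exact ⟨hg g rfl, by rw [← M.leftFace_rot]; exact hg _ (M.rot_fst g)⟩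
    · have := hg (M.rot g.symm) (M.rot_fst g.symm)
      rw [M.leftFace_rot, M.rightFace_symm] at this
      exact ⟨this, hg g.symm rfl⟩
  · intro g hg f hf
    have h1 := hC.reflTransGen_leftFace_of_mem hd hf
    clear hf
    induction h1 with
    | refl => rfl
    | @tail b c hb hc ih =>
      have hbL : b ∈ M.leftFaces C := ⟨d, hd, hb⟩
      have hcL : c ∈ M.leftFaces C := ⟨d, hd, hb.tail hc⟩
      obtain ⟨d', hd', rfl, rfl⟩ := hc
      rw [← ih]
      by_cases hdE : d' ∈ E
      · exact (hg d' hdE hbL hcL).symm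
      · have := hg _ ((hE d').2 hdE) hcL (by rwa [M.rightFace_symm])
        rwa [M.leftFace_symm, M.rightFace_symm] at this

theorem mem_innerVertices_or [Finite V] (hE : M.IsOrientation E) (hC : C.IsCycle) {x : V}
    (hx : x ∉ C.support) :
    x ∈ M.innerVertices (M.leftFaces C) ∨ x ∈ M.innerVertices (M.rightFaces C) := by
  obtain ⟨h, hs⟩ := exists_isSide hE hC
  have step : ∀ g : M.graph.Dart, g.fst = x → h (M.leftFace (M.rot g)) = h (M.leftFace g) := by
    intro g hg
    have h1 : M.flow C g = 0 := flow_eq_zero fun h => hx (by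
      rw [← hg]; exact SimpleGraph.Walk.fst_mem_support_of_mem_edges C h)
    rw [M.leftFace_rot]; linarith [hs.pot g]
  by_cases hd : ∃ d : M.graph.Dart, d.fst = x
  · obtain ⟨d, rfl⟩ := hd
    have hall : ∀ d' : M.graph.Dart, d'.fst = d.fst → h (M.leftFace d') = h (M.leftFace d) :=
      fun d' hd' => M.rot_induction (p := fun g => h (M.leftFace g) = h (M.leftFace d)) rfl hd'.symm
        (fun g hg h1 => by rw [step g hg, h1])
    refine (hs.eq_one_or hC (M.leftFace d)).imp (fun h1 g hg => ?_) (fun h1 g hg => ?_)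
    · rw [hs.left, hall g hg, h1]
    · rw [hs.right, hall g hg, h1]
  · exact Or.inl fun d h => absurd ⟨d, h⟩ hd

theorem ncard_support_le [Finite V] (hC : C.IsCycle) : {x | x ∈ C.support}.ncard = C.length := by
  classical
  have : {x | x ∈ C.support} = (C.support.tail.toFinset : Set V) := by
    ext x
    simp only [Set.mem_ofPred_eq, List.coe_toFinset]
    refine ⟨fun h => ?_, List.mem_of_mem_tail⟩
    obtain ⟨d, hd, rfl⟩ := hC.exists_dart_snd h
    rw [← SimpleGraph.Walk.map_snd_darts]
    exact List.mem_map_of_mem hd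
  rw [this, Set.ncard_coe_finset, List.toFinset_card_of_nodup hC.support_nodup, List.length_tail,
    SimpleGraph.Walk.length_support, Nat.add_sub_cancel]

/-- Euler's formula for the right side of a simple cycle. -/
theorem euler_rightFaces [Finite V] (hE : M.IsOrientation E) (hC : C.IsCycle) :
    (M.rightFaces C).ncard + (M.innerVertices (M.rightFaces C)).ncard =
      (M.innerDarts E (M.rightFaces C)).ncard + 1 := by
  obtain ⟨h, hs⟩ := exists_isSide hE hC
  obtain ⟨d, hd⟩ := hC.exists_dart
  -- Each side satisfies Euler's formula as an inequality. Since the cycle partitions faces,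
  -- vertices and edges, the sum of the two inequalities is Euler's formula of the sphere, so both
  -- are equalities.
  have hL := (isRegion_leftFaces hE hC hd).ncard_add_ncard_le hE
  have hR := (isRegion_leftFaces hE hC.reverse (d := d.symm)
    (by simpa using hd)).ncard_add_ncard_le hE
  rw [leftFaces_reverse] at hR
  change _ ≤ (M.innerDarts E (M.leftFaces C)).ncard + 1 at hL
  change _ ≤ (M.innerDarts E (M.rightFaces C)).ncard + 1 at hR
  have hF : (M.leftFaces C).ncard + (M.rightFaces C).ncard = Nat.card M.Face := by
    rw [← Set.ncard_univ, ← Set.ncard_union_eq]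
    · congr 1
      exact Set.eq_univ_of_forall fun f => mem_leftFaces_or_mem_rightFaces hC f
    · rw [Set.disjoint_left]
      intro f h1 h2
      have h1 := (hs.left f).1 h1
      have h2 := (hs.right f).1 h2
      omega
  have hV : Nat.card V ≤ (M.innerVertices (M.leftFaces C)).ncard +
      (M.innerVertices (M.rightFaces C)).ncard + C.length := by
    rw [← ncard_support_le hC, ← Set.ncard_univ]
    refine le_trans (Set.ncard_le_ncard (t := (M.innerVertices (M.leftFaces C) ∪
      M.innerVertices (M.rightFaces C)) ∪ {x | x ∈ C.support}) fun x _ => ?_) ?_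
    · by_cases hx : x ∈ C.support
      · exact Or.inr hx
      · exact Or.inl (mem_innerVertices_or hE hC hx)
    · exact (Set.ncard_union_le _ _).trans (Nat.add_le_add_right (Set.ncard_union_le _ _) _)
  have hEE : (M.innerDarts E (M.leftFaces C)).ncard + (M.innerDarts E (M.rightFaces C)).ncard +
      C.length ≤ Nat.card M.graph.edgeSet := by
    rw [← hE.ncard_eq, ← hE.ncard_edges hC, ← Set.ncard_union_eq, ← Set.ncard_union_eq]
    · refine Set.ncard_le_ncard ?_
      rintro d ((h | h) | h) <;> exact h.1
    · rw [Set.disjoint_left]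
      rintro g hg ⟨-, h2⟩
      have h3 : M.flow C g = 0 := by
        rw [← hs.pot]
        rcases hg with ⟨-, h4, h5⟩ | ⟨-, h4, h5⟩
        · rw [(hs.left _).1 h4, (hs.left _).1 h5]; rfl
        · rw [(hs.right _).1 h4, (hs.right _).1 h5]; rfl
      rcases mem_edges_iff.1 h2 with h4 | h4
      · rw [hC.flow_eq_one h4] at h3; omega
      · have := hC.flow_eq_one h4
        rw [flow_symm, h3] at this; omega
    · rw [Set.disjoint_left]
      rintro g ⟨-, h1, -⟩ ⟨-, h2, -⟩
      have h1 := (hs.left _).1 h1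
      have h2 := (hs.right _).1 h2
      omega
  have := M.euler
  omega

end PlanarMap

/-! ### Edges leaving a cycle into its right side -/

namespace PlantedTriangulation

open RotationSystem

variable {V : Type*} {G : PlantedTriangulation V} {E : Set G.graph.Dart} {a : V}
  {C : G.graph.Walk a a}

theorem leftFace_eq_iff' [Finite V] {d d' : G.graph.Dart} : G.leftFace d' = G.leftFace d ↔
    d' = d ∨ d' = G.faceNext d ∨ d' = G.faceNext (G.faceNext d) := by
  constructor
  · intro h
    obtain ⟨n, rfl⟩ := (G.leftFace_eq_iff.1 h.symm).exists_nat_pow_eq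
    clear h
    induction n with
    | zero => exact Or.inl rfl
    | succ n ih =>
      rw [pow_succ', Equiv.Perm.mul_apply]
      rcases ih with h | h | h <;> rw [h]
      · exact Or.inr (Or.inl rfl)
      · exact Or.inr (Or.inr rfl)
      · exact Or.inl (G.triangle d)
  · rintro (rfl | rfl | rfl) <;> simp only [G.leftFace_faceNext]

theorem faceNext_ne (d : G.graph.Dart) : G.faceNext d ≠ d := by
  intro h
  have := G.faceNext_fst d
  rw [h] at this
  exact d.adj.ne this

theorem faceNext_faceNext_ne (d : G.graph.Dart) : G.faceNext (G.faceNext d) ≠ d := by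
  intro h
  have := G.triangle d
  rw [h] at this
  exact faceNext_ne d this

theorem ncard_leftFace_eq [Finite V] (f : G.Face) : {d | G.leftFace d = f}.ncard = 3 := by
  obtain ⟨d, rfl⟩ := G.leftFace_surjective f
  have : {d' | G.leftFace d' = G.leftFace d} =
      {d, G.faceNext d, G.faceNext (G.faceNext d)} := by
    ext d'; exact leftFace_eq_iff'
  rw [this, Set.ncard_eq_three]
  exact ⟨_, _, _, (faceNext_ne d).symm, (faceNext_faceNext_ne d).symm,
    (faceNext_ne _).symm, rfl⟩

theorem ncard_leftFace_mem [Finite V] (R : Set G.Face) :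
    {d | G.leftFace d ∈ R}.ncard = 3 * R.ncard := by
  classical
  have := Fintype.ofFinite G.Face
  rw [Set.ncard_eq_sum_fiber _ G.leftFace R.toFinset (fun d hd => by simpa using hd),
    Set.ncard_eq_toFinset_card' R, mul_comm, ← smul_eq_mul, ← Finset.sum_const]
  refine Finset.sum_congr rfl fun f hf => ?_
  rw [← ncard_leftFace_eq f]
  congr 1
  ext d
  simp only [Set.mem_ofPred_eq]
  refine ⟨fun h => h.2, fun h => ⟨?_, h⟩⟩
  rw [h]; simpa using hf

theorem ncard_fst_mem [Finite V] (U : Set V) {n : ℕ}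
    (h : ∀ x ∈ U, {d | d ∈ E ∧ d.fst = x}.ncard = n) :
    {d | d ∈ E ∧ d.fst ∈ U}.ncard = n * U.ncard := by
  classical
  have := Fintype.ofFinite V
  rw [Set.ncard_eq_sum_fiber _ (fun d => d.fst) U.toFinset (fun d hd => by simpa using hd.2),
    Set.ncard_eq_toFinset_card' U, mul_comm, ← smul_eq_mul, ← Finset.sum_const]
  refine Finset.sum_congr rfl fun x hx => ?_
  have hx : x ∈ U := by simpa using hx
  rw [← h x hx]
  congr 1
  ext d
  simp only [Set.mem_ofPred_eq]
  exact ⟨fun h => ⟨h.1.1, h.2⟩, fun h => ⟨⟨h.1, h.2 ▸ hx⟩, h.2⟩⟩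

theorem leftFace_root : G.leftFace G.root = G.rootFace := rfl

theorem faceNext_root_fst : (G.faceNext G.root).fst = G.A := G.faceNext_fst _

theorem leftFace_faceNext_root : G.leftFace (G.faceNext G.root) = G.rootFace :=
  G.leftFace_faceNext _

theorem faceNext_faceNext_root_fst : (G.faceNext (G.faceNext G.root)).fst = G.B :=
  G.faceNext_fst _

theorem faceNext_faceNext_root_snd : (G.faceNext (G.faceNext G.root)).snd = G.rootVertex := by
  rw [← G.faceNext_fst, G.triangle]; rfl

theorem leftFace_faceNext_faceNext_root :
    G.leftFace (G.faceNext (G.faceNext G.root)) = G.rootFace := by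
  simp only [G.leftFace_faceNext]; rfl

/-- The darts of `E` that leave a vertex of `C` into the right side of `C`. -/
def rightOut (E : Set G.graph.Dart) (C : G.graph.Walk a a) : Set G.graph.Dart :=
  {d | d ∈ G.innerDarts E (G.rightFaces C) ∧ d.fst ∈ C.support}

/-- Three counts on the right side `R` are combined: Euler's formula; three darts per face, where
inner edges count twice and edges of `C` once; and outdegree 3 at every inner vertex, as the
exceptional vertices all have a corner in the root face, which is on the left. Eliminating faces and
inner vertices leaves length minus 3. -/
theorem IsThreeOrientation.ncard_rightOut [Finite V] (hE : G.IsThreeOrientation E)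
    (hC : C.IsCycle) (hroot : G.rootFace ∈ G.leftFaces C) :
    (rightOut E C).ncard + 3 = C.length := by
  have hO : G.IsOrientation E := hE.orientation
  obtain ⟨h, hs⟩ := PlanarMap.exists_isSide (M := G.toPlanarMap) hO hC
  set R := G.rightFaces C with hR
  have hroot' : G.rootFace ∉ R := fun h' => by
    have h1 := (hs.left _).1 hroot
    have h2 := (hs.right _).1 h'
    omega
  have heuler := PlanarMap.euler_rightFaces (M := G.toPlanarMap) hO hC
  have hsupp : ∀ x ∈ G.innerVertices R, x ∉ C.support := by
    intro x hx hxC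
    obtain ⟨d, hd, rfl⟩ := hC.exists_dart_fst hxC
    have h1 := (hs.right _).1 (hx d rfl)
    have h2 := (hs.left _).1 ⟨d, hd, .refl⟩
    omega
  have hinner : {d | d ∈ E ∧ d.fst ∈ G.innerVertices R}.ncard =
      3 * (G.innerVertices R).ncard := by
    refine ncard_fst_mem _ fun x hx => hE.outdeg x ?_ ?_ ?_ <;> rintro rfl <;> apply hroot'
    · rw [← leftFace_faceNext_root]; exact hx _ faceNext_root_fst
    · rw [← leftFace_faceNext_faceNext_root]; exact hx _ faceNext_faceNext_root_fst
    · exact hx G.root rfl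
  have hsplit : (G.innerDarts E R).ncard =
      {d | d ∈ E ∧ d.fst ∈ G.innerVertices R}.ncard + (rightOut E C).ncard := by
    rw [← Set.ncard_union_eq]
    · congr 1
      ext d
      constructor
      · intro hd
        by_cases hdC : d.fst ∈ C.support
        · exact Or.inr ⟨hd, hdC⟩
        · rcases PlanarMap.mem_innerVertices_or (M := G.toPlanarMap) hO hC hdC with h1 | h1
          · have h1 := (hs.left _).1 (h1 d rfl)
            have h2 := (hs.right _).1 hd.2.1
            omega
          · exact Or.inl ⟨hd.1, h1⟩
      · rintro (⟨hd, hd'⟩ | hd)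
        · exact ⟨hd, hd' d rfl, by rw [← G.leftFace_rot]; exact hd' _ (G.rot_fst d)⟩
        · exact hd.1
    · rw [Set.disjoint_left]
      rintro d ⟨-, h1⟩ ⟨-, h2⟩
      exact hsupp _ h1 h2
  have hdarts : {d | G.leftFace d ∈ R}.ncard = 2 * (G.innerDarts E R).ncard + C.length := by
    have h1 : {d | G.leftFace d ∈ R} = {d | G.leftFace d ∈ R ∧ G.rightFace d ∈ R} ∪
        SimpleGraph.Dart.symm '' {d | d ∈ C.darts} := by
      ext d
      constructor
      · intro hd
        by_cases hd' : G.rightFace d ∈ R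
        · exact Or.inl ⟨hd, hd'⟩
        · refine Or.inr ⟨d.symm, ?_, SimpleGraph.Dart.symm_symm d⟩
          have h1 := hs.pot d
          rw [(hs.right _).1 hd] at h1
          have h2 := (hs.eq_one_or hC (G.rightFace d)).resolve_right
            (fun h => hd' ((hs.right _).2 h))
          have h3 : d.edge ∈ C.edges := by
            by_contra h
            have := flow_eq_zero h
            omega
          rcases mem_edges_iff.1 h3 with h4 | h4
          · have := hC.flow_eq_one h4; omega
          · exact h4
      · rintro (h | ⟨d, hd, rfl⟩)
        · exact h.1
        · exact ⟨d, hd, .refl⟩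
    rw [h1, Set.ncard_union_eq, hO.ncard_symm_closed,
      Set.ncard_image_of_injective _ SimpleGraph.Dart.symm_involutive.injective]
    · congr 1
      classical
      have : {d | d ∈ C.darts} = (C.darts.toFinset : Set G.graph.Dart) := by ext; simp
      rw [this, Set.ncard_coe_finset, List.toFinset_card_of_nodup (hC.edges_nodup.of_map _),
        SimpleGraph.Walk.length_darts]
    · rintro d ⟨h1, h2⟩
      exact ⟨h2, by rwa [G.rightFace_symm]⟩
    · rw [Set.disjoint_left]
      rintro _ ⟨-, h1⟩ ⟨d, hd, rfl⟩
      rw [G.rightFace_symm] at h1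
      have h1 := (hs.right _).1 h1
      have h2 := (hs.left _).1 ⟨d, hd, .refl⟩
      omega
  rw [ncard_leftFace_mem] at hdarts
  change R.ncard + (G.innerVertices R).ncard = (G.innerDarts E R).ncard + 1 at heuler
  omega

end PlantedTriangulation

/-! ### Rotating around a vertex of a cycle -/

namespace RotationSystem

variable {V : Type*} {M : RotationSystem V} {E : Set M.graph.Dart} {a : V}
  {C : M.graph.Walk a a}

theorem _root_.SimpleGraph.Walk.IsCycle.flow_nonneg (hC : C.IsCycle) {d g : M.graph.Dart}
    (hd : d ∈ C.darts) (hg : g.fst = d.snd) (hne : g ≠ d.symm) : 0 ≤ M.flow C g := by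
  by_cases h : g.edge ∈ C.edges
  · rcases mem_edges_iff.1 h with h1 | h1
    · rw [hC.flow_eq_one h1]; exact zero_le_one
    · exact absurd (by rw [← hC.eq_of_snd_eq h1 hd hg, SimpleGraph.Dart.symm_symm]) hne
  · rw [flow_eq_zero h]

theorem _root_.SimpleGraph.Walk.IsCycle.flow_eq_ite [DecidableEq M.graph.Dart] (hC : C.IsCycle)
    {d d' g : M.graph.Dart} (hd : d ∈ C.darts) (hd' : d' ∈ C.darts) (h : d.snd = d'.fst)
    (hg : g.fst = d'.fst) :
    M.flow C g = (if g = d' then 1 else 0) - (if g = d.symm then 1 else 0) := by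
  have hdd : d' ≠ d.symm := fun h => hC.symm_notMem hd (h ▸ hd')
  by_cases h1 : g = d'
  · rw [if_pos h1, if_neg (h1 ▸ hdd), h1, hC.flow_eq_one hd', sub_zero]
  by_cases h2 : g = d.symm
  · rw [if_neg h1, if_pos h2, h2, flow_symm, hC.flow_eq_one hd, zero_sub]
  · rw [if_neg h1, if_neg h2, flow_eq_zero, sub_zero]
    rw [mem_edges_iff]
    rintro (h3 | h3)
    · exact h1 (hC.eq_of_fst_eq h3 hd' hg)
    · exact h2 (by rw [← hC.eq_of_snd_eq h3 hd (hg.trans h.symm), SimpleGraph.Dart.symm_symm])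

theorem IsPotential.rot_pow {φ : M.graph.Dart → ℤ} {h : M.Face → ℤ} (hh : M.IsPotential φ h)
    (s : M.graph.Dart) (n : ℕ) : h (M.leftFace ((M.rot ^ n) s)) =
      h (M.leftFace s) - ∑ b ∈ Finset.range n, φ ((M.rot ^ b) s) := by
  induction n with
  | zero => simp
  | succ n ih =>
    rw [pow_succ', Equiv.Perm.mul_apply, M.leftFace_rot, Finset.sum_range_succ]
    linarith [hh ((M.rot ^ n) s)]

/-- Rotating past both edges of a cycle at a vertex leads back to the same side. -/
theorem IsPotential.rot_pow_eq {h : M.Face → ℤ} (hh : M.IsPotential (M.flow C) h)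
    (hC : C.IsCycle) {d d' s : M.graph.Dart} (hd : d ∈ C.darts) (hd' : d' ∈ C.darts)
    (hdd : d.snd = d'.fst) (hs : s.fst = d'.fst) {n b c : ℕ}
    (hinj : ∀ i < n, ∀ j < n, (M.rot ^ i) s = (M.rot ^ j) s → i = j)
    (hb : b < n) (hbd : (M.rot ^ b) s = d') (hc : c < n) (hcd : (M.rot ^ c) s = d.symm) :
    h (M.leftFace ((M.rot ^ n) s)) = h (M.leftFace s) := by
  classical
  rw [hh.rot_pow, sub_eq_self]
  have e : ∀ i ∈ Finset.range n, M.flow C ((M.rot ^ i) s) =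
      (if i = b then 1 else 0) - (if i = c then 1 else 0) := by
    intro i hi
    rw [hC.flow_eq_ite hd hd' hdd (by rw [M.rot_pow_fst, hs])]
    have hi := Finset.mem_range.1 hi
    have e1 : (M.rot ^ i) s = d' ↔ i = b :=
      ⟨fun h => hinj i hi b hb (h.trans hbd.symm), fun h => h ▸ hbd⟩
    have e2 : (M.rot ^ i) s = d.symm ↔ i = c :=
      ⟨fun h => hinj i hi c hc (h.trans hcd.symm), fun h => h ▸ hcd⟩
    simp only [e1, e2]
  rw [Finset.sum_congr rfl e, Finset.sum_sub_distrib, Finset.sum_ite_eq', Finset.sum_ite_eq',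
    if_pos (Finset.mem_range.2 hb), if_pos (Finset.mem_range.2 hc), sub_self]

/-- Rotating without meeting the incoming edge of a cycle, one does not get from the right to the
left. -/
theorem IsPotential.exists_of_lt {h : M.Face → ℤ} (hh : M.IsPotential (M.flow C) h)
    (hC : C.IsCycle) {d s : M.graph.Dart} (hd : d ∈ C.darts) (hs : s.fst = d.snd) {n : ℕ}
    (hlt : h (M.leftFace s) < h (M.leftFace ((M.rot ^ n) s))) :
    ∃ c < n, (M.rot ^ c) s = d.symm := by
  by_contra! hne
  rw [hh.rot_pow] at hlt
  have : 0 ≤ ∑ b ∈ Finset.range n, M.flow C ((M.rot ^ b) s) :=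
    Finset.sum_nonneg fun i hi =>
      hC.flow_nonneg hd (by rw [M.rot_pow_fst, hs]) (hne i (Finset.mem_range.1 hi))
  omega

theorem exists_rot_pow_minimal [Finite V] {s g : M.graph.Dart} (h : s.fst = g.fst) :
    ∃ n, (M.rot ^ n) s = g ∧ (∀ i < n, (M.rot ^ i) s ≠ g) ∧
      ∀ i < n, ∀ j < n, (M.rot ^ i) s = (M.rot ^ j) s → i = j := by
  classical
  have hex : ∃ n, (M.rot ^ n) s = g := (M.rot_sameCycle s g h).exists_nat_pow_eq
  have hmin : ∀ i < Nat.find hex, (M.rot ^ i) s ≠ g := fun i hi => Nat.find_min hex hi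
  refine ⟨Nat.find hex, Nat.find_spec hex, hmin, ?_⟩
  have key : ∀ i j, i < j → j < Nat.find hex → (M.rot ^ i) s ≠ (M.rot ^ j) s := by
    intro i j hij hj he
    refine hmin (Nat.find hex - j + i) (by omega) ?_
    rw [pow_add, Equiv.Perm.mul_apply, he, ← Equiv.Perm.mul_apply, ← pow_add,
      Nat.sub_add_cancel hj.le]
    exact Nat.find_spec hex
  intro i hi j hj he
  rcases lt_trichotomy i j with h1 | h1 | h1
  · exact absurd he (key i j h1 hj)
  · exact h1
  · exact absurd he.symm (key j i h1 hi)

end RotationSystem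

/-! ### Leftmost steps at a cycle -/

namespace PlantedTriangulation

open RotationSystem

variable {V : Type*} {G : PlantedTriangulation V} {E : Set G.graph.Dart} {a : V}
  {C : G.graph.Walk a a} {h : G.Face → ℤ}

theorem IsFirstOutgoing.fst_eq {d p : G.graph.Dart} (hp : G.IsFirstOutgoing E d p) :
    p.fst = d.snd := by
  obtain ⟨-, k, -, rfl, -⟩ := hp
  rw [G.rot_pow_fst]; rfl

/-- The position of an outgoing dart `g` relative to the first outgoing dart. -/
theorem IsFirstOutgoing.exists_pow [Finite V] (hO : G.IsOrientation E) {d p g : G.graph.Dart}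
    (hd : d ∈ E) (hp : G.IsFirstOutgoing E d p) (hg : g ∈ E) (hgd : g.fst = d.snd) :
    ∃ k n : ℕ, 1 ≤ k ∧ k ≤ n ∧ (g ≠ p → k < n) ∧ (G.rot ^ k) d.symm = p ∧
      (G.rot ^ n) d.symm = g ∧ (∀ i < n, (G.rot ^ i) d.symm ≠ g) ∧
      ∀ i < n, ∀ j < n, (G.rot ^ i) d.symm = (G.rot ^ j) d.symm → i = j := by
  obtain ⟨-, k, hk, hkp, hmin⟩ := hp
  obtain ⟨n, hn, hnlt, hinj⟩ := exists_rot_pow_minimal (M := G.toRotationSystem) (s := d.symm)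
    (g := g) hgd.symm
  have hn0 : n ≠ 0 := by
    rintro rfl
    rw [pow_zero, Equiv.Perm.one_apply] at hn
    exact (hO d).1 (hn ▸ hg) hd
  have hkn : k ≤ n := by
    by_contra! hlt
    exact hmin n (by omega) hlt (hn ▸ hg)
  refine ⟨k, n, hk, hkn, fun hne => lt_of_le_of_ne hkn ?_, hkp, hn, hnlt, hinj⟩
  rintro rfl
  exact hne (hn.symm.trans hkp)

/-- If the leftmost path follows a cycle at an inner vertex, the other outgoing edges are all on the
right-hand side of the path. -/
theorem IsFirstOutgoing.side_of_mem [Finite V] (hO : G.IsOrientation E) (hC : C.IsCycle)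
    (hh : G.IsPotential (G.flow C) h) {d p g : G.graph.Dart} (hd : d ∈ E)
    (hp : G.IsFirstOutgoing E d p) (hg : g ∈ E) (hgd : g.fst = d.snd) (hne : g ≠ p)
    (hdC : d ∈ C.darts ∧ p ∈ C.darts ∨ d.symm ∈ C.darts ∧ p.symm ∈ C.darts) :
    h (G.leftFace g) = h (G.rightFace d) := by
  obtain ⟨k, n, hk, -, hkn, hkp, rfl, -, hinj⟩ := hp.exists_pow hO hd hg hgd
  have hkn := hkn hne
  rw [← G.leftFace_symm]
  rcases hdC with ⟨h1, h2⟩ | ⟨h1, h2⟩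
  · exact hh.rot_pow_eq hC h1 h2 hp.fst_eq.symm hp.fst_eq.symm hinj hkn hkp (by omega : 0 < n) rfl
  · exact hh.rot_pow_eq hC h2 h1 hp.fst_eq rfl hinj (by omega : 0 < n) rfl hkn
      (hkp.trans (SimpleGraph.Dart.symm_symm p).symm)

/-- If the leftmost path, followed backwards by a cycle, leaves the cycle to the left, all outgoing
edges do. -/
theorem IsFirstOutgoing.side_of_leave [Finite V] (hO : G.IsOrientation E) (hC : C.IsCycle)
    (hs : G.toPlanarMap.IsSide C h) {c d p g : G.graph.Dart} (hd : d ∈ E)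
    (hp : G.IsFirstOutgoing E d p) (hg : g ∈ E) (hgd : g.fst = d.snd)
    (hcC : c ∈ C.darts) (hcd : c.snd = d.snd) (hdC : d.symm ∈ C.darts)
    (hp1 : h (G.leftFace p) = 1) :
    h (G.leftFace g) = 1 ∧ g ≠ c.symm := by
  obtain ⟨k, n, hk, hkn, -, hkp, rfl, -, hinj⟩ := hp.exists_pow hO hd hg hgd
  have hl : h (G.leftFace d.symm) = 1 := (hs.left _).1 ⟨_, hdC, .refl⟩
  have hl' : h (G.leftFace (G.rot d.symm)) = 0 := by
    rw [G.leftFace_rot]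
    exact (hs.right _).1 ⟨_, hdC, .refl⟩
  obtain ⟨k, rfl⟩ := Nat.exists_eq_add_of_le' hk
  -- Past `d.symm` the corners are on the right, while `p` is on the left; so the edge `c` is passed
  -- on the way to `p`. Beyond `p` both edges of the cycle have been passed, and the corners are on
  -- the left again.
  obtain ⟨i, hi, hic⟩ := hs.pot.exists_of_lt hC (s := G.rot d.symm) (n := k) hcC
    (by rw [G.rot_fst]; exact hcd.symm) (by
      rw [← Equiv.Perm.mul_apply, ← pow_succ, hkp, hp1, hl']; exact zero_lt_one)
  rw [← Equiv.Perm.mul_apply, ← pow_succ] at hic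
  have := hs.pot.rot_pow_eq hC hcC hdC hcd rfl hinj (by omega : 0 < n) rfl
    (by omega : i + 1 < n) hic
  refine ⟨this.trans hl, fun he => ?_⟩
  have h1 : h (G.leftFace c.symm) = 0 := (hs.right _).1 ⟨c, hcC, .refl⟩
  rw [← he, this, hl] at h1
  omega

/-- If the leftmost path joins a cycle from the right, the other outgoing edges are all on the
right. -/
theorem IsFirstOutgoing.side_of_join [Finite V] (hO : G.IsOrientation E) (hC : C.IsCycle)
    (hs : G.toPlanarMap.IsSide C h) {c d p g : G.graph.Dart} (hd : d ∈ E)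
    (hp : G.IsFirstOutgoing E d p) (hg : g ∈ E) (hgd : g.fst = d.snd) (hne : g ≠ p)
    (hcC : c ∈ C.darts) (hcd : c.snd = d.snd) (hpC : p ∈ C.darts)
    (hd0 : h (G.rightFace d) = 0) :
    h (G.leftFace g) = 0 ∧ g ≠ c.symm := by
  obtain ⟨k, n, hk, -, hkn, hkp, rfl, hmin, hinj⟩ := hp.exists_pow hO hd hg hgd
  have hkn := hkn hne
  have hl : h (G.leftFace p) = 1 := (hs.left _).1 ⟨_, hpC, .refl⟩
  -- The path arrives on the right and the corner before `p` is on the left, so `c` is passed before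
  -- `p`; after `p` the corners are on the right again.
  obtain ⟨i, hi, hic⟩ := hs.pot.exists_of_lt hC (s := d.symm) (n := k) hcC hcd.symm
    (by rw [hkp, hl, G.leftFace_symm, hd0]; exact zero_lt_one)
  refine ⟨?_, fun he => hmin i (hi.trans hkn) (hic.trans he.symm)⟩
  rw [hs.pot.rot_pow_eq hC hcC hpC (hcd.trans hp.fst_eq.symm) hp.fst_eq.symm hinj hkn hkp
    (hi.trans hkn) hic, G.leftFace_symm, hd0]

end PlantedTriangulation

/-! ### Segments of walks -/

namespace SimpleGraph.Walk

variable {V : Type*} {G : SimpleGraph V} {a b : V}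

/-- The part of a walk between two of its positions. -/
def segment (P : G.Walk a b) (i j : ℕ) (hij : i ≤ j) : G.Walk (P.getVert i) (P.getVert j) :=
  ((P.drop i).take (j - i)).copy rfl (by rw [drop_getVert, Nat.add_sub_cancel' hij])

variable {P : G.Walk a b} {i j : ℕ} {hij : i ≤ j}

theorem length_segment (hj : j ≤ P.length) : (P.segment i j hij).length = j - i := by
  simp only [segment, length_copy, take_length, drop_length]; omega

theorem darts_segment : (P.segment i j hij).darts = (P.darts.drop i).take (j - i) := by
  simp [segment, darts_take, darts_drop]

theorem mem_darts_segment {d : G.Dart} : d ∈ (P.segment i j hij).darts ↔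
    ∃ k, i ≤ k ∧ k < j ∧ ∃ h : k < P.darts.length, P.darts[k] = d := by
  rw [darts_segment, List.mem_iff_getElem]
  simp only [List.getElem_take, List.getElem_drop, List.length_take, List.length_drop]
  constructor
  · rintro ⟨k, hk, rfl⟩
    exact ⟨i + k, by omega, by omega, by omega, rfl⟩
  · rintro ⟨k, h1, h2, h3, rfl⟩
    exact ⟨k - i, by omega, by simp only [Nat.add_sub_cancel' h1]⟩

theorem mem_support_segment (hj : j ≤ P.length) {x : V} : x ∈ (P.segment i j hij).support ↔
    ∃ k, i ≤ k ∧ k ≤ j ∧ P.getVert k = x := by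
  rw [mem_support_iff_exists_getVert, length_segment hj]
  simp only [segment, getVert_copy, take_getVert, drop_getVert]
  constructor
  · rintro ⟨k, rfl, hk⟩
    exact ⟨i + k, by omega, by omega, by rw [Nat.min_eq_right hk]⟩
  · rintro ⟨k, h1, h2, rfl⟩
    exact ⟨k - i, by rw [Nat.min_eq_right (by omega), Nat.add_sub_cancel' h1], by omega⟩

theorem IsPath.segment (hP : P.IsPath) : (P.segment i j hij).IsPath := by
  simpa [Walk.segment] using (hP.drop i).take (j - i)

theorem isPath_segment_of_injOn (hj : j ≤ P.length)
    (h : Set.InjOn P.getVert (Set.Icc i j)) : (P.segment i j hij).IsPath := by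
  rw [← IsPath.getVert_injOn_iff, length_segment hj]
  intro k hk l hl hkl
  simp only [Set.mem_ofPred_eq] at hk hl
  simp only [Walk.segment, getVert_copy, take_getVert, drop_getVert, Nat.min_eq_right hk,
    Nat.min_eq_right hl] at hkl
  have := @h (i + k) ⟨by omega, by omega⟩ (i + l) ⟨by omega, by omega⟩ hkl
  omega

theorem getElem_darts_fst {k : ℕ} (h : k < P.darts.length) : P.darts[k].fst = P.getVert k := by
  rw [darts_getElem_eq_getVert]

theorem getElem_darts_snd {k : ℕ} (h : k < P.darts.length) :
    P.darts[k].snd = P.getVert (k + 1) := by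
  rw [darts_getElem_eq_getVert]

end SimpleGraph.Walk

/-! ### Leftmost walks are simple -/

namespace PlantedTriangulation

open RotationSystem

variable {V : Type*} {G : PlantedTriangulation V} {E : Set G.graph.Dart} {a : V}

variable (G) in
/-- A walk that always takes the first outgoing dart of `E` in clockwise order. -/
structure IsLeftmost (E : Set G.graph.Dart) {a b : V} (P : G.graph.Walk a b) : Prop where
  mem : ∀ d ∈ P.darts, d ∈ E
  chain : P.darts.IsChain (G.IsFirstOutgoing E)

theorem IsLeftmostPath.isLeftmost {e : G.graph.Dart} (he : e ∈ E) {P : G.graph.Walk e.fst G.A}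
    (hP : G.IsLeftmostPath E e P) : G.IsLeftmost E P := by
  refine ⟨fun d hd => ?_, hP.2⟩
  obtain ⟨k, hk, rfl⟩ := List.getElem_of_mem hd
  cases k with
  | zero =>
    have := hP.1
    rw [List.head?_eq_getElem?, List.getElem?_eq_getElem hk] at this
    rw [Option.some.inj this]; exact he
  | succ k => exact (List.isChain_iff_getElem.1 hP.2 k hk).1

theorem IsThreeOrientation.fst_ne_A [Finite V] (hE : G.IsThreeOrientation E) {d : G.graph.Dart}
    (hd : d ∈ E) : d.fst ≠ G.A := by
  intro h
  have := (Set.ncard_eq_zero (Set.toFinite _)).1 hE.outdeg_A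
  exact Set.eq_empty_iff_forall_notMem.1 this d ⟨hd, h⟩

theorem A_ne_B : G.A ≠ G.B := by
  have := (G.faceNext G.root).adj.ne
  rw [faceNext_root_fst] at this
  exact this

theorem rootVertex_ne_A : G.rootVertex ≠ G.A := G.root.adj.ne

theorem B_ne_rootVertex : G.B ≠ G.rootVertex := by
  have := (G.faceNext (G.faceNext G.root)).adj.ne
  rw [faceNext_faceNext_root_fst, faceNext_faceNext_root_snd] at this
  exact this

/-- The only outgoing dart at `B` leads to `A`. -/
theorem IsThreeOrientation.eq_of_fst_eq_B [Finite V] (hE : G.IsThreeOrientation E)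
    {d : G.graph.Dart} (hd : d ∈ E) (h : d.fst = G.B) : d = (G.faceNext G.root).symm := by
  obtain ⟨d₀, hd₀⟩ := Set.ncard_eq_one.1 hE.outdeg_B
  have h1 : d ∈ ({d₀} : Set _) := hd₀ ▸ ⟨hd, h⟩
  have h2 : (G.faceNext G.root).symm ∈ ({d₀} : Set _) := hd₀ ▸ ⟨(hE.orientation _).2
    fun h' => hE.fst_ne_A h' faceNext_root_fst, rfl⟩
  exact h1.trans h2.symm

theorem IsThreeOrientation.snd_eq_A [Finite V] (hE : G.IsThreeOrientation E)
    {d : G.graph.Dart} (hd : d ∈ E) (h : d.fst = G.B) : d.snd = G.A := by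
  rw [hE.eq_of_fst_eq_B hd h]; exact faceNext_root_fst

theorem IsThreeOrientation.outdeg_le [Finite V] (hE : G.IsThreeOrientation E) (x : V) :
    {d | d ∈ E ∧ d.fst = x}.ncard ≤ 3 := by
  by_cases h1 : x = G.A
  · rw [h1, hE.outdeg_A]; omega
  by_cases h2 : x = G.B
  · rw [h2, hE.outdeg_B]; omega
  by_cases h3 : x = G.rootVertex
  · rw [h3, hE.outdeg_root]; omega
  · rw [hE.outdeg x h1 h2 h3]

section Leftmost

variable {b : V} {P : G.graph.Walk a b}

theorem IsLeftmost.first (hP : G.IsLeftmost E P) {k : ℕ} (hk : k + 1 < P.darts.length) :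
    G.IsFirstOutgoing E P.darts[k] P.darts[k + 1] :=
  List.isChain_iff_getElem.1 hP.chain k hk

theorem IsLeftmost.getVert_ne_A [Finite V] (hE : G.IsThreeOrientation E)
    (hP : G.IsLeftmost E P) {k : ℕ} (hk : k < P.darts.length) : P.getVert k ≠ G.A := by
  rw [← SimpleGraph.Walk.getElem_darts_fst hk]
  exact hE.fst_ne_A (hP.mem _ (List.getElem_mem hk))

theorem IsLeftmost.getVert_succ_eq_A [Finite V] (hE : G.IsThreeOrientation E)
    (hP : G.IsLeftmost E P) {k : ℕ} (hk : k < P.darts.length) (h : P.getVert k = G.B) :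
    P.getVert (k + 1) = G.A := by
  rw [← SimpleGraph.Walk.getElem_darts_snd hk]
  exact hE.snd_eq_A (hP.mem _ (List.getElem_mem hk))
    ((SimpleGraph.Walk.getElem_darts_fst hk).trans h)

/-- A lower bound for the number of outgoing darts, other than those of the walk, along a piece of a
walk that does not visit `A` or `B` and visits no vertex twice. -/
theorem IsThreeOrientation.le_ncard_of_forall [Finite V] (hE : G.IsThreeOrientation E)
    {i j : ℕ} (hinj : Set.InjOn P.getVert (Set.Ico i j)) {S : Set G.graph.Dart}
    (hA : ∀ k ∈ Set.Ico i j, P.getVert k ≠ G.A) (hB : ∀ k ∈ Set.Ico i j, P.getVert k ≠ G.B)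
    (hj : j ≤ P.darts.length)
    (hS : ∀ k (hk : k < P.darts.length), i ≤ k → k < j → ∀ g ∈ E, g.fst = P.getVert k →
      g ≠ P.darts[k] → g ∈ S) :
    2 * (j - i) ≤ S.ncard + 1 := by
  classical
  set t := (Finset.Ico i j).image P.getVert with ht
  have hcard : t.card = j - i := by
    rw [ht, Finset.card_image_of_injOn (by simpa using hinj), Nat.card_Ico]
  have h1 : ∑ x ∈ t, {d | d ∈ S ∧ d.fst = x}.ncard ≤ S.ncard := by
    have h := Set.ncard_eq_sum_fiber {d | d ∈ S ∧ d.fst ∈ t} (fun d => d.fst) t (fun d hd => hd.2)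
    refine le_trans (le_of_eq ?_) (h.symm.le.trans (Set.ncard_le_ncard fun d hd => hd.1))
    refine Finset.sum_congr rfl fun x hx => ?_
    congr 1
    ext d
    exact ⟨fun h => ⟨⟨h.1, h.2.symm ▸ hx⟩, h.2⟩, fun h => ⟨h.1.1, h.2⟩⟩
  -- Three outgoing edges, one of them used by the walk; only the root vertex has one fewer, hence
  -- the `+ 1` in the bound.
  have h2 : ∀ x ∈ t, 2 ≤ {d | d ∈ S ∧ d.fst = x}.ncard + if x = G.rootVertex then 1 else 0 := by
    intro x hx
    obtain ⟨k, hk, rfl⟩ := Finset.mem_image.1 hx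
    have hk := Finset.mem_Ico.1 hk
    have hkl : k < P.darts.length := by omega
    have hle : {d | d ∈ E ∧ d.fst = P.getVert k}.ncard ≤
        {d | d ∈ S ∧ d.fst = P.getVert k}.ncard + 1 := by
      refine le_trans (Set.ncard_le_ncard (t := insert P.darts[k]
        {d | d ∈ S ∧ d.fst = P.getVert k}) fun d hd => ?_) (Set.ncard_insert_le _ _)
      by_cases h : d = P.darts[k]
      · exact Or.inl h
      · exact Or.inr ⟨hS k hkl hk.1 hk.2 d hd.1 hd.2 h, hd.2⟩
    split_ifs with hv
    · have := hE.outdeg_root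
      rw [hv] at hle ⊢
      omega
    · have := hE.outdeg _ (hA k hk) (hB k hk) hv
      omega
  have h3 := Finset.sum_le_sum h2
  rw [Finset.sum_add_distrib, Finset.sum_const, hcard, smul_eq_mul] at h3
  have h4 : ∑ x ∈ t, (if x = G.rootVertex then 1 else 0) ≤ 1 := by
    rw [Finset.sum_ite_eq']; split_ifs <;> omega
  omega

/-- A dart that leaves a simple cycle into its right side. -/
theorem mem_rightOut [Finite V] {C : G.graph.Walk a a} (hC : C.IsCycle) {h : G.Face → ℤ}
    (hs : G.toPlanarMap.IsSide C h) {c c' g : G.graph.Dart} (hg : g ∈ E)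
    (hc : c ∈ C.darts) (hc' : c' ∈ C.darts) (hgc : g.fst = c.snd) (hgc' : g.fst = c'.fst)
    (h1 : g ≠ c.symm) (h2 : g ≠ c') (h0 : h (G.leftFace g) = 0) : g ∈ rightOut E C := by
  classical
  have := hC.flow_eq_ite hc hc' (hgc.symm.trans hgc') hgc'
  rw [if_neg h1, if_neg h2] at this
  refine ⟨⟨hg, (hs.right _).2 h0, (hs.right _).2 ?_⟩, ?_⟩
  · linarith [hs.pot g]
  · rw [hgc']; exact SimpleGraph.Walk.dart_fst_mem_support_of_mem_darts C hc'

/-- Leftmost walks do not visit a vertex twice. -/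
theorem IsLeftmost.isPath [Finite V] (hE : G.IsMinimalThreeOrientation E)
    (hP : G.IsLeftmost E P) : P.IsPath := by
  classical
  by_contra hnp
  -- At the earliest repetition, the piece between the two visits is a simple directed cycle.
  have hex : ∃ j, j ≤ P.length ∧ ∃ i < j, P.getVert i = P.getVert j := by
    by_contra! hne
    refine hnp ((SimpleGraph.Walk.IsPath.getVert_injOn_iff P).1 fun i hi j hj hij => ?_)
    rcases lt_trichotomy i j with h | h | h
    · exact absurd hij (hne j hj i h)
    · exact h
    · exact absurd hij.symm (hne i hi j h)
  obtain ⟨hj, i, hij, heq⟩ := Nat.find_spec hex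
  have hmin : ∀ k < Nat.find hex, ∀ i < k, P.getVert i ≠ P.getVert k := fun k hk i hi he =>
    Nat.find_min hex hk ⟨by omega, i, hi, he⟩
  set j := Nat.find hex with hjdef
  clear_value j
  have hlen := P.length_darts
  have hdi : i < P.darts.length := by omega
  have hadj : G.graph.Adj (P.getVert i) (P.getVert (i + 1)) := P.adj_getVert_succ (by omega)
  set W := (P.segment (i + 1) j (by omega)).copy rfl heq.symm with hW
  set C : G.graph.Walk (P.getVert i) (P.getVert i) := .cons hadj W with hCdef
  have hinj : Set.InjOn P.getVert (Set.Ico i j) := by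
    intro k hk l hl hkl
    rcases lt_trichotomy k l with h | h | h
    · exact absurd hkl (hmin l hl.2 k h)
    · exact h
    · exact absurd hkl.symm (hmin k hk.2 l h)
  have hCd : ∀ d, d ∈ C.darts ↔ ∃ k, i ≤ k ∧ k < j ∧ ∃ h : k < P.darts.length, P.darts[k] = d := by
    intro d
    have hWd : W.darts = (P.segment (i + 1) j (by omega)).darts := by rw [hW]; simp
    rw [hCdef, SimpleGraph.Walk.darts_cons, List.mem_cons, hWd,
      SimpleGraph.Walk.mem_darts_segment]
    constructor
    · rintro (rfl | ⟨k, h1, h2, h3, rfl⟩)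
      · exact ⟨i, le_rfl, hij, hdi, SimpleGraph.Walk.darts_getElem_eq_getVert i hdi⟩
      · exact ⟨k, by omega, h2, h3, rfl⟩
    · rintro ⟨k, h1, h2, h3, rfl⟩
      rcases h1.eq_or_lt with rfl | h1
      · exact Or.inl (SimpleGraph.Walk.darts_getElem_eq_getVert i hdi)
      · exact Or.inr ⟨k, h1, h2, h3, rfl⟩
  have hCE : ∀ d ∈ C.darts, d ∈ E := by
    intro d hd
    obtain ⟨k, -, -, hk, rfl⟩ := (hCd d).1 hd
    exact hP.mem _ (List.getElem_mem hk)
  have hC : C.IsCycle := by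
    rw [hCdef, SimpleGraph.Walk.cons_isCycle_iff]
    constructor
    · rw [hW, SimpleGraph.Walk.isPath_copy]
      refine SimpleGraph.Walk.isPath_segment_of_injOn hj fun k hk l hl hkl => ?_
      rcases hk.2.eq_or_lt with h1 | h1 <;> rcases hl.2.eq_or_lt with h2 | h2
      · omega
      · rw [h1, ← heq] at hkl
        have := hinj ⟨le_rfl, hij⟩ ⟨by have := hl.1; omega, h2⟩ hkl
        have := hl.1; omega
      · rw [h2, ← heq] at hkl
        have := hinj ⟨by have := hk.1; omega, h1⟩ ⟨le_rfl, hij⟩ hkl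
        have := hk.1; omega
      · exact hinj ⟨by have := hk.1; omega, h1⟩ ⟨by have := hl.1; omega, h2⟩ hkl
    · intro hmem
      have hmem' : (P.darts[i]).edge ∈ W.edges := by
        rw [SimpleGraph.Walk.darts_getElem_eq_getVert]; exact hmem
      have hWC : ∀ d ∈ W.darts, ∃ k, i < k ∧ k < j ∧ ∃ h : k < P.darts.length,
          P.darts[k] = d := by
        intro d hd
        rw [hW, SimpleGraph.Walk.darts_copy, SimpleGraph.Walk.mem_darts_segment] at hd
        obtain ⟨k, h1, h2⟩ := hd
        exact ⟨k, h1, h2⟩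
      rcases mem_edges_iff.1 hmem' with h | h
      · obtain ⟨k, h1, h2, h3, h4⟩ := hWC _ h
        have : P.getVert k = P.getVert i := by
          rw [← SimpleGraph.Walk.getElem_darts_fst h3, h4, SimpleGraph.Walk.getElem_darts_fst]
        exact hmin k h2 i h1 this.symm
      · obtain ⟨k, h1, h2, h3, h4⟩ := hWC _ h
        exact (hE.orientation _).1 (h4 ▸ hP.mem _ (List.getElem_mem h3))
          (hP.mem _ (List.getElem_mem hdi))
  -- Minimality puts the root face on the left, so only length minus 3 edges go to the right. But
  -- the other outgoing edges at all vertices of the cycle except its first go there: `2 * (length -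
  -- 1) ≤ (length - 3) + 1`, which is absurd. The first vertex is left out because the walk need not
  -- enter it along the cycle.
  have hroot := hE.minimal _ C hC hCE
  obtain ⟨h, hs⟩ := PlanarMap.exists_isSide (M := G.toPlanarMap) hE.orientation hC
  have hout := hE.toIsThreeOrientation.ncard_rightOut hC hroot
  have hClen : C.length = j - i := by
    rw [hCdef, SimpleGraph.Walk.length_cons, hW, SimpleGraph.Walk.length_copy,
      SimpleGraph.Walk.length_segment hj]
    omega
  have hlow := hE.toIsThreeOrientation.le_ncard_of_forall (P := P) (i := i + 1) (j := j)
    (S := rightOut E C) (hinj.mono (Set.Ico_subset_Ico_left (by omega)))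
    (fun k hk => hP.getVert_ne_A hE.toIsThreeOrientation (by have := hk.2; omega)) ?_ (by omega) ?_
  · omega
  -- From `B` the only way leads to `A`, where the walk would have to stop.
  · intro k hk hB
    have hA := hP.getVert_succ_eq_A hE.toIsThreeOrientation (by have := hk.2; omega) hB
    rcases (Nat.succ_le_of_lt hk.2).eq_or_lt with h1 | h1
    · rw [← Nat.succ_eq_add_one, h1, ← heq] at hA
      exact hP.getVert_ne_A hE.toIsThreeOrientation (by omega) hA
    · exact hP.getVert_ne_A hE.toIsThreeOrientation (by omega) hA
  · intro k hk h1 h2 g hg hgk hne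
    obtain ⟨k, rfl⟩ : ∃ l, k = l + 1 := ⟨k - 1, by omega⟩
    have hc : P.darts[k] ∈ C.darts := (hCd _).2 ⟨k, by omega, by omega, by omega, rfl⟩
    have hc' : P.darts[k + 1] ∈ C.darts := (hCd _).2 ⟨k + 1, by omega, by omega, by omega, rfl⟩
    have hgs : g.fst = P.darts[k].snd := by rw [hgk, SimpleGraph.Walk.getElem_darts_snd]
    have h0 := (hP.first hk).side_of_mem hE.orientation hC hs.pot (hCE _ hc) hg hgs hne
      (Or.inl ⟨hc, hc'⟩)
    refine mem_rightOut hC hs hg hc hc' hgs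
      (by rw [hgk, SimpleGraph.Walk.getElem_darts_fst]) ?_ hne ?_
    · rintro rfl
      exact (hE.orientation _).1 hg (hCE _ hc)
    · rw [h0]; exact (hs.right _).1 ⟨_, hc, .refl⟩

end Leftmost

end PlantedTriangulation

/-! ### Excursions of a geodesic from a path -/

namespace SimpleGraph.Walk

variable {V : Type*} {G : SimpleGraph V} {x y : V}

/-- Two single edges are excluded because in a simple graph they would be one edge traversed there
and back. -/
theorem IsPath.isCycle_append_of_ne {W : G.Walk x y} {W' : G.Walk y x} (hW : W.IsPath)
    (hW' : W'.IsPath) (hne : x ≠ y)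
    (hdisj : ∀ z ∈ W.support, z ∈ W'.support → z = x ∨ z = y)
    (hlen : ¬ (W.length = 1 ∧ W'.length = 1)) : (W.append W').IsCycle := by
  have h1 : W.length ≠ 0 := fun h => hne (eq_of_length_eq_zero h)
  have h2 : W'.length ≠ 0 := fun h => hne (eq_of_length_eq_zero h).symm
  refine hW.isCycle_append hW' (fun z hz hz' => ?_) (by omega)
  have h3 := hW.support_nodup
  have h4 := hW'.support_nodup
  rw [← cons_tail_support, List.nodup_cons] at h3 h4
  rcases hdisj z (List.mem_of_mem_tail hz) (List.mem_of_mem_tail hz') with rfl | rfl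
  · exact h3.1 hz
  · exact h4.1 hz'

variable {P Q : G.Walk x y}

/-- A piece of the walk `Q` that meets the walk `P` only at its ends. -/
structure IsExcursion (P Q : G.Walk x y) (s t i j : ℕ) : Prop where
  lt : s < t
  le_length : t ≤ Q.length
  left_le : i ≤ P.length
  right_le : j ≤ P.length
  left_eq : Q.getVert s = P.getVert i
  right_eq : Q.getVert t = P.getVert j
  notMem : ∀ r, s < r → r < t → Q.getVert r ∉ P.support

/-- On a geodesic, the distance is the difference of the positions. -/
theorem sub_le_length_of_length_eq_dist (hQ : Q.length = G.dist x y) {s t : ℕ} (hst : s ≤ t)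
    (ht : t ≤ Q.length) (W : G.Walk (Q.getVert s) (Q.getVert t)) : t - s ≤ W.length := by
  have h := dist_le ((Q.take s).append (W.append (Q.drop t)))
  simp only [length_append, take_length, drop_length] at h
  rw [← hQ] at h
  have : s ⊓ Q.length = s := Nat.min_eq_left (by omega)
  omega

theorem IsExcursion.length_le {s t i j : ℕ} (h : P.IsExcursion Q s t i j) (hQ : Q.length = G.dist x y)
    (hij : i ≤ j) : t - s ≤ j - i := by
  have := sub_le_length_of_length_eq_dist hQ h.lt.le h.le_length
    ((P.segment i j hij).copy h.left_eq.symm h.right_eq.symm)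
  rwa [length_copy, length_segment h.right_le] at this

theorem IsExcursion.length_le' {s t i j : ℕ} (h : P.IsExcursion Q s t i j) (hQ : Q.length = G.dist x y)
    (hij : j ≤ i) : t - s ≤ i - j := by
  have := sub_le_length_of_length_eq_dist hQ h.lt.le h.le_length
    ((P.segment j i hij).reverse.copy h.left_eq.symm h.right_eq.symm)
  rwa [length_copy, length_reverse, length_segment h.left_le] at this

theorem IsExcursion.ne (hQ : Q.IsPath) {s t i j : ℕ} (h : P.IsExcursion Q s t i j) : i ≠ j := by
  rintro rfl
  have := hQ.getVert_injOn (by have := h.lt; have := h.le_length; simp; omega) h.le_length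
    (h.left_eq.trans h.right_eq.symm)
  have := h.lt
  omega

/-- A geodesic reaches a common vertex no later than any other walk from the same start. -/
theorem le_of_getVert_eq (hQ : Q.length = G.dist x y) {t j : ℕ} (ht : t ≤ Q.length)
    (hj : j ≤ P.length) (h : Q.getVert t = P.getVert j) : t ≤ j := by
  have := sub_le_length_of_length_eq_dist hQ (Nat.zero_le t) ht
    ((P.take j).copy Q.getVert_zero.symm h.symm)
  rw [length_copy, take_length] at this
  omega

theorem sub_le_of_getVert_eq (hQ : Q.length = G.dist x y) {t j : ℕ} (ht : t ≤ Q.length)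
    (h : Q.getVert t = P.getVert j) : Q.length - t ≤ P.length - j := by
  have := sub_le_length_of_length_eq_dist hQ ht le_rfl
    ((P.drop j).copy h.symm Q.getVert_length.symm)
  rwa [length_copy, drop_length] at this

theorem IsExcursion.mem_support {s t i j : ℕ} (h : P.IsExcursion Q s t i j) {r : ℕ} (h1 : s ≤ r)
    (h2 : r ≤ t) (h3 : Q.getVert r ∈ P.support) :
    Q.getVert r = P.getVert i ∨ Q.getVert r = P.getVert j := by
  rcases h1.eq_or_lt with rfl | h1
  · exact Or.inl h.left_eq
  rcases h2.eq_or_lt with rfl | h2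
  · exact Or.inr h.right_eq
  · exact absurd h3 (h.notMem r h1 h2)

theorem darts_segment_succ {i : ℕ} (hi : i < P.length) :
    (P.segment i (i + 1) (Nat.le_succ i)).darts =
      [⟨(P.getVert i, P.getVert (i + 1)), P.adj_getVert_succ hi⟩] := by
  have hi' : i < P.darts.length := by rwa [length_darts]
  rw [darts_segment, Nat.add_sub_cancel_left, ← darts_getElem_eq_getVert i hi',
    List.take_one, List.head?_drop, List.getElem?_eq_getElem hi', Option.toList_some]

end SimpleGraph.Walk

/-! ### Counting edges at an excursion -/

namespace RotationSystem

variable {V : Type*} {M : RotationSystem V} {a b : V}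

theorem flow_take_eq (P : M.graph.Walk a b) {i j : ℕ} (hij : i ≤ j) (d : M.graph.Dart) :
    M.flow (P.take j) d = M.flow (P.take i) d + M.flow (P.segment i j hij) d := by
  have : (P.take j).darts = (P.take i).darts ++ (P.segment i j hij).darts := by
    rw [SimpleGraph.Walk.darts_take, SimpleGraph.Walk.darts_take, SimpleGraph.Walk.darts_segment,
      ← List.take_add, Nat.add_sub_cancel' hij]
  simp only [flow, this, List.count_append]
  push_cast; ring

end RotationSystem

namespace PlantedTriangulation

open RotationSystem SimpleGraph.Walk

variable {V : Type*} {G : PlantedTriangulation V} {E : Set G.graph.Dart} {a u : V}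
  {C : G.graph.Walk a a} {h : G.Face → ℤ}

/-- All corners at a vertex off a cycle are on the same side. -/
theorem side_eq_of_notMem [Finite V] (hs : G.toPlanarMap.IsSide C h) {d d' : G.graph.Dart}
    (hd : d.fst ∉ C.support) (hdd : d.fst = d'.fst) :
    h (G.leftFace d) = h (G.leftFace d') := by
  refine G.rot_induction (p := fun g => h (G.leftFace d) = h (G.leftFace g)) rfl hdd
    fun g hg h1 => ?_
  rw [h1, G.leftFace_rot]
  have : G.flow C g = 0 := flow_eq_zero fun h' => hd (by
    rw [← hg]; exact C.fst_mem_support_of_mem_edges h')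
  linarith [hs.pot g]

theorem side_eq_of_notMem_edges (hs : G.toPlanarMap.IsSide C h) {d : G.graph.Dart}
    (hd : d.edge ∉ C.edges) : h (G.leftFace d) = h (G.rightFace d) := by
  linarith [hs.pot d, flow_eq_zero hd]

theorem fst_notMem_edge {d : G.graph.Dart} (hd : d.fst ∉ C.support) : d.edge ∉ C.edges :=
  fun h' => hd (C.fst_mem_support_of_mem_edges h')

theorem snd_notMem_edge {d : G.graph.Dart} (hd : d.snd ∉ C.support) : d.edge ∉ C.edges :=
  fun h' => hd (C.snd_mem_support_of_mem_edges h')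

section Excursion

variable {P Q : G.graph.Walk u G.A} {s t i j : ℕ}

/-- The beginning of a path, up to a cycle, is on one side of it. -/
theorem side_before [Finite V] (hs : G.toPlanarMap.IsSide C h) (hP : ∀ k < j, P.getVert k ∉ C.support)
    {k : ℕ} (hk : k < j) (hkl : k < P.darts.length) :
    h (G.rightFace P.darts[k]) = h (G.rightFace (P.darts[0]'(by omega))) := by
  induction k with
  | zero => rfl
  | succ k ih =>
    rw [← ih (by omega) (by omega), ← side_eq_of_notMem_edges hs, ← G.leftFace_symm]
    · refine side_eq_of_notMem hs ?_ ?_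
      · rw [getElem_darts_fst]; exact hP _ hk
      · rw [getElem_darts_fst]; exact (getElem_darts_snd (P := P) (by omega)).symm
    · refine fst_notMem_edge ?_
      rw [getElem_darts_fst]; exact hP _ hk

/-- The end of a path to `A`, after a cycle, is on the side of the root face. -/
theorem side_after [Finite V] (hs : G.toPlanarMap.IsSide C h)
    (hP : ∀ k, j < k → k ≤ P.length → P.getVert k ∉ C.support) {k : ℕ} (hk : j ≤ k)
    (hkl : k < P.darts.length) : h (G.leftFace P.darts[k]) = h G.rootFace := by
  have hlen := P.length_darts
  obtain ⟨n, hn⟩ : ∃ n, P.length = k + 1 + n := ⟨P.length - (k + 1), by omega⟩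
  have hsnd : ∀ l (hl : l < P.darts.length), j ≤ l → P.darts[l].snd ∉ C.support := fun l hl h' => by
    rw [getElem_darts_snd]; exact hP _ (by omega) (by omega)
  induction n generalizing k with
  | zero =>
    rw [side_eq_of_notMem_edges hs (snd_notMem_edge (hsnd k hkl hk)), ← G.leftFace_symm,
      ← leftFace_faceNext_root]
    refine side_eq_of_notMem hs (hsnd k hkl hk) ?_
    rw [faceNext_root_fst]
    refine (getElem_darts_snd hkl).trans ?_
    rw [show k + 1 = P.length by omega, getVert_length]
  | succ n ih =>
    rw [side_eq_of_notMem_edges hs (snd_notMem_edge (hsnd k hkl hk)), ← G.leftFace_symm,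
      ← ih (k := k + 1) (by omega) (by omega) (by omega)]
    refine side_eq_of_notMem hs (hsnd k hkl hk) ?_
    rw [getElem_darts_fst]
    exact getElem_darts_snd hkl

/-- A leftmost path cannot be joined by a geodesic excursion backwards in the clockwise direction. -/
theorem IsExcursion.not_lt [Finite V] (hE : G.IsThreeOrientation E) (hP : G.IsLeftmost E P)
    (hPp : P.IsPath) (hQp : Q.IsPath) (hQ : Q.length = G.graph.dist u G.A)
    (hx : P.IsExcursion Q s t i j) (hC : C.IsCycle) (hs : G.toPlanarMap.IsSide C h)
    (hroot : G.rootFace ∈ G.leftFaces C) (h0 : ∀ h' : 0 < P.darts.length,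
      h (G.rightFace P.darts[0]) = 0)
    (hsupp : ∀ z ∈ C.support, (∃ r, s ≤ r ∧ r ≤ t ∧ Q.getVert r = z) ∨
      ∃ k, j ≤ k ∧ k ≤ i ∧ P.getVert k = z)
    (hQd : ∀ r, s ≤ r → r < t → ∀ hr : r < Q.darts.length, Q.darts[r] ∈ C.darts)
    (hPd : ∀ k, j ≤ k → k < i → ∀ hk : k < P.darts.length, P.darts[k] ∈ C.darts)
    (hlen : C.length = (t - s) + (i - j)) : ¬ j < i := by
  intro hji
  have hlP := P.length_darts
  have hlQ := Q.length_darts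
  have hst := hx.lt
  have htl := hx.le_length
  have hil := hx.left_le
  -- An edge of `P` must enter position `j`, for the side of the other edges there to be determined.
  have hj0 : j ≠ 0 := by
    rintro rfl
    have := hx.right_eq
    rw [getVert_zero, hQp.getVert_eq_start_iff htl] at this
    omega
  have hoff : ∀ k < j, P.getVert k ∉ C.support := by
    intro k hk hkC
    have key : ∀ l, l ≤ P.length → P.getVert k = P.getVert l → k = l := fun l hl he =>
      hPp.getVert_injOn (by simp; omega) hl he
    rcases hsupp _ hkC with ⟨r, h1, h2, h3⟩ | ⟨l, h1, h2, h3⟩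
    · rcases hx.mem_support h1 h2 (h3 ▸ P.getVert_mem_support k) with h4 | h4
      · have := key i hil (h3.symm.trans h4); omega
      · have := key j hx.right_le (h3.symm.trans h4); omega
    · have := key l (by omega) h3.symm; omega
  -- The count gives `2 * (i - j) ≤ (t - s) + (i - j) - 3 + 1`, so the piece of `P` would be a
  -- shortcut for the geodesic.
  have hout := hE.ncard_rightOut hC hroot
  have hlow := hE.le_ncard_of_forall (P := P) (i := j) (j := i) (S := rightOut E C)
    (hPp.getVert_injOn.mono fun k hk => by have := hk.2; simp; omega)
    (fun k hk => hP.getVert_ne_A hE (by have := hk.2; omega)) ?_ (by omega) ?_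
  · have := hx.length_le' hQ hji.le
    omega
  -- After `B` the path is at `A`. This is either a nonfinal position of `P`, or position `i`; but
  -- the vertex at `i` is visited by `Q` at `s < t`, before its end.
  · intro k hk hB
    have hA := hP.getVert_succ_eq_A hE (by have := hk.2; omega) hB
    have hk2 := hk.2
    rcases (show k + 1 ≤ P.length by omega).eq_or_lt with h1 | h1
    · have h2 : i = k + 1 := by omega
      have h3 := hx.left_eq
      rw [h2, hA, hQp.getVert_eq_end_iff (by omega)] at h3
      omega
    · exact hP.getVert_ne_A hE (by omega) hA
  · intro k hk h1 h2 g hg hgk hne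
    obtain ⟨k, rfl⟩ : ∃ l, k = l + 1 := ⟨k - 1, by omega⟩
    have hk' : k < P.darts.length := by omega
    have hpE : P.darts[k] ∈ E := hP.mem _ (List.getElem_mem hk')
    have hc' : P.darts[k + 1] ∈ C.darts := hPd _ h1 h2 hk
    have hgs : g.fst = P.darts[k].snd := by rw [hgk, getElem_darts_snd]
    have hgf : g.fst = P.darts[k + 1].fst := by rw [hgk, getElem_darts_fst]
    rcases h1.eq_or_lt with h1 | h1
    -- At `j` the path joins the cycle from the right, because its beginning stays on the side of
    -- `G.rightFace e`.
    · have hd : t - 1 < Q.darts.length := by omega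
      have hc := hQd (t - 1) (by omega) (by omega) hd
      have hcs : Q.darts[t - 1].snd = P.getVert (k + 1) := by
        rw [getElem_darts_snd, Nat.sub_add_cancel (by omega), hx.right_eq, h1]
      obtain ⟨h3, h4⟩ := (hP.first hk).side_of_join hE.orientation hC hs hpE hg hgs hne hc
        (by rw [hcs, getElem_darts_snd]) hc'
        (by rw [side_before hs hoff (by omega)]; exact h0 _)
      exact mem_rightOut hC hs hg hc hc' (by rw [hcs, hgk]) hgf h4 hne h3
    · have hc : P.darts[k] ∈ C.darts := hPd _ (by omega) (by omega) hk'
      have h3 := (hP.first hk).side_of_mem hE.orientation hC hs.pot hpE hg hgs hne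
        (Or.inl ⟨hc, hc'⟩)
      refine mem_rightOut hC hs hg hc hc' hgs hgf ?_ hne ?_
      · rintro rfl
        exact (hE.orientation _).1 hg hpE
      · rw [h3]; exact (hs.right _).1 ⟨_, hc, .refl⟩

theorem IsThreeOrientation.ncard_le_of_fst_mem [Finite V] (hE : G.IsThreeOrientation E)
    (t : Finset V) : {d | d ∈ E ∧ d.fst ∈ t}.ncard ≤ 3 * t.card := by
  classical
  rw [Set.ncard_eq_sum_fiber _ (fun d => d.fst) t (fun d hd => hd.2), mul_comm, ← smul_eq_mul,
    ← Finset.sum_const]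
  refine Finset.sum_le_sum fun x _ => le_trans (Set.ncard_le_ncard fun d hd => ?_) (hE.outdeg_le x)
  exact ⟨hd.1.1, hd.2⟩

/-- The part of a leftmost path that is cut off by a clockwise excursion is hardly longer than the
excursion. -/
theorem IsExcursion.le_add_two [Finite V] (hE : G.IsThreeOrientation E) (hP : G.IsLeftmost E P)
    (hPp : P.IsPath) (hx : P.IsExcursion Q s t i j) (hC : C.IsCycle)
    (hs : G.toPlanarMap.IsSide C h) (hroot : G.rootFace ∈ G.leftFaces C) (hij : i < j)
    (hsupp : ∀ z ∈ C.support, (∃ r, s ≤ r ∧ r ≤ t ∧ Q.getVert r = z) ∨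
      ∃ k, i ≤ k ∧ k ≤ j ∧ P.getVert k = z)
    (hQd : ∀ r, s ≤ r → r < t → ∀ hr : r < Q.darts.length, Q.darts[r] ∈ C.darts)
    (hPd : ∀ k, i ≤ k → k < j → ∀ hk : k < P.darts.length, P.darts[k].symm ∈ C.darts)
    (hlen : C.length = (t - s) + (j - i)) : j - i ≤ (t - s) + 2 := by
  classical
  have hlP := P.length_darts
  have hlQ := Q.length_darts
  have hst := hx.lt
  have htl := hx.le_length
  have hjl := hx.right_le
  have hoff : ∀ k, j < k → k ≤ P.length → P.getVert k ∉ C.support := by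
    intro k hk hkl hkC
    have key : ∀ l, l ≤ P.length → P.getVert k = P.getVert l → k = l := fun l hl he =>
      hPp.getVert_injOn hkl hl he
    rcases hsupp _ hkC with ⟨r, h1, h2, h3⟩ | ⟨l, h1, h2, h3⟩
    · rcases hx.mem_support h1 h2 (h3 ▸ P.getVert_mem_support k) with h4 | h4
      · have := key i hx.left_le (h3.symm.trans h4); omega
      · have := key j hx.right_le (h3.symm.trans h4); omega
    · have := key l (by omega) h3.symm; omega
  have hroot1 := (hs.left _).1 hroot
  have hO : G.IsOrientation E := hE.orientation
  -- All outgoing darts at vertices of `C` that do not leave into the left side; edges of `C` count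
  -- in whichever direction they are oriented. There are `2 * C.length - 3` of them.
  set S : Set G.graph.Dart := rightOut E C ∪ {d | d ∈ E ∧ d.edge ∈ C.edges} with hS
  have hScard : S.ncard = (rightOut E C).ncard + C.length := by
    rw [hS, Set.ncard_union_eq, hO.ncard_edges hC]
    rw [Set.disjoint_left]
    rintro g ⟨⟨-, h1, h2⟩, -⟩ ⟨-, h3⟩
    have h4 := hs.pot g
    rw [(hs.right _).1 h1, (hs.right _).1 h2] at h4
    rcases mem_edges_iff.1 h3 with h5 | h5
    · rw [hC.flow_eq_one h5] at h4; omega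
    · have := hC.flow_eq_one h5
      rw [flow_symm, ← h4] at this; omega
  -- At the positions of `P` after `i`, every outgoing edge that `P` does not use is on the left.
  -- What remains are `j - i - 1` darts of `P` and at most three darts at each of the `t - s`
  -- positions of `Q` before `t`; comparing with `2 * C.length - 3` gives the bound.
  have hSsub : S ⊆ ((P.segment (i + 1) j hij).darts.toFinset : Set G.graph.Dart) ∪
      {d | d ∈ E ∧ d.fst ∈ (Finset.Ico s t).image Q.getVert} := by
    intro g hg
    have hgE : g ∈ E := by
      rcases hg with h1 | h1
      · exact h1.1.1
      · exact h1.1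
    have hgC : g.fst ∈ C.support := by
      rcases hg with h1 | h1
      · exact h1.2
      · exact C.fst_mem_support_of_mem_edges h1.2
    have hleft : ∀ {c c' : G.graph.Dart}, c ∈ C.darts → c' ∈ C.darts → g.fst = c.snd →
        g.fst = c'.fst → g ≠ c.symm → g ≠ c' → h (G.leftFace g) ≠ 1 := by
      intro c c' hc hc' h1 h2 h3 h4 h5
      rcases hg with h6 | h6
      · have := (hs.right _).1 h6.1.2.1
        omega
      · rcases mem_edges_iff.1 h6.2 with h7 | h7
        · exact h4 (hC.eq_of_fst_eq h7 hc' h2)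
        · exact h3 (by rw [← hC.eq_of_snd_eq h7 hc h1, SimpleGraph.Dart.symm_symm])
    have hPk : ∀ k, i < k → k ≤ j → g.fst = P.getVert k →
        g ∈ (P.segment (i + 1) j hij).darts := by
      intro k h1 h2 h3
      obtain ⟨k, rfl⟩ : ∃ l, k = l + 1 := ⟨k - 1, by omega⟩
      have hk' : k < P.darts.length := by omega
      have hpE : P.darts[k] ∈ E := hP.mem _ (List.getElem_mem hk')
      have hc' := hPd k (by omega) (by omega) hk'
      have hgs : g.fst = P.darts[k].snd := by rw [h3, getElem_darts_snd]
      have hgne : g ≠ P.darts[k].symm := by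
        rintro rfl
        exact (hO _).1 hgE hpE
      by_cases hkl : k + 1 < P.darts.length
      swap
      · exact absurd (by rw [h3, show k + 1 = P.length by omega, getVert_length])
          (hE.fst_ne_A hgE)
      rcases h2.eq_or_lt with h2 | h2
      -- At `j` the path leaves the cycle, and its end stays on the side of the root face, the left;
      -- so no outgoing dart there belongs to `S`.
      · exfalso
        have hd : t - 1 < Q.darts.length := by omega
        have hc := hQd (t - 1) (by omega) (by omega) hd
        have hcs : Q.darts[t - 1].snd = P.getVert (k + 1) := by
          rw [getElem_darts_snd, Nat.sub_add_cancel (by omega), hx.right_eq, h2]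
        obtain ⟨h4, h5⟩ := (hP.first hkl).side_of_leave hO hC hs hpE hgE hgs hc
          (by rw [hcs, getElem_darts_snd]) hc'
          (by rw [side_after hs hoff (by omega), hroot1])
        exact hleft hc hc' (by rw [hcs, h3]) hgs h5 hgne h4
      · by_contra hmem
        have hc := hPd (k + 1) (by omega) h2 hkl
        have hne : g ≠ P.darts[k + 1] := by
          rintro rfl
          exact hmem (mem_darts_segment.2 ⟨k + 1, by omega, h2, hkl, rfl⟩)
        have h4 := (hP.first hkl).side_of_mem hO hC hs.pot hpE hgE hgs hne (Or.inr ⟨hc', hc⟩)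
        refine hleft hc hc' (by rw [h3]; exact (getElem_darts_fst hkl).symm) hgs
          (by rwa [SimpleGraph.Dart.symm_symm]) hgne ?_
        rw [h4, ← G.leftFace_symm]
        exact (hs.left _).1 ⟨_, hc', .refl⟩
    have hQr : ∀ r, s ≤ r → r < t → g.fst = Q.getVert r →
        g ∈ {d | d ∈ E ∧ d.fst ∈ (Finset.Ico s t).image Q.getVert} := fun r h1 h2 h3 =>
      ⟨hgE, Finset.mem_image.2 ⟨r, Finset.mem_Ico.2 ⟨h1, h2⟩, h3.symm⟩⟩
    rcases hsupp _ hgC with ⟨r, h1, h2, h3⟩ | ⟨k, h1, h2, h3⟩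
    · rcases h2.eq_or_lt with rfl | h2
      · exact Or.inl (by simpa using hPk j hij le_rfl (h3.symm.trans hx.right_eq))
      · exact Or.inr (hQr r h1 h2 h3.symm)
    · rcases h1.eq_or_lt with rfl | h1
      · exact Or.inr (hQr s le_rfl hst (h3.symm.trans hx.left_eq.symm))
      · exact Or.inl (by simpa using hPk k h1 h2 h3.symm)
  have h1 := (Set.ncard_le_ncard hSsub).trans (Set.ncard_union_le _ _)
  have h2 : ((P.segment (i + 1) j hij).darts.toFinset : Set G.graph.Dart).ncard ≤ j - (i + 1) := by
    rw [Set.ncard_coe_finset]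
    refine (List.toFinset_card_le _).trans ?_
    rw [length_darts, length_segment hjl]
  have h3 := hE.ncard_le_of_fst_mem ((Finset.Ico s t).image Q.getVert)
  have h4 : ((Finset.Ico s t).image Q.getVert).card ≤ t - s :=
    Finset.card_image_le.trans (by simp)
  have hout := hE.ncard_rightOut hC hroot
  omega

end Excursion

end PlantedTriangulation

/-! ### A short step in a slow descent -/

/-- A function on a set of positions that decreases by at most one from each position to the next
has a short step of size one in the middle third of its descent. -/
theorem exists_short_descent (S : ℕ → Prop) (ω : ℕ → ℤ) {L k m : ℕ} (h0 : S 0) (hL : S L)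
    (hω0 : ω 0 = 0) (hωL : ω L ≤ -k)
    (hstep : ∀ s t, S s → S t → s < t → t ≤ L → (∀ r, s < r → r < t → ¬ S r) → ω s - 1 ≤ ω t)
    (hm : 1 ≤ m) (hk : 3 * m ≤ k) :
    ∃ s t, S s ∧ S t ∧ s < t ∧ t ≤ L ∧ (∀ r, s < r → r < t → ¬ S r) ∧ ω t = ω s - 1 ∧
      m * (t - s) + 2 * m ≤ L ∧ m ≤ s ∧ m + t ≤ L := by
  classical
  -- For `r ≤ k`, `T r` will be the first position in `S` with value at most `-r`.
  have hex : ∀ r : ℕ, ∃ t, r ≤ k → S t ∧ t ≤ L ∧ ω t ≤ -r ∧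
      ∀ t' < t, S t' → -(r : ℤ) < ω t' := by
    intro r
    by_cases hr : r ≤ k
    · have hex : ∃ t, S t ∧ t ≤ L ∧ ω t ≤ -r := ⟨L, hL, le_rfl, by omega⟩
      refine ⟨Nat.find hex, fun _ => ⟨(Nat.find_spec hex).1, (Nat.find_spec hex).2.1,
        (Nat.find_spec hex).2.2, fun t' ht' hS => ?_⟩⟩
      by_contra! h
      exact Nat.find_min hex ht' ⟨hS, by have := (Nat.find_spec hex).2.1; omega, h⟩
    · exact ⟨0, fun h => absurd h hr⟩
  choose T hT using hex
  -- The last position in `S` before `T (r + 1)`: as a step loses at most one, the value there is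
  -- exactly `-r`, so it is not before `T r`.
  have hpred : ∀ r : ℕ, ∃ s, r + 1 ≤ k → S s ∧ s < T (r + 1) ∧
      (∀ l, s < l → l < T (r + 1) → ¬ S l) ∧ ω (T (r + 1)) = ω s - 1 ∧ T r ≤ s := by
    intro r
    by_cases hr : r + 1 ≤ k
    swap
    · exact ⟨0, fun h => absurd h hr⟩
    obtain ⟨h1, h2, h3, h4⟩ := hT (r + 1) hr
    obtain ⟨h1', h2', h3', h4'⟩ := hT r (by omega)
    have hpos : 0 < T (r + 1) := by
      rcases Nat.eq_zero_or_pos (T (r + 1)) with h | h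
      · rw [h, hω0] at h3; omega
      · exact h
    set F := (Finset.range (T (r + 1))).filter S with hF
    have hne : F.Nonempty := ⟨0, by simp [hF, hpos, h0]⟩
    obtain ⟨l₀, hl₀, hmax⟩ : ∃ l₀ ∈ F, ∀ l ∈ F, l ≤ l₀ :=
      ⟨F.max' hne, F.max'_mem hne, fun l hl => F.le_max' l hl⟩
    simp only [hF, Finset.mem_filter, Finset.mem_range] at hl₀ hmax
    have hgap : ∀ l, l₀ < l → l < T (r + 1) → ¬ S l := by
      intro l hl hl' hS
      have := hmax l ⟨hl', hS⟩
      omega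
    have h5 := hstep _ _ hl₀.2 h1 hl₀.1 h2 hgap
    have h6 := h4 _ hl₀.1 hl₀.2
    push_cast at h3 h6
    refine ⟨l₀, fun _ => ⟨hl₀.2, hl₀.1, hgap, by omega, ?_⟩⟩
    by_contra! hlt
    have := h4' _ hlt hl₀.2
    omega
  choose s hs using hpred
  -- Each level takes at least one position.
  have hmono : ∀ r n, r + n ≤ k → T r + n ≤ T (r + n) := by
    intro r n
    induction n with
    | zero => intro _; exact le_rfl
    | succ n ih =>
      intro hn
      obtain ⟨-, h1, -, -, h2⟩ := hs (r + n) (by omega)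
      have := ih (by omega)
      change T r + (n + 1) ≤ T (r + n + 1)
      omega
  have hTL := (hT k le_rfl).2.1
  -- The `m` steps down from levels `-m, …, -(2m - 1)` are disjoint and lie between `T m ≥ m` and `T
  -- (2m) ≤ L - m`, so they cannot all be longer than the average `(L - 2m) / m`.
  obtain ⟨n, hn, hshort⟩ : ∃ n < m, m * (T (m + n + 1) - s (m + n)) + 2 * m ≤ L := by
    by_contra! hlong
    have hsum : ∀ n ≤ m, n * (L + 1 - 2 * m) ≤ m * (T (m + n) - T m) := by
      intro n
      induction n with
      | zero => intro _; omega
      | succ n ih =>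
        intro hn
        have h1 := ih (by omega)
        have h2 := hlong n (by omega)
        obtain ⟨-, h3, -, -, h4⟩ := hs (m + n) (by omega)
        have h5 := hmono m n (by omega)
        have h6 : T (m + (n + 1)) - T m = (T (m + n + 1) - s (m + n)) + (s (m + n) - T (m + n)) +
            (T (m + n) - T m) := by
          change T (m + n + 1) - T m = _
          omega
        rw [h6, mul_add, mul_add]
        have h7 : (n + 1) * (L + 1 - 2 * m) = n * (L + 1 - 2 * m) + (L + 1 - 2 * m) := by ring
        omega
    have h1 := Nat.le_of_mul_le_mul_left (hsum m le_rfl) (by omega)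
    have h2 := hmono 0 m (by omega)
    have h2' := hmono m m (by omega)
    have h3 := hmono (m + m) (k - (m + m)) (by omega)
    rw [Nat.add_sub_cancel' (by omega)] at h3
    rw [zero_add] at h2
    omega
  obtain ⟨h1, h2, h3, h4, h5⟩ := hs (m + n) (by omega)
  obtain ⟨h1', h2', -, -⟩ := hT (m + n + 1) (by omega)
  have h6 := hmono 0 (m + n) (by omega)
  have h7 := hmono (m + n + 1) (k - (m + n + 1)) (by omega)
  rw [Nat.add_sub_cancel' (by omega)] at h7
  rw [zero_add] at h6
  exact ⟨s (m + n), T (m + n + 1), h1, h1', h2, h2', h3, h4, hshort, by omega, by omega⟩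

/-! ### The winding number along a geodesic -/

namespace RotationSystem

variable {V : Type*} {M : RotationSystem V} {a b c d : V}

theorem flow_congr {W : M.graph.Walk a b} {W' : M.graph.Walk c d} (h : W.darts = W'.darts) :
    M.flow W = M.flow W' := by
  funext g; simp only [flow, h]

end RotationSystem

namespace PlantedTriangulation

open RotationSystem SimpleGraph.Walk

variable {V : Type*} {G : PlantedTriangulation V} {E : Set G.graph.Dart} {u : V}
  {P Q : G.graph.Walk u G.A} {s t i j : ℕ}

variable (P Q) in
/-- The flow of the closed walk that follows `Q` up to position `s` and comes back along `P` from
position `i`. -/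
noncomputable def lassoFlow (s i : ℕ) (d : G.graph.Dart) : ℤ :=
  G.flow (Q.take s) d - G.flow (P.take i) d

theorem exists_isPotential_lassoFlow [Finite V] (hO : G.IsOrientation E)
    (h : Q.getVert s = P.getVert i) : ∃ f, G.IsPotential (lassoFlow P Q s i) f := by
  classical
  refine G.toPlanarMap.exists_isPotential hO _ (fun d => ?_) (fun g => ?_)
  · simp only [lassoFlow, flow_symm]; ring
  · simp only [lassoFlow]
    push_cast
    simp only [sub_mul, Finset.sum_sub_distrib]
    rw [hO.sum_flow, hO.sum_flow, h, sub_self]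

/-- What happens to the winding number in one excursion. -/
theorem IsExcursion.winding [Finite V] (hE : G.IsMinimalThreeOrientation E) {e : G.graph.Dart}
    (hP : G.IsLeftmost E P) (he : ∀ h : 0 < P.darts.length, P.darts[0] = e)
    (hQ : Q.length = G.graph.dist u G.A) (hx : P.IsExcursion Q s t i j) :
    ∃ h, G.IsPotential (fun d => lassoFlow P Q t j d - lassoFlow P Q s i d) h ∧
      h G.rootFace - 1 ≤ h (G.rightFace e) ∧
      (h (G.rightFace e) = h G.rootFace - 1 → i < j ∧ j - i ≤ t - s + 2 ∧
        ∃ (a : V) (C : G.graph.Walk a a), C.IsCycle ∧ C.length = (t - s) + (j - i) ∧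
          G.rootFace ∈ G.leftFaces C ∧ G.rightFace e ∈ G.rightFaces C ∧
          P.getVert i ∈ C.support ∧ P.getVert j ∈ C.support) := by
  have hO : G.IsOrientation E := hE.orientation
  have hPp := hP.isPath hE
  have hQp := Q.isPath_of_length_eq_dist hQ
  have hst := hx.lt
  have htl := hx.le_length
  have hlP := P.length_darts
  have hlQ := Q.length_darts
  have hne : i ≠ j := IsExcursion.ne hQp hx
  have hvne : P.getVert i ≠ P.getVert j := fun h =>
    hne (hPp.getVert_injOn hx.left_le hx.right_le h)
  set W := (Q.segment s t hst.le).copy hx.left_eq hx.right_eq with hW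
  have hWp : W.IsPath := by rw [hW, isPath_copy]; exact hQp.segment
  have hWl : W.length = t - s := by rw [hW, length_copy, length_segment htl]
  have hWs : ∀ z, z ∈ W.support ↔ ∃ r, s ≤ r ∧ r ≤ t ∧ Q.getVert r = z := fun z => by
    rw [hW, support_copy, mem_support_segment htl]
  have hWd : ∀ r, s ≤ r → r < t → ∀ hr : r < Q.darts.length, Q.darts[r] ∈ W.darts :=
    fun r h1 h2 h3 => by
      rw [hW, darts_copy]; exact mem_darts_segment.2 ⟨r, h1, h2, h3, rfl⟩
  have hflowQ : ∀ d, G.flow (Q.take t) d - G.flow (Q.take s) d = G.flow W d := fun d => by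
    rw [flow_take_eq Q hst.le, hW, flow_copy]; ring
  -- The piece of `P` closes the excursion: backwards if `i < j`, forwards if `j < i`.
  rcases lt_or_gt_of_ne hne with hij | hij
  · set W' := P.segment i j hij.le with hW'
    have hW'l : W'.length = j - i := length_segment hx.right_le
    have hflowP : ∀ d, G.flow (P.take j) d - G.flow (P.take i) d = G.flow W' d := fun d => by
      rw [flow_take_eq P hij.le]; ring
    have hflow : ∀ d, lassoFlow P Q t j d - lassoFlow P Q s i d = G.flow (W.append W'.reverse) d :=
      fun d => by
        rw [flow_append, flow_reverse, ← hflowQ, ← hflowP]; simp only [lassoFlow]; ring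
    -- Here `Q` and `P` share the edge; there is no cycle and the flows cancel.
    by_cases htriv : W.length = 1 ∧ W'.reverse.length = 1
    · refine ⟨0, fun d => ?_, by simp, fun h => by simp at h⟩
      change (0 : ℤ) - 0 = lassoFlow P Q t j d - lassoFlow P Q s i d
      rw [hflow, flow_append, flow_reverse]
      rw [length_reverse] at htriv
      obtain rfl : t = s + 1 := by omega
      obtain rfl : j = i + 1 := by omega
      rw [flow_congr (W := W) (W' := W')]
      · ring
      · rw [hW, hW', darts_copy, darts_segment_succ (by omega),
          darts_segment_succ (by have := hx.right_le; omega)]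
        simp only [List.cons.injEq, and_true]
        exact SimpleGraph.Dart.toProd_injective (Prod.ext hx.left_eq hx.right_eq)
    have hC : (W.append W'.reverse).IsCycle := by
      refine hWp.isCycle_append_of_ne hPp.segment.reverse hvne (fun z hz hz' => ?_) htriv
      obtain ⟨r, h1, h2, rfl⟩ := (hWs z).1 hz
      rw [support_reverse, List.mem_reverse, hW', mem_support_segment hx.right_le] at hz'
      obtain ⟨k, -, -, hk⟩ := hz'
      exact hx.mem_support h1 h2 (hk ▸ P.getVert_mem_support k)
    obtain ⟨h, hs⟩ := PlanarMap.exists_isSide (M := G.toPlanarMap) hO hC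
    have hr := hs.eq_one_or hC G.rootFace
    have hxe := hs.eq_one_or hC (G.rightFace e)
    refine ⟨h, fun d => (hs.pot d).trans (hflow d).symm, by omega, fun hh => ⟨hij, ?_,
      _, W.append W'.reverse, hC, ?_, (hs.left _).2 (by omega), (hs.right _).2 (by omega),
      start_mem_support _, ?_⟩⟩
    · refine IsExcursion.le_add_two hE.toIsThreeOrientation hP hPp hx hC hs
        ((hs.left _).2 (by omega)) hij ?_ ?_ ?_ ?_
      · intro z hz
        rw [mem_support_append_iff] at hz
        refine hz.imp (hWs z).1 fun hz => ?_
        rwa [support_reverse, List.mem_reverse, hW', mem_support_segment hx.right_le] at hz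
      · intro r h1 h2 h3
        rw [darts_append, List.mem_append]
        exact Or.inl (hWd r h1 h2 h3)
      · intro k h1 h2 h3
        rw [darts_append, List.mem_append]
        refine Or.inr (mem_darts_reverse.2 ?_)
        rw [SimpleGraph.Dart.symm_symm]
        exact mem_darts_segment.2 ⟨k, h1, h2, h3, rfl⟩
      · rw [length_append, length_reverse, hWl, hW'l]
    · rw [length_append, length_reverse, hWl, hW'l]
    · rw [mem_support_append_iff]; exact Or.inl W.end_mem_support
  · set W' := P.segment j i hij.le with hW'
    have hW'l : W'.length = i - j := length_segment hx.left_le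
    have hflowP : ∀ d, G.flow (P.take i) d - G.flow (P.take j) d = G.flow W' d := fun d => by
      rw [flow_take_eq P hij.le]; ring
    have hflow : ∀ d, lassoFlow P Q t j d - lassoFlow P Q s i d = G.flow (W.append W') d :=
      fun d => by
        rw [flow_append, ← hflowQ, ← hflowP]; simp only [lassoFlow]; ring
    by_cases htriv : W.length = 1 ∧ W'.length = 1
    · refine ⟨0, fun d => ?_, by simp, fun h => by simp at h⟩
      change (0 : ℤ) - 0 = lassoFlow P Q t j d - lassoFlow P Q s i d
      rw [hflow, flow_append]
      obtain rfl : t = s + 1 := by omega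
      obtain rfl : i = j + 1 := by omega
      rw [flow_congr (W := W) (W' := W'.reverse), flow_reverse]
      · ring
      · rw [hW, hW', darts_copy, darts_segment_succ (by omega), darts_reverse,
          darts_segment_succ (by have := hx.left_le; omega)]
        simp only [List.map_cons, List.map_nil, List.reverse_singleton, List.cons.injEq, and_true]
        exact SimpleGraph.Dart.toProd_injective (Prod.ext hx.left_eq hx.right_eq)
    have hC : (W.append W').IsCycle := by
      refine hWp.isCycle_append_of_ne hPp.segment hvne (fun z hz hz' => ?_) htriv
      obtain ⟨r, h1, h2, rfl⟩ := (hWs z).1 hz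
      rw [hW', mem_support_segment hx.left_le] at hz'
      obtain ⟨k, -, -, hk⟩ := hz'
      exact hx.mem_support h1 h2 (hk ▸ P.getVert_mem_support k)
    obtain ⟨h, hs⟩ := PlanarMap.exists_isSide (M := G.toPlanarMap) hO hC
    have hr := hs.eq_one_or hC G.rootFace
    have hxe := hs.eq_one_or hC (G.rightFace e)
    refine ⟨h, fun d => (hs.pot d).trans (hflow d).symm, by omega, fun hh => ?_⟩
    refine absurd hij (IsExcursion.not_lt hE.toIsThreeOrientation hP hPp hQp hQ hx hC hs
      ((hs.left _).2 (by omega)) (fun h' => by rw [he h']; omega) ?_ ?_ ?_ ?_)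
    · intro z hz
      rw [mem_support_append_iff] at hz
      refine hz.imp (hWs z).1 fun hz => ?_
      rwa [hW', mem_support_segment hx.left_le] at hz
    · intro r h1 h2 h3
      rw [darts_append, List.mem_append]
      exact Or.inl (hWd r h1 h2 h3)
    · intro k h1 h2 h3
      rw [darts_append, List.mem_append]
      exact Or.inr (mem_darts_segment.2 ⟨k, h1, h2, h3, rfl⟩)
    · rw [length_append, hWl, hW'l]

/-- A geodesic with large negative winding number contains a short clockwise excursion far from
its ends. -/
theorem exists_short_cycle [Finite V] (hE : G.IsMinimalThreeOrientation E) {e : G.graph.Dart}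
    {P Q : G.graph.Walk e.fst G.A}
    (hP : G.IsLeftmost E P) (he : ∀ h : 0 < P.darts.length, P.darts[0] = e)
    (hQ : Q.length = G.graph.dist e.fst G.A) {k m : ℕ} (hw : G.windingNumber P Q = -k)
    (hm : 1 ≤ m) (hk : 3 * m ≤ k) :
    ∃ s t i j, P.IsExcursion Q s t i j ∧ i < j ∧ j - i ≤ t - s + 2 ∧
      m * (t - s) + 2 * m ≤ Q.length ∧ m ≤ s ∧ m + t ≤ Q.length ∧
      ∃ (a : V) (C : G.graph.Walk a a), C.IsCycle ∧ C.length = (t - s) + (j - i) ∧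
        G.rootFace ∈ G.leftFaces C ∧ G.rightFace e ∈ G.rightFaces C ∧
        P.getVert i ∈ C.support ∧ P.getVert j ∈ C.support := by
  classical
  have hO : G.IsOrientation E := hE.orientation
  have hPp := hP.isPath hE
  obtain ⟨f, hf, hfe⟩ : ∃ f, G.IsWindingFunction (Q.append P.reverse) G.rootFace f ∧
      f (G.rightFace e) = -k := by
    rw [windingNumber, wind] at hw
    -- The default value 0 of `wind` is excluded, since `k` is positive.
    split_ifs at hw with h
    · exact ⟨_, h.choose_spec, hw⟩
    · omega
  -- Off `P` the index and the potential are dummies; only visits to `P` are used.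
  have hidx : ∀ s, ∃ i, Q.getVert s ∈ P.support → i ≤ P.length ∧ P.getVert i = Q.getVert s := by
    intro s
    by_cases hs : Q.getVert s ∈ P.support
    · obtain ⟨i, h1, h2⟩ := mem_support_iff_exists_getVert.1 hs
      exact ⟨i, fun _ => ⟨h2, h1⟩⟩
    · exact ⟨0, fun h => absurd h hs⟩
  choose idx hidx using hidx
  have hpot : ∀ s, ∃ h, Q.getVert s ∈ P.support → G.IsPotential (lassoFlow P Q s (idx s)) h := by
    intro s
    by_cases hs : Q.getVert s ∈ P.support
    · obtain ⟨h, hh⟩ := exists_isPotential_lassoFlow hO (hidx s hs).2.symm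
      exact ⟨h, fun _ => hh⟩
    · exact ⟨0, fun h => absurd h hs⟩
  choose h hh using hpot
  have hS0 : Q.getVert 0 ∈ P.support := by rw [getVert_zero]; exact P.start_mem_support
  have hSL : Q.getVert Q.length ∈ P.support := by rw [getVert_length]; exact P.end_mem_support
  have hdiff : ∀ s t, Q.getVert s ∈ P.support → Q.getVert t ∈ P.support → s < t →
      t ≤ Q.length → (∀ r, s < r → r < t → ¬ Q.getVert r ∈ P.support) →
      ∃ g, P.IsExcursion Q s t (idx s) (idx t) ∧ G.IsPotential (fun d =>
        lassoFlow P Q t (idx t) d - lassoFlow P Q s (idx s) d) g ∧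
      (h t (G.rightFace e) - h t G.rootFace) - (h s (G.rightFace e) - h s G.rootFace) =
        g (G.rightFace e) - g G.rootFace ∧ g G.rootFace - 1 ≤ g (G.rightFace e) ∧
      (g (G.rightFace e) = g G.rootFace - 1 → idx s < idx t ∧ idx t - idx s ≤ t - s + 2 ∧
        ∃ (a : V) (C : G.graph.Walk a a), C.IsCycle ∧ C.length = (t - s) + (idx t - idx s) ∧
          G.rootFace ∈ G.leftFaces C ∧ G.rightFace e ∈ G.rightFaces C ∧
          P.getVert (idx s) ∈ C.support ∧ P.getVert (idx t) ∈ C.support) := by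
    intro s t hs ht hst htl hgap
    have hx : P.IsExcursion Q s t (idx s) (idx t) :=
      ⟨hst, htl, (hidx s hs).1, (hidx t ht).1, (hidx s hs).2.symm, (hidx t ht).2.symm, hgap⟩
    obtain ⟨g, h1, h2, h3⟩ := IsExcursion.winding hE hP he hQ hx
    refine ⟨g, hx, h1, ?_, h2, h3⟩
    have h4 : G.IsPotential (fun d => lassoFlow P Q t (idx t) d - lassoFlow P Q s (idx s) d)
        (fun f => h t f - h s f) := fun d => by
      have := hh t ht d
      have := hh s hs d
      change (h t _ - h s _) - (h t _ - h s _) = lassoFlow P Q t (idx t) d - lassoFlow P Q s _ d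
      linarith
    have := h1.sub_eq h4 (G.rightFace e) G.rootFace
    linarith
  -- The lasso at the start is trivial, and the one at the end is the closed curve that defines
  -- `windingNumber`.
  have hω0 : h 0 (G.rightFace e) - h 0 G.rootFace = 0 := by
    have h1 := hh 0 hS0
    have h2 : idx 0 = 0 := by
      have := (hidx 0 hS0)
      rw [getVert_zero] at this
      exact (hPp.getVert_eq_start_iff this.1).1 this.2
    rw [h2] at h1
    have h3 : G.IsPotential (lassoFlow P Q 0 0) (fun _ => 0) := fun d => by
      simp [lassoFlow]
    simpa using h1.sub_eq h3 (G.rightFace e) G.rootFace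
  have hωL : h Q.length (G.rightFace e) - h Q.length G.rootFace ≤ -k := by
    have h1 := hh Q.length hSL
    have h2 : idx Q.length = P.length := by
      have := (hidx Q.length hSL)
      rw [getVert_length] at this
      exact (hPp.getVert_eq_end_iff this.1).1 this.2
    rw [h2] at h1
    have h3 : G.IsPotential (lassoFlow P Q Q.length P.length) f := fun d => by
      refine (hf.2 d).trans ?_
      change G.flow (Q.append P.reverse) d = _
      rw [flow_append, flow_reverse, lassoFlow,
        flow_congr (W := Q.take Q.length) (W' := Q) (by simp [darts_take, ← length_darts]),
        flow_congr (W := P.take P.length) (W' := P) (by simp [darts_take, ← length_darts])]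
      ring
    have := h1.sub_eq h3 (G.rightFace e) G.rootFace
    have h4 := hf.1
    linarith
  have hstep : ∀ s t, Q.getVert s ∈ P.support → Q.getVert t ∈ P.support → s < t →
      t ≤ Q.length → (∀ r, s < r → r < t → ¬ Q.getVert r ∈ P.support) →
      h s (G.rightFace e) - h s G.rootFace - 1 ≤ h t (G.rightFace e) - h t G.rootFace := by
    intro s t hs ht hst htl hgap
    obtain ⟨g, -, -, h10, h11, -⟩ := hdiff s t hs ht hst htl hgap
    linarith
  obtain ⟨s, t, h1, h2, h3, h4, h5, h6, h7, h8, h9⟩ := exists_short_descent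
    (fun s => Q.getVert s ∈ P.support) (fun s => h s (G.rightFace e) - h s G.rootFace)
    (L := Q.length) (k := k) (m := m) hS0 hSL hω0 hωL hstep hm hk
  obtain ⟨g, hx, -, h10, h11, h12⟩ := hdiff s t h1 h2 h3 h4 h5
  obtain ⟨h13, h14, h15⟩ := h12 (by linarith)
  exact ⟨s, t, idx s, idx t, hx, h13, h14, h7, h8, h9, h15⟩

end PlantedTriangulation

/-! ### The contour exploration of the blossoming tree -/

namespace RotationSystem

variable {V : Type*} {M : RotationSystem V}

/-- The darts at a vertex, enumerated in clockwise order. -/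
theorem rot_bijOn [Finite V] (s : M.graph.Dart) : ∃ p, 0 < p ∧ (M.rot ^ p) s = s ∧
    Set.BijOn (fun j => (M.rot ^ j) s) (Set.Iio p) {g | g.fst = s.fst} := by
  have hper : s ∈ Function.periodicPts M.rot := M.rot.injective.mem_periodicPts s
  refine ⟨Function.minimalPeriod M.rot s, Function.minimalPeriod_pos_of_mem_periodicPts hper, ?_,
    fun j _ => M.rot_pow_fst s j, ?_, ?_⟩
  · rw [← Equiv.Perm.iterate_eq_pow]; exact Function.iterate_minimalPeriod
  · simp only [← Equiv.Perm.iterate_eq_pow]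
    exact Function.iterate_injOn_Iio_minimalPeriod
  · intro g hg
    obtain ⟨n, hn⟩ := (M.rot_sameCycle s g (Eq.symm hg)).exists_nat_pow_eq
    refine ⟨n % Function.minimalPeriod M.rot s,
      Nat.mod_lt _ (Function.minimalPeriod_pos_of_mem_periodicPts hper), ?_⟩
    simp only [← Equiv.Perm.iterate_eq_pow] at hn ⊢
    rw [Function.iterate_mod_minimalPeriod_eq, hn]

/-- Induction along the counterclockwise rotation around a vertex. -/
theorem rot_induction_backward [Finite V] {p : M.graph.Dart → Prop} {d d' : M.graph.Dart}
    (hd : p d) (h : d'.fst = d.fst) (step : ∀ g, g.fst = d.fst → p (M.rot g) → p g) : p d' := by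
  obtain ⟨n, hn⟩ := (M.rot_sameCycle d' d h).exists_nat_pow_eq
  induction n generalizing d' with
  | zero => rw [pow_zero] at hn; rwa [show d' = d from hn]
  | succ n ih =>
    exact step d' h (ih (by rw [M.rot_fst, h]) (by rw [← hn, pow_succ, Equiv.Perm.mul_apply]))

open Classical in
theorem card_filter_rot_pow [Finite V] {s : M.graph.Dart} {p : ℕ}
    (hp : Set.BijOn (fun j => (M.rot ^ j) s) (Set.Iio p) {g | g.fst = s.fst})
    (E : Set M.graph.Dart) :
    #{i ∈ range p | (M.rot ^ i) s ∈ E} = {g | g ∈ E ∧ g.fst = s.fst}.ncard := by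
  rw [← Set.ncard_coe_finset]
  refine Set.ncard_congr (fun j _ => (M.rot ^ j) s) ?_ ?_ ?_
  · intro j hj
    simp only [coe_filter, mem_range, Set.mem_ofPred_eq] at hj
    exact ⟨hj.2, M.rot_pow_fst s j⟩
  · intro i j hi hj hij
    simp only [coe_filter, mem_range, Set.mem_ofPred_eq] at hi hj
    exact hp.injOn hi.1 hj.1 hij
  · rintro g ⟨hg, hgs⟩
    obtain ⟨j, hj, rfl⟩ := hp.surjOn hgs
    exact ⟨j, by simpa using ⟨hj, hg⟩, rfl⟩

end RotationSystem

namespace PlantedTriangulation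

open RotationSystem

variable {V : Type*} {G : PlantedTriangulation V} {E T : Set G.graph.Dart}

theorem contour_succ (t : ℕ) : G.contour T (t + 1) = G.contourNext T (G.contour T t) :=
  Function.iterate_succ_apply' _ _ _

theorem contourNext_of_mem {d : G.graph.Dart} (h : d ∈ T ∨ d.symm ∈ T) :
    G.contourNext T d = G.faceNext d := if_pos h

theorem contourNext_of_notMem {d : G.graph.Dart} (h : ¬(d ∈ T ∨ d.symm ∈ T)) :
    G.contourNext T d = G.rot d := if_neg h

/-- On a finite set this makes the exploration periodic: it returns to the root corner, with all
corners of one period distinct. -/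
theorem contourNext_injective : Function.Injective (G.contourNext T) := by
  intro d d' h
  by_cases h1 : d ∈ T ∨ d.symm ∈ T <;> by_cases h2 : d' ∈ T ∨ d'.symm ∈ T
  · rw [contourNext_of_mem h1, contourNext_of_mem h2] at h
    exact G.faceNext.injective h
  · rw [contourNext_of_mem h1, contourNext_of_notMem h2, faceNext_apply] at h
    rw [← G.rot.injective h, SimpleGraph.Dart.symm_symm] at h2
    exact absurd h1.symm h2
  · rw [contourNext_of_notMem h1, contourNext_of_mem h2, faceNext_apply] at h
    rw [G.rot.injective h, SimpleGraph.Dart.symm_symm] at h1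
    exact absurd h2.symm h1
  · rw [contourNext_of_notMem h1, contourNext_of_notMem h2] at h
    exact G.rot.injective h

theorem contourLength_pos [Finite V] : 0 < G.contourLength T :=
  Function.minimalPeriod_pos_of_mem_periodicPts (contourNext_injective.mem_periodicPts _)

theorem contour_contourLength : G.contour T (G.contourLength T) = G.root :=
  Function.iterate_minimalPeriod

theorem contour_injOn : Set.InjOn (G.contour T) (Set.Iio (G.contourLength T)) :=
  Function.iterate_injOn_Iio_minimalPeriod

theorem lt_contourLength {s t : ℕ} (hs : s < G.contourLength T)
    (h : ∀ k, s < k → k ≤ t → G.contour T k ≠ G.root) : t < G.contourLength T := by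
  by_contra! hlt
  exact h _ hs hlt contour_contourLength

/-- The exploration goes around the subtree above `d`, gaining two stems, and comes back to `d`. -/
def HasTour (T E : Set G.graph.Dart) (d : G.graph.Dart) : Prop :=
  ∀ s, G.contour T s = G.rot d → ∃ t, s ≤ t ∧ G.contour T t = d ∧
    G.cornerLabel T E t = G.cornerLabel T E s + 2 ∧ ∀ k, s < k → k ≤ t → G.contour T k ≠ G.root

theorem cornerLabel_succ_of_mem {t : ℕ} (h : G.contour T t ∈ T ∨ (G.contour T t).symm ∈ T) :
    G.cornerLabel T E (t + 1) = G.cornerLabel T E t - 1 := by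
  rw [cornerLabel, if_pos h]

open Classical in
theorem cornerLabel_succ_of_notMem {t : ℕ}
    (h : ¬(G.contour T t ∈ T ∨ (G.contour T t).symm ∈ T)) :
    G.cornerLabel T E (t + 1) = G.cornerLabel T E t + if G.contour T t ∈ E then 1 else 0 := by
  rw [cornerLabel, if_neg h]; split_ifs <;> simp

open Classical in
/-- The exploration from a corner to the next corner at the same vertex. -/
theorem IsBlossomingTree.exists_contour_eq_rot (hO : G.IsOrientation E)
    (hT : G.IsBlossomingTree T E) {g : G.graph.Dart} (hg : g ∉ T) (hr : G.rot g ≠ G.root)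
    (htour : ∀ d ∈ T, d.snd = g.fst → HasTour T E d) {s : ℕ} (hs : G.contour T s = g) :
    ∃ t, s < t ∧ G.contour T t = G.rot g ∧
      G.cornerLabel T E t = G.cornerLabel T E s + (if g ∈ E then 1 else 0) ∧
      ∀ k, s < k → k ≤ t → G.contour T k ≠ G.root := by
  subst hs
  -- A child edge contributes nothing: one is lost on the way in, two are gained in the subtree, one
  -- is lost on the way back.
  by_cases h : (G.contour T s).symm ∈ T
  · have h1 : G.contour T (s + 1) = G.rot (G.contour T s).symm := by
      rw [contour_succ, contourNext_of_mem (Or.inr h), faceNext_apply]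
    obtain ⟨t, hst, ht, hl, hk⟩ := htour _ h rfl _ h1
    have h2 : G.contour T (t + 1) = G.rot (G.contour T s) := by
      rw [contour_succ, ht, contourNext_of_mem (Or.inl h), faceNext_apply,
        SimpleGraph.Dart.symm_symm]
    refine ⟨t + 1, by omega, h2, ?_, ?_⟩
    · rw [cornerLabel_succ_of_mem (by rw [ht]; exact Or.inl h), hl,
        cornerLabel_succ_of_mem (Or.inr h), if_neg ((hO _).1 (hT.oriented h))]
      ring
    · intro k hk1 hk2
      rcases eq_or_ne k (t + 1) with rfl | h3
      · rwa [h2]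
      rcases eq_or_ne k (s + 1) with rfl | h4
      · intro h5
        rw [h1] at h5
        exact hT.root_no_parent _ h (by rw [← G.rot_fst, h5]; rfl)
      · exact hk k (by omega) (by omega)
  · have hn : ¬(G.contour T s ∈ T ∨ (G.contour T s).symm ∈ T) := by tauto
    have h1 : G.contour T (s + 1) = G.rot (G.contour T s) := by
      rw [contour_succ, contourNext_of_notMem hn]
    refine ⟨s + 1, by omega, h1, cornerLabel_succ_of_notMem hn, fun k hk1 hk2 => ?_⟩
    rw [show k = s + 1 by omega, h1]
    exact hr

open Classical in
theorem IsBlossomingTree.exists_contour_eq_rot_pow (hO : G.IsOrientation E)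
    (hT : G.IsBlossomingTree T E) {g : G.graph.Dart}
    (htour : ∀ d ∈ T, d.snd = g.fst → HasTour T E d) {s : ℕ} (hs : G.contour T s = g) (n : ℕ)
    (hg : ∀ i < n, (G.rot ^ i) g ∉ T) (hr : ∀ i < n, (G.rot ^ (i + 1)) g ≠ G.root) :
    ∃ t, s ≤ t ∧ G.contour T t = (G.rot ^ n) g ∧
      G.cornerLabel T E t = G.cornerLabel T E s + #{i ∈ range n | (G.rot ^ i) g ∈ E} ∧
      ∀ k, s < k → k ≤ t → G.contour T k ≠ G.root := by
  induction n with
  | zero => exact ⟨s, le_rfl, hs, by simp, fun k h1 h2 => by omega⟩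
  | succ n ih =>
    obtain ⟨t, hst, ht, hl, hk⟩ := ih (fun i hi => hg i (by omega)) (fun i hi => hr i (by omega))
    obtain ⟨t', htt', ht', hl', hk'⟩ := hT.exists_contour_eq_rot hO (hg n (by omega))
      (by have := hr n (by omega); rwa [pow_succ', Equiv.Perm.mul_apply] at this)
      (by rw [G.rot_pow_fst]; exact htour) ht
    refine ⟨t', by omega, by rw [ht', pow_succ', Equiv.Perm.mul_apply], ?_, fun k h1 h2 => ?_⟩
    · rw [hl', hl, range_add_one, filter_insert]
      split_ifs with h
      · rw [card_insert_of_notMem (by simp)]; push_cast; ring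
      · ring
    · rcases le_or_gt k t with h | h
      · exact hk k h1 h
      · exact hk' k h h2

/-- The exploration from the first corner after `d` to a later corner at the tail of `d`. -/
theorem IsBlossomingTree.exists_rot_pow_eq [Finite V] (hE : G.IsThreeOrientation E)
    (hT : G.IsBlossomingTree T E) {d : G.graph.Dart} (hd : d ∈ T) : ∃ p,
    (∀ i < p, (G.rot ^ i) (G.rot d) ∉ T) ∧ (∀ i, (G.rot ^ i) (G.rot d) ≠ G.root) ∧
    (G.rot ^ p) (G.rot d) = d ∧
    (∀ g : G.graph.Dart, g.fst = d.fst → ∃ i ≤ p, (G.rot ^ i) (G.rot d) = g) ∧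
    ∀ [DecidablePred fun i => (G.rot ^ i) (G.rot d) ∈ E],
      #{i ∈ range p | (G.rot ^ i) (G.rot d) ∈ E} = 2 := by
  classical
  obtain ⟨p, hp, hps, hbij⟩ := rot_bijOn (M := G.toRotationSystem) (G.rot d)
  obtain ⟨p, rfl⟩ : ∃ q, p = q + 1 := ⟨p - 1, by omega⟩
  have hpd : (G.rot ^ p) (G.rot d) = d := by
    rw [pow_succ', Equiv.Perm.mul_apply] at hps
    exact G.rot.injective hps
  have hfst : (G.rot d).fst = d.fst := G.rot_fst d
  refine ⟨p, fun i hi h => ?_, fun i h => ?_, hpd, fun g hg => ?_, ?_⟩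
  · have := hT.parent_unique _ h _ hd (by rw [G.rot_pow_fst, hfst])
    have := hbij.injOn (show i < p + 1 by omega) (show p < p + 1 by omega) (this.trans hpd.symm)
    omega
  · exact hT.root_no_parent _ hd (by rw [← hfst, ← G.rot_pow_fst _ i, h]; rfl)
  · obtain ⟨i, hi, rfl⟩ := hbij.surjOn (show g.fst = (G.rot d).fst by rw [hg, hfst])
    exact ⟨i, by have : i < p + 1 := hi; omega, rfl⟩
  · intro _
    -- Outdegree 3 with `d` itself removed leaves two stems.
    have h := card_filter_rot_pow hbij E
    rw [hfst, hE.outdeg _ (hT.avoids d hd).1 (hT.avoids d hd).2.1 (hT.root_no_parent d hd),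
      range_add_one, filter_insert, if_pos (by rw [hpd]; exact hT.oriented hd),
      card_insert_of_notMem (by simp)] at h
    convert Nat.succ.inj h using 1
    convert rfl

/-- Induction from the leaves: at the tail of `d` the children cancel out and the two stems remain.
The descent is well founded because every vertex of the tree reaches the root vertex, which has no
parent, so the parent relation has no cycles. -/
theorem IsBlossomingTree.hasTour [Finite V] (hE : G.IsThreeOrientation E)
    (hT : G.IsBlossomingTree T E) {d : G.graph.Dart} (hd : d ∈ T) : HasTour T E d := by
  classical
  set r : V → V → Prop := fun x y => ∃ d ∈ T, d.fst = x ∧ d.snd = y with hr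
  have huniq : ∀ {x y z}, r x y → r x z → y = z := by
    rintro x y z ⟨d, hd, rfl, rfl⟩ ⟨d', hd', h, rfl⟩
    rw [hT.parent_unique d hd d' hd' h.symm]
  have hcycle : ∀ {x y}, Relation.TransGen r x x → r x y → Relation.TransGen r y y := by
    intro x y h hxy
    obtain ⟨z, hz, hzx⟩ := Relation.TransGen.head'_iff.1 h
    rw [huniq hz hxy] at hzx
    exact Relation.TransGen.tail' hzx hxy
  have hirr : ∀ x, ¬Relation.TransGen r x x := by
    intro x h
    have hx : x ≠ G.A ∧ x ≠ G.B := by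
      obtain ⟨z, ⟨d, hd, rfl, -⟩, -⟩ := Relation.TransGen.head'_iff.1 h
      exact ⟨(hT.avoids d hd).1, (hT.avoids d hd).2.1⟩
    have key : ∀ y, Relation.ReflTransGen r x y → Relation.TransGen r y y := by
      intro y hy
      induction hy with
      | refl => exact h
      | tail _ hbc ih => exact hcycle ih hbc
    obtain ⟨z, ⟨d, hd, h1, -⟩, -⟩ :=
      Relation.TransGen.head'_iff.1 (key _ (hT.reaches_root x hx.1 hx.2))
    exact hT.root_no_parent d hd h1
  have : Std.Irrefl (Relation.TransGen r) := ⟨hirr⟩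
  have hwf : WellFounded (Relation.TransGen r) := Finite.wellFounded_of_trans_of_irrefl _
  induction hx : d.fst using hwf.induction generalizing d with
  | _ x ih =>
    subst hx
    intro s hs
    obtain ⟨p, hp1, hp2, hp3, hp4, hp5⟩ := hT.exists_rot_pow_eq hE hd
    obtain ⟨t, h1, h2, h3, h4⟩ := hT.exists_contour_eq_rot_pow hE.orientation (g := G.rot d)
      (fun d' hd' h => ih _ (.single ⟨d', hd', rfl, h.trans (G.rot_fst d)⟩) hd' rfl) hs p hp1
      (fun i _ => hp2 _)
    exact ⟨t, h1, h2.trans hp3, by rw [h3, hp5]; rfl, h4⟩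

/-- The exploration visits all corners outside `A` and `B`, and the labels of the corners at a
vertex differ by at most two. -/
theorem IsBlossomingTree.exists_contour_eq [Finite V] (hE : G.IsThreeOrientation E)
    (hT : G.IsBlossomingTree T E) {x : V} (hA : x ≠ G.A) (hB : x ≠ G.B) :
    ∃ l : ℤ, (x = G.rootVertex → l = 2) ∧ ∀ g : G.graph.Dart, g.fst = x →
      ∃ t < G.contourLength T, G.contour T t = g ∧ l ≤ G.cornerLabel T E t ∧
        G.cornerLabel T E t ≤ l + 2 := by
  classical
  have := hT.reaches_root x hA hB
  induction this using Relation.ReflTransGen.head_induction_on with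
  | refl =>
    refine ⟨2, fun _ => rfl, fun g hg => ?_⟩
    obtain ⟨p, hp, hps, hbij⟩ := rot_bijOn (M := G.toRotationSystem) G.root
    obtain ⟨n, hn, rfl⟩ := hbij.surjOn hg
    have hn : n < p := hn
    obtain ⟨t, h1, h2, h3, h4⟩ := hT.exists_contour_eq_rot_pow hE.orientation (g := G.root)
      (fun d' hd' h => hT.hasTour hE hd') (s := 0) rfl n
      (fun i hi h => hT.root_no_parent _ h (G.rot_pow_fst _ _))
      (fun i hi h => by
        have := hbij.injOn (show i + 1 < p by omega) hp h
        omega)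
    have h5 : #{i ∈ range n | (G.rot ^ i) G.root ∈ E} ≤ 2 := by
      have := card_filter_rot_pow hbij E
      rw [show G.root.fst = G.rootVertex from rfl, hE.outdeg_root] at this
      rw [← this]
      exact card_le_card (filter_subset_filter _ (range_mono hn.le))
    refine ⟨t, lt_contourLength contourLength_pos h4, h2, ?_, ?_⟩ <;>
      rw [h3, show G.cornerLabel T E 0 = 2 from rfl] <;> omega
  | @head x y hxy _ ih =>
    obtain ⟨d, hd, rfl, rfl⟩ := hxy
    obtain ⟨l, -, hl⟩ := ih (hT.avoids d hd).2.2.1 (hT.avoids d hd).2.2.2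
    obtain ⟨s, hsN, hs, -⟩ := hl d.symm rfl
    have hs1 : G.contour T (s + 1) = G.rot d := by
      rw [contour_succ, hs, contourNext_of_mem (Or.inr (by simpa using hd)), faceNext_apply,
        SimpleGraph.Dart.symm_symm]
    -- The first corner after entering from the parent has the least label; the later ones only gain
    -- stems, at most two.
    refine ⟨G.cornerLabel T E (s + 1), fun h => absurd h (hT.root_no_parent d hd), fun g hg => ?_⟩
    obtain ⟨p, hp1, hp2, hp3, hp4, hp5⟩ := hT.exists_rot_pow_eq hE hd
    obtain ⟨n, hn, rfl⟩ := hp4 g hg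
    obtain ⟨t, h1, h2, h3, h4⟩ := hT.exists_contour_eq_rot_pow hE.orientation (g := G.rot d)
      (fun d' hd' h => hT.hasTour hE hd') hs1 n (fun i hi => hp1 i (by omega)) (fun i _ => hp2 _)
    have h5 : #{i ∈ range n | (G.rot ^ i) (G.rot d) ∈ E} ≤ 2 := by
      rw [← hp5]
      exact card_le_card (filter_subset_filter _ (range_mono hn))
    refine ⟨t, lt_contourLength hsN fun k hk1 hk2 => ?_, h2, ?_, ?_⟩
    · rcases eq_or_ne k (s + 1) with rfl | h
      · rw [hs1]; exact hp2 0
      · exact h4 k (by omega) hk2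
    all_goals rw [h3]; omega

end PlantedTriangulation

/-! ### Corner labels, visit times and the jump of each face -/

namespace PlantedTriangulation

open RotationSystem

variable {V : Type*} {G : PlantedTriangulation V} {E T : Set G.graph.Dart}

variable (G) in
/-- The vertices of the blossoming tree that are not buds. -/
def IsInner (x : V) : Prop := x ≠ G.A ∧ x ≠ G.B

theorem isInner_rootVertex : G.IsInner G.rootVertex := ⟨rootVertex_ne_A, B_ne_rootVertex.symm⟩

theorem IsBlossomingTree.isInner_fst (hT : G.IsBlossomingTree T E) {d : G.graph.Dart}
    (hd : d ∈ T) : G.IsInner d.fst := ⟨(hT.avoids d hd).1, (hT.avoids d hd).2.1⟩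

theorem IsBlossomingTree.isInner_snd (hT : G.IsBlossomingTree T E) {d : G.graph.Dart}
    (hd : d ∈ T) : G.IsInner d.snd := (hT.avoids d hd).2.2

/-- The time at which a corner is visited by the exploration. -/
noncomputable def visitTime (T : Set G.graph.Dart) (g : G.graph.Dart) : ℕ :=
  sInf {t | G.contour T t = g}

/-- The label of a corner. -/
noncomputable def visitLabel (T E : Set G.graph.Dart) (g : G.graph.Dart) : ℤ :=
  G.cornerLabel T E (visitTime T g)

theorem visitTime_eq {t : ℕ} {g : G.graph.Dart} (ht : t < G.contourLength T)
    (h : G.contour T t = g) : visitTime T g = t :=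
  contour_injOn (lt_of_le_of_lt (Nat.sInf_le h) ht) ht
    ((Nat.sInf_mem (s := {t | G.contour T t = g}) ⟨t, h⟩).trans h.symm)

theorem visitLabel_eq {t : ℕ} {g : G.graph.Dart} (ht : t < G.contourLength T)
    (h : G.contour T t = g) : visitLabel T E g = G.cornerLabel T E t := by
  rw [visitLabel, visitTime_eq ht h]

theorem visitLabel_root [Finite V] : visitLabel T E G.root = 2 :=
  visitLabel_eq contourLength_pos rfl

/-- The other side of a stem. -/
def IsJump (T E : Set G.graph.Dart) (d : G.graph.Dart) : Prop := d.symm ∈ E ∧ d.symm ∉ T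

theorem mem_of_not_isJump (hO : G.IsOrientation E) {g : G.graph.Dart}
    (h : ¬IsJump T E g) : g.symm ∈ T ∨ g ∈ E := by
  by_contra! h'
  exact h ⟨(hO _).2 h'.2, h'.1⟩

theorem IsBlossomingTree.visitTime_lt_symm (hT : G.IsBlossomingTree T E) {d : G.graph.Dart}
    (hd : d ∈ E) (hd' : d ∉ T) (h : G.IsInner d.snd) : visitTime T d < visitTime T d.symm := by
  obtain ⟨s, t, hst, ht, h1, h2⟩ := hT.tail_first d hd hd' h.1 h.2
  rw [visitTime_eq (hst.trans ht) h1, visitTime_eq ht h2]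
  exact hst

theorem ne_root_of_leftFace_ne {g : G.graph.Dart} (h : G.leftFace g ≠ G.rootFace) :
    g ≠ G.root := fun h' => h (by rw [h']; rfl)

variable [Finite V]

theorem IsBlossomingTree.contour_visitTime (hE : G.IsThreeOrientation E)
    (hT : G.IsBlossomingTree T E) {g : G.graph.Dart} (hg : G.IsInner g.fst) :
    visitTime T g < G.contourLength T ∧ G.contour T (visitTime T g) = g := by
  obtain ⟨l, -, h⟩ := hT.exists_contour_eq hE hg.1 hg.2
  obtain ⟨t, ht, hgt, -⟩ := h g rfl
  rw [visitTime_eq ht hgt]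
  exact ⟨ht, hgt⟩

theorem IsBlossomingTree.exists_visitLabel_mem (hE : G.IsThreeOrientation E)
    (hT : G.IsBlossomingTree T E) {x : V} (hx : G.IsInner x) :
    ∃ l : ℤ, (x = G.rootVertex → l = 2) ∧ ∀ g : G.graph.Dart, g.fst = x →
      l ≤ visitLabel T E g ∧ visitLabel T E g ≤ l + 2 := by
  obtain ⟨l, h1, h⟩ := hT.exists_contour_eq hE hx.1 hx.2
  refine ⟨l, h1, fun g hg => ?_⟩
  obtain ⟨t, ht, hgt, h2⟩ := h g hg
  rwa [visitLabel_eq ht hgt]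

theorem IsBlossomingTree.label_mem (hE : G.IsThreeOrientation E)
    (hT : G.IsBlossomingTree T E) {g : G.graph.Dart} (hg : G.IsInner g.fst) :
    visitLabel T E g - 2 ≤ G.label T E g.fst ∧ G.label T E g.fst ≤ visitLabel T E g := by
  obtain ⟨l, -, h⟩ := hT.exists_visitLabel_mem hE hg
  rw [label, if_neg hg.1, if_neg hg.2]
  set S := {l | ∃ t < G.contourLength T, (G.contour T t).fst = g.fst ∧
    G.cornerLabel T E t = l} with hS
  have hlow : ∀ k ∈ S, l ≤ k := by
    rintro _ ⟨t, ht, hgt, rfl⟩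
    rw [← visitLabel_eq ht rfl]
    exact (h _ hgt).1
  have hmem : visitLabel T E g ∈ S := by
    obtain ⟨h1, h2⟩ := hT.contour_visitTime hE hg
    exact ⟨_, h1, by rw [h2], rfl⟩
  constructor
  · have := le_csInf ⟨_, hmem⟩ hlow
    have := (h g rfl).2
    linarith
  · exact csInf_le ⟨l, hlow⟩ hmem

theorem IsBlossomingTree.two_le_visitLabel (hE : G.IsThreeOrientation E)
    (hT : G.IsBlossomingTree T E) {g : G.graph.Dart} (hg : g.fst = G.rootVertex) :
    2 ≤ visitLabel T E g := by
  obtain ⟨l, h1, h⟩ := hT.exists_visitLabel_mem hE isInner_rootVertex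
  have := (h g hg).1
  rwa [h1 rfl] at this

theorem IsBlossomingTree.visitTime_contourNext (hE : G.IsThreeOrientation E)
    (hT : G.IsBlossomingTree T E) {g : G.graph.Dart} (hg : G.IsInner g.fst)
    (hr : G.contourNext T g ≠ G.root) : visitTime T (G.contourNext T g) = visitTime T g + 1 := by
  obtain ⟨h1, h2⟩ := hT.contour_visitTime hE hg
  have h3 : G.contour T (visitTime T g + 1) = G.contourNext T g := by rw [contour_succ, h2]
  refine visitTime_eq (lt_contourLength h1 fun k hk1 hk2 => ?_) h3
  rwa [show k = visitTime T g + 1 by omega, h3]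

theorem IsBlossomingTree.visitTime_faceNext (hE : G.IsThreeOrientation E)
    (hT : G.IsBlossomingTree T E) {g : G.graph.Dart} (hg : G.IsInner g.fst)
    (h : g ∈ T ∨ g.symm ∈ T) (hr : G.faceNext g ≠ G.root) :
    visitTime T (G.faceNext g) = visitTime T g + 1 := by
  rw [← contourNext_of_mem h] at hr ⊢
  exact hT.visitTime_contourNext hE hg hr

theorem IsBlossomingTree.visitTime_rot (hE : G.IsThreeOrientation E)
    (hT : G.IsBlossomingTree T E) {g : G.graph.Dart} (hg : G.IsInner g.fst)
    (h : ¬(g ∈ T ∨ g.symm ∈ T)) (hr : G.rot g ≠ G.root) :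
    visitTime T (G.rot g) = visitTime T g + 1 := by
  rw [← contourNext_of_notMem h] at hr ⊢
  exact hT.visitTime_contourNext hE hg hr

theorem IsBlossomingTree.visitLabel_faceNext (hE : G.IsThreeOrientation E)
    (hT : G.IsBlossomingTree T E) {g : G.graph.Dart} (hg : G.IsInner g.fst)
    (h : g ∈ T ∨ g.symm ∈ T) (hr : G.faceNext g ≠ G.root) :
    visitLabel T E (G.faceNext g) = visitLabel T E g - 1 := by
  rw [visitLabel, visitLabel, hT.visitTime_faceNext hE hg h hr, cornerLabel_succ_of_mem]
  rwa [(hT.contour_visitTime hE hg).2]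

open Classical in
theorem IsBlossomingTree.visitTime_lt_rot (hE : G.IsThreeOrientation E)
    (hT : G.IsBlossomingTree T E) {g : G.graph.Dart} (hg : G.IsInner g.fst)
    (h : g ∉ T) (hr : G.rot g ≠ G.root) : visitTime T g < visitTime T (G.rot g) ∧
      visitLabel T E (G.rot g) = visitLabel T E g + if g ∈ E then 1 else 0 := by
  obtain ⟨h1, h2⟩ := hT.contour_visitTime hE hg
  obtain ⟨t, h3, h4, h5, h6⟩ := hT.exists_contour_eq_rot hE.orientation h hr
    (fun d hd _ => hT.hasTour hE hd) h2
  have ht := lt_contourLength h1 h6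
  rw [visitTime_eq ht h4, visitLabel_eq ht h4]
  exact ⟨h3, h5⟩

theorem IsBlossomingTree.visitLabel_rot (hE : G.IsThreeOrientation E)
    (hT : G.IsBlossomingTree T E) {g : G.graph.Dart} (hg : G.IsInner g.fst)
    (h : g ∉ T) (h' : g ∈ E) (hr : G.rot g ≠ G.root) :
    visitLabel T E (G.rot g) = visitLabel T E g + 1 := by
  rw [(hT.visitTime_lt_rot hE hg h hr).2, if_pos h']

/-- Passing an edge that is not outgoing keeps the label, except on returning to the root corner,
where the label starts again at 2, the least value at the root vertex. -/
theorem IsBlossomingTree.visitLabel_rot_le (hE : G.IsThreeOrientation E)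
    (hT : G.IsBlossomingTree T E) {g : G.graph.Dart} (hg : G.IsInner g.fst)
    (h : g ∉ E) : visitLabel T E (G.rot g) ≤ visitLabel T E g := by
  by_cases hr : G.rot g = G.root
  · rw [hr, visitLabel_root]
    exact hT.two_le_visitLabel hE (by rw [← G.rot_fst, hr]; rfl)
  · rw [(hT.visitTime_lt_rot hE hg (fun h' => h (hT.oriented h')) hr).2, if_neg h, add_zero]

/-- Entering the child loses one and the tour of its subtree gains two. -/
theorem IsBlossomingTree.visitLabel_symm_of_mem (hE : G.IsThreeOrientation E)
    (hT : G.IsBlossomingTree T E) {d : G.graph.Dart} (hd : d ∈ T) :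
    visitLabel T E d.symm = visitLabel T E d - 1 := by
  have hr : G.faceNext d.symm ≠ G.root := by
    rw [faceNext_apply, SimpleGraph.Dart.symm_symm]
    intro h
    exact hT.root_no_parent _ hd (by rw [← G.rot_fst, h]; rfl)
  have h1 := hT.visitLabel_faceNext hE (g := d.symm) (hT.isInner_snd hd) (Or.inr (by simpa using hd))
    hr
  rw [faceNext_apply, SimpleGraph.Dart.symm_symm] at h1
  obtain ⟨h2, h3⟩ := hT.contour_visitTime hE (g := G.rot d) (by
    rw [G.rot_fst]; exact hT.isInner_fst hd)
  obtain ⟨t, h4, h5, h6, h7⟩ := hT.hasTour hE hd _ h3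
  rw [visitLabel_eq (lt_contourLength h2 h7) h5, h6, ← visitLabel, h1]
  ring

theorem IsBlossomingTree.isInner_fst_of_not_isJump (hE : G.IsThreeOrientation E)
    (hT : G.IsBlossomingTree T E) {g : G.graph.Dart} (h : ¬IsJump T E g)
    (h' : ¬IsJump T E (G.faceNext g)) : G.IsInner g.fst := by
  rcases mem_of_not_isJump hE.orientation h with h1 | h1
  · exact hT.isInner_snd h1
  refine ⟨hE.fst_ne_A h1, fun hB => ?_⟩
  have hA : (G.faceNext g).fst = G.A := by rw [G.faceNext_fst, hE.snd_eq_A h1 hB]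
  rcases mem_of_not_isJump hE.orientation h' with h2 | h2
  · exact (hT.isInner_snd h2).1 hA
  · exact hE.fst_ne_A h2 hA

/-- Time increases along a face, except at the jumps. -/
theorem IsBlossomingTree.visitTime_lt_faceNext (hE : G.IsThreeOrientation E)
    (hT : G.IsBlossomingTree T E) {g : G.graph.Dart} (h1 : G.IsInner g.fst)
    (h2 : G.IsInner g.snd) (hr : G.faceNext g ≠ G.root) (hg : ¬IsJump T E g) :
    visitTime T g < visitTime T (G.faceNext g) ∧
      (¬(g ∈ T ∨ g.symm ∈ T) → visitTime T g.symm < visitTime T (G.faceNext g)) := by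
  by_cases h : g ∈ T ∨ g.symm ∈ T
  · exact ⟨by rw [hT.visitTime_faceNext hE h1 h hr]; omega, fun h' => absurd h h'⟩
  · have hgE : g ∈ E := (mem_of_not_isJump hE.orientation hg).resolve_left (by tauto)
    have h3 := hT.visitTime_lt_symm hgE (by tauto) h2
    have h4 : visitTime T (G.faceNext g) = visitTime T g.symm + 1 :=
      hT.visitTime_rot hE (g := g.symm) h2 (by rw [SimpleGraph.Dart.symm_symm]; tauto) hr
    exact ⟨by omega, fun _ => by omega⟩

/-- Without a jump, visit times would increase strictly all the way around the triangle. -/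
theorem IsBlossomingTree.exists_isJump (hE : G.IsThreeOrientation E)
    (hT : G.IsBlossomingTree T E) {f : G.Face} (hf : f ≠ G.rootFace) :
    ∃ d, IsJump T E d ∧ G.leftFace d = f := by
  by_contra! hno
  have key : ∀ d, G.leftFace d = f → visitTime T d < visitTime T (G.faceNext d) := by
    intro d hd
    have h0 : ¬IsJump T E d := fun h => hno d h hd
    have h1 : ¬IsJump T E (G.faceNext d) := fun h => hno _ h (by rw [G.leftFace_faceNext, hd])
    have h2 : ¬IsJump T E (G.faceNext (G.faceNext d)) := fun h => hno _ h (by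
      rw [G.leftFace_faceNext, G.leftFace_faceNext, hd])
    refine (hT.visitTime_lt_faceNext hE (hT.isInner_fst_of_not_isJump hE h0 h1) ?_ ?_ h0).1
    · rw [← G.faceNext_fst]; exact hT.isInner_fst_of_not_isJump hE h1 h2
    · exact ne_root_of_leftFace_ne (by rwa [G.leftFace_faceNext, hd])
  obtain ⟨d, hd⟩ := G.leftFace_surjective f
  have h1 := key d hd
  have h2 := key (G.faceNext d) (by rw [G.leftFace_faceNext, hd])
  have h3 := key (G.faceNext (G.faceNext d)) (by rw [G.leftFace_faceNext, G.leftFace_faceNext, hd])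
  rw [G.triangle] at h3
  omega

theorem IsBlossomingTree.isJump_faceNext_root (hE : G.IsThreeOrientation E)
    (hT : G.IsBlossomingTree T E) : IsJump T E (G.faceNext G.root) := by
  constructor
  · exact (hE.orientation _).2 fun h' => hE.fst_ne_A h' faceNext_root_fst
  · intro h
    exact (hT.isInner_snd h).1 faceNext_root_fst

theorem IsBlossomingTree.isJump_faceNext_faceNext_root (hE : G.IsThreeOrientation E)
    (hT : G.IsBlossomingTree T E) : IsJump T E (G.faceNext (G.faceNext G.root)) := by
  constructor
  · refine (hE.orientation _).2 fun h' => ?_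
    have := hE.snd_eq_A h' faceNext_faceNext_root_fst
    rw [faceNext_faceNext_root_snd] at this
    exact rootVertex_ne_A this
  · intro h
    exact (hT.isInner_snd h).2 faceNext_faceNext_root_fst

/-- Jumps are reversed stems. The tree has an edge for each vertex outside the root face, and
Euler's formula bounds the number of remaining edges. -/
theorem IsBlossomingTree.ncard_isJump_le (hE : G.IsThreeOrientation E)
    (hT : G.IsBlossomingTree T E) : {d | IsJump T E d}.ncard ≤ Nat.card G.Face + 1 := by
  have h1 : {d | IsJump T E d}.ncard = (E \ T).ncard := by
    rw [← Set.ncard_image_of_injective (E \ T) SimpleGraph.Dart.symm_involutive.injective]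
    congr 1
    ext d
    constructor
    · intro h
      exact ⟨d.symm, h, d.symm_symm⟩
    · rintro ⟨d, hd, rfl⟩
      simpa [IsJump] using hd
  have h2 := Set.ncard_sdiff_add_ncard_of_subset hT.oriented
  have h3 := IsOrientation.ncard_eq (M := G.toRotationSystem) hE.orientation
  have h4 : Nat.card V ≤ T.ncard + 3 := by
    have hsub : (Set.univ : Set V) ⊆ (fun d : G.graph.Dart => d.fst) '' T ∪
        {G.A, G.B, G.rootVertex} := by
      intro x _
      by_cases hx : x = G.A ∨ x = G.B ∨ x = G.rootVertex
      · exact Or.inr hx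
      · push Not at hx
        left
        rcases Relation.ReflTransGen.cases_head (hT.reaches_root x hx.1 hx.2.1) with h | h
        · exact absurd h hx.2.2
        · obtain ⟨y, ⟨d, hd, h, -⟩, -⟩ := h
          exact ⟨d, hd, h⟩
    rw [← Set.ncard_univ]
    refine (Set.ncard_le_ncard hsub).trans ((Set.ncard_union_le _ _).trans
      (add_le_add (Set.ncard_image_le) ?_))
    exact (Set.ncard_insert_le _ _).trans (Nat.succ_le_succ ((Set.ncard_insert_le _ _).trans
      (by rw [Set.ncard_singleton])))
  have h5 := G.euler
  omega

/-- Every face but the root face has exactly one jump. -/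
theorem IsBlossomingTree.isJump_unique (hE : G.IsThreeOrientation E)
    (hT : G.IsBlossomingTree T E) {d d' : G.graph.Dart} (hd : IsJump T E d) (hd' : IsJump T E d')
    (h : G.leftFace d = G.leftFace d') (hr : G.leftFace d ≠ G.rootFace) : d = d' := by
  classical
  have := Fintype.ofFinite G.Face
  by_contra hne
  have h1 := Set.ncard_eq_sum_fiber {d | IsJump T E d} G.leftFace Finset.univ (by simp)
  -- The root face has at least two jumps (its edges at `B`) and every other face at least one; a
  -- second jump in another face would exceed the total number of faces plus 1.
  have h2 : ∑ f : G.Face, (1 + (if f = G.rootFace then 1 else 0) +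
      if f = G.leftFace d then 1 else 0) ≤
      ∑ f : G.Face, {a | a ∈ {d | IsJump T E d} ∧ G.leftFace a = f}.ncard := by
    refine Finset.sum_le_sum fun f _ => ?_
    by_cases hf : f = G.rootFace
    · rw [if_pos hf, if_neg (by rw [hf]; exact hr.symm)]
      refine (Set.ncard_pair (a := G.faceNext G.root) (b := G.faceNext (G.faceNext G.root))
        (faceNext_ne _).symm).ge.trans (Set.ncard_le_ncard ?_)
      rintro x (rfl | rfl)
      · exact ⟨hT.isJump_faceNext_root hE, by rw [hf, leftFace_faceNext_root]⟩
      · exact ⟨hT.isJump_faceNext_faceNext_root hE, by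
          rw [hf, leftFace_faceNext_faceNext_root]⟩
    · rw [if_neg hf]
      split_ifs with hfd
      · refine (Set.ncard_pair hne).ge.trans (Set.ncard_le_ncard ?_)
        rintro x (rfl | rfl)
        · exact ⟨hd, hfd.symm⟩
        · exact ⟨hd', by rw [← h, hfd]⟩
      · obtain ⟨g, hg, hgf⟩ := hT.exists_isJump hE hf
        exact (Set.ncard_pos (Set.toFinite _)).2 ⟨g, hg, hgf⟩
  rw [← h1, Finset.sum_add_distrib, Finset.sum_add_distrib, Finset.sum_ite_eq', Finset.sum_ite_eq',
    if_pos (Finset.mem_univ _), if_pos (Finset.mem_univ _)] at h2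
  have h3 := hT.ncard_isJump_le hE
  simp only [sum_const, card_univ, smul_eq_mul, mul_one, Nat.card_eq_fintype_card] at h2 h3
  omega

end PlantedTriangulation

/-! ### Labels across edges and along leftmost paths -/

namespace PlantedTriangulation

open RotationSystem

variable {V : Type*} {G : PlantedTriangulation V} {E T : Set G.graph.Dart}

theorem faceNext_snd (g : G.graph.Dart) : (G.faceNext g).snd = (G.faceNext (G.faceNext g)).fst :=
  (G.faceNext_fst _).symm

theorem dart_eq {d d' : G.graph.Dart} (h : d.fst = d'.fst) (h' : d.snd = d'.snd) : d = d' :=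
  SimpleGraph.Dart.ext _ _ (Prod.ext h h')

theorem label_A : G.label T E G.A = 1 := if_pos rfl

theorem label_B : G.label T E G.B = 2 := by rw [label, if_neg A_ne_B.symm, if_pos rfl]

variable [Finite V]

theorem snd_eq_of_leftFace_eq {g : G.graph.Dart} (h : G.leftFace g = G.rootFace) :
    g = G.root ∨ g.fst = G.A ∧ g.snd = G.B ∨ g.fst = G.B ∧ g.snd = G.rootVertex := by
  rcases leftFace_eq_iff'.1 (h.trans leftFace_root.symm) with rfl | rfl | rfl
  · exact Or.inl rfl
  · exact Or.inr (Or.inl ⟨faceNext_root_fst, rfl⟩)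
  · exact Or.inr (Or.inr ⟨faceNext_faceNext_root_fst, faceNext_faceNext_root_snd⟩)

/-- The rule for stems is a hypothesis here, because this lemma is used inside the induction that
proves it. -/
theorem IsBlossomingTree.visitLabel_faceNext_of_symm (hE : G.IsThreeOrientation E)
    (hT : G.IsBlossomingTree T E) {g : G.graph.Dart} (h1 : G.IsInner g.fst)
    (h2 : G.IsInner g.snd) (hr : G.faceNext g ≠ G.root) (hg : ¬IsJump T E g)
    (ih : g ∈ E → g ∉ T → visitLabel T E g.symm = visitLabel T E g - 1) :
    visitLabel T E (G.faceNext g) = visitLabel T E g - 1 := by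
  by_cases h : g ∈ T ∨ g.symm ∈ T
  · exact hT.visitLabel_faceNext hE h1 h hr
  · push Not at h
    have hgE : g ∈ E := (mem_of_not_isJump hE.orientation hg).resolve_left h.2
    rw [← ih hgE h.1, faceNext_apply, (hT.visitTime_lt_rot hE (g := g.symm) h2 h.2 hr).2,
      if_neg (fun h' => (hE.orientation _).1 h' hgE), add_zero]

/-- The labels on the two sides of a stem that is closed at an inner vertex. -/
theorem IsBlossomingTree.visitLabel_symm_of_notMem (hE : G.IsThreeOrientation E)
    (hT : G.IsBlossomingTree T E) {d : G.graph.Dart} (hd : d ∈ E) (hdT : d ∉ T)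
    (hs : G.IsInner d.snd) : visitLabel T E d.symm = visitLabel T E d - 1 := by
  -- In the triangle on the left of `d.symm`, that dart is the only jump. Passing the stem gains
  -- one, and each of the other two edges loses one: it is a tree edge, or a stem whose two visits
  -- fall strictly between those of `d`.
  induction hn : visitTime T d.symm - visitTime T d using Nat.strong_induction_on
    generalizing d with
  | _ n ih =>
    subst hn
    have hf : G.leftFace d.symm ≠ G.rootFace := by
      intro h
      rcases snd_eq_of_leftFace_eq h with h | h | h
      · exact hE.fst_ne_A hd (congrArg (fun g : G.graph.Dart => g.snd) h)
      · exact hs.1 h.1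
      · exact hs.2 h.1
    have hj : IsJump T E d.symm := ⟨by simpa using hd, by simpa using hdT⟩
    set d₁ := G.faceNext d.symm with hd₁
    set d₂ := G.faceNext d₁ with hd₂
    have hd₃ : G.faceNext d₂ = d.symm := G.triangle _
    have hf₁ : G.leftFace d₁ = G.leftFace d.symm := G.leftFace_faceNext _
    have hf₂ : G.leftFace d₂ = G.leftFace d.symm := (G.leftFace_faceNext _).trans hf₁
    have hj₁ : ¬IsJump T E d₁ := fun h =>
      faceNext_ne _ (hT.isJump_unique hE h hj hf₁ (by rwa [hf₁]))
    have hj₂ : ¬IsJump T E d₂ := fun h =>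
      faceNext_faceNext_ne _ (hT.isJump_unique hE h hj hf₂ (by rwa [hf₂]))
    have hr₁ : d₁ ≠ G.root := ne_root_of_leftFace_ne (by rwa [hf₁])
    have hr₂ : d₂ ≠ G.root := ne_root_of_leftFace_ne (by rwa [hf₂])
    have hr₃ : G.faceNext d₂ ≠ G.root := by rw [hd₃]; exact ne_root_of_leftFace_ne hf
    have hs₂ : d₂.snd = d.snd := by rw [← G.faceNext_fst, hd₃]; rfl
    have hs₁ : d₁.snd = d₂.fst := (G.faceNext_fst _).symm
    have hi₁ : G.IsInner d₁.fst := hT.isInner_fst_of_not_isJump hE hj₁ hj₂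
    have hi : G.IsInner d.fst := by
      rwa [hd₁, G.faceNext_fst] at hi₁
    have hi₂ : G.IsInner d₂.fst := by
      rcases mem_of_not_isJump hE.orientation hj₂ with h | h
      · exact hT.isInner_snd h
      · exact ⟨hE.fst_ne_A h, fun hB => hs.1 (hs₂ ▸ hE.snd_eq_A h hB)⟩
    have hrot : d₁ = G.rot d := by rw [hd₁, faceNext_apply, SimpleGraph.Dart.symm_symm]
    have ht := (hT.visitTime_lt_rot hE hi hdT (by rwa [← hrot])).1
    have ht₁ := hT.visitTime_lt_faceNext hE hi₁ (by rwa [hs₁]) hr₂ hj₁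
    have ht₂ := hT.visitTime_lt_faceNext hE hi₂ (by rwa [hs₂]) hr₃ hj₂
    have hl := hT.visitLabel_rot hE hi hdT hd (by rwa [← hrot])
    rw [hd₃] at ht₂
    rw [← hrot] at ht hl
    rw [← hd₂] at ht₁
    have hl₁ := hT.visitLabel_faceNext_of_symm hE hi₁ (by rwa [hs₁]) hr₂ hj₁ fun h h' =>
      have := ht₁.2 (fun h'' => h''.elim h' fun h'' =>
        (hE.orientation _).1 (hT.oriented h'') h)
      ih _ (by omega) h h' (by rwa [hs₁]) rfl
    have hl₂ := hT.visitLabel_faceNext_of_symm hE hi₂ (by rwa [hs₂]) hr₃ hj₂ fun h h' =>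
      have := ht₂.2 (fun h'' => h''.elim h' fun h'' =>
        (hE.orientation _).1 (hT.oriented h'') h)
      ih _ (by omega) h h' (by rwa [hs₂]) rfl
    rw [hd₃] at hl₂
    rw [← hd₂] at hl₁
    linarith

theorem IsBlossomingTree.visitLabel_faceNext_of_not_isJump (hE : G.IsThreeOrientation E)
    (hT : G.IsBlossomingTree T E) {g : G.graph.Dart} (h1 : G.IsInner g.fst)
    (h2 : G.IsInner g.snd) (hr : G.faceNext g ≠ G.root) (hg : ¬IsJump T E g) :
    visitLabel T E (G.faceNext g) = visitLabel T E g - 1 :=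
  hT.visitLabel_faceNext_of_symm hE h1 h2 hr hg fun h h' =>
    hT.visitLabel_symm_of_notMem hE h h' h2

/-- Two consecutive stems closed at the same vertex, outside the root face, have the same label. -/
theorem IsBlossomingTree.visitLabel_symm_eq_of_rot (hE : G.IsThreeOrientation E)
    (hT : G.IsBlossomingTree T E) {g : G.graph.Dart} (hg : G.IsInner g.snd)
    (hg' : G.IsInner (G.rot g).snd) (hf : G.leftFace g.symm ≠ G.rootFace)
    (hj : IsJump T E (G.rot g)) :
    visitLabel T E g.symm = visitLabel T E (G.rot g).symm := by
  have hr : G.faceNext g.symm = G.rot g := by rw [faceNext_apply, SimpleGraph.Dart.symm_symm]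
  set r := G.rot g with hrdef
  have hfr : G.leftFace r = G.leftFace g.symm := by rw [← hr, G.leftFace_faceNext]
  have hnext : G.faceNext (G.faceNext r) = g.symm := by rw [← hr, G.triangle]
  have hf₁ : G.leftFace (G.faceNext r) = G.leftFace g.symm := by rw [G.leftFace_faceNext, hfr]
  have hj₁ : ¬IsJump T E (G.faceNext r) := fun h =>
    faceNext_ne _ (hT.isJump_unique hE h hj (G.leftFace_faceNext _) (by rwa [hf₁]))
  -- Around the triangle: one is gained past the stem and one lost along the third edge.
  have h1 := hT.visitLabel_rot hE (g := r.symm) hg' hj.2 hj.1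
    (ne_root_of_leftFace_ne (by rwa [← faceNext_apply, hf₁]))
  have h2 := hT.visitLabel_faceNext_of_not_isJump hE (g := G.faceNext r)
    (by rwa [G.faceNext_fst]) (by rw [faceNext_snd, hnext]; exact hg)
    (by rw [hnext]; exact ne_root_of_leftFace_ne hf) hj₁
  rw [hnext, faceNext_apply, h1] at h2
  linarith

/-- Going counterclockwise around `A` from the root edge, whose label is 2, consecutive stems have
equal labels; the turn ends at the edge to `B`, beyond which is the root face. -/
theorem IsBlossomingTree.visitLabel_of_snd_eq_A (hE : G.IsThreeOrientation E)
    (hT : G.IsBlossomingTree T E) {d : G.graph.Dart} (hA : d.snd = G.A) (hB : d.fst ≠ G.B) :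
    visitLabel T E d = 2 := by
  suffices h : d.symm.snd = G.B ∨ visitLabel T E d.symm.symm = 2 by
    simpa using h.resolve_left hB
  refine rot_induction_backward (p := fun g => g.snd = G.B ∨ visitLabel T E g.symm = 2)
    (d := G.root.symm) (Or.inr visitLabel_root) hA fun g hg ih => ?_
  have hgA : g.fst = G.A := hg
  rw [or_iff_not_imp_left]
  intro hgB
  by_cases hroot : g.symm = G.root
  · rw [hroot, visitLabel_root]
  have hf : G.leftFace g.symm ≠ G.rootFace := by
    intro h
    rcases snd_eq_of_leftFace_eq h with h | h | h
    · exact hroot h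
    · exact A_ne_B (hgA.symm.trans h.2)
    · exact rootVertex_ne_A (h.2.symm.trans hgA)
  have hrA : (G.rot g).fst = G.A := by rw [G.rot_fst, hgA]
  have hrB : (G.rot g).snd ≠ G.B := by
    intro h
    refine hf ?_
    rw [G.leftFace_symm, ← G.leftFace_rot, ← leftFace_faceNext_root]
    exact congrArg _ (dart_eq (hrA.trans faceNext_root_fst.symm) h)
  rw [hT.visitLabel_symm_eq_of_rot hE ⟨fun h => g.adj.ne (hgA.trans h.symm), hgB⟩
    ⟨fun h => (G.rot g).adj.ne (hrA.trans h.symm), hrB⟩ hf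
    ⟨(hE.orientation _).2 fun h => hE.fst_ne_A h hrA, fun h => (hT.isInner_snd h).1 hrA⟩]
  exact ih.resolve_left hrB

/-- The same turn around `B`, starting at the edge to `A`. In the first triangle a stem to `A`, of
label 2, is passed, which gives 3. -/
theorem IsBlossomingTree.visitLabel_of_snd_eq_B (hE : G.IsThreeOrientation E)
    (hT : G.IsBlossomingTree T E) {d : G.graph.Dart} (hB : d.snd = G.B) (hA : d.fst ≠ G.A) :
    visitLabel T E d = 3 := by
  suffices h : d.symm.snd = G.A ∨ visitLabel T E d.symm.symm = 3 by
    simpa using h.resolve_left hA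
  refine rot_induction_backward (p := fun g => g.snd = G.A ∨ visitLabel T E g.symm = 3)
    (d := (G.faceNext G.root).symm) (Or.inl faceNext_root_fst) hB fun g hg ih => ?_
  have hgB : g.fst = G.B := hg
  rw [or_iff_not_imp_left]
  intro hgA
  have hg : G.IsInner g.snd := ⟨hgA, fun h => g.adj.ne (hgB.trans h.symm)⟩
  have hf : G.leftFace g.symm ≠ G.rootFace := by
    intro h
    rcases snd_eq_of_leftFace_eq h with h | h | h
    · exact A_ne_B ((congrArg (fun g : G.graph.Dart => g.snd) h).symm.trans hgB)
    · exact hgA h.1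
    · exact B_ne_rootVertex (hgB.symm.trans h.2)
  have hrB : (G.rot g).fst = G.B := by rw [G.rot_fst, hgB]
  by_cases hrA : (G.rot g).snd = G.A
  · have hr : G.faceNext g.symm = G.rot g := by rw [faceNext_apply, SimpleGraph.Dart.symm_symm]
    set h := G.faceNext (G.rot g) with hh
    have hnext : G.faceNext h = g.symm := by rw [hh, ← hr, G.triangle]
    have hhA : h.fst = G.A := by rw [hh, G.faceNext_fst, hrA]
    have hhs : h.snd = g.snd := by rw [← G.faceNext_fst, hnext]; rfl
    have h1 := hT.visitLabel_of_snd_eq_A hE (d := h.symm) hhA (by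
      rw [show h.symm.fst = g.snd from hhs]; exact hg.2)
    have h2 := hT.visitLabel_rot hE (g := h.symm) (by
      rw [show h.symm.fst = g.snd from hhs]; exact hg) (fun h' => (hT.isInner_snd h').1 hhA)
      ((hE.orientation _).2 fun h' => hE.fst_ne_A h' hhA)
      (by rw [← faceNext_apply, hnext]; exact ne_root_of_leftFace_ne hf)
    rw [← hnext, faceNext_apply, h2, h1]
    rfl
  · rw [hT.visitLabel_symm_eq_of_rot hE hg
      ⟨hrA, fun h => (G.rot g).adj.ne (hrB.trans h.symm)⟩ hf
      ⟨(hE.orientation _).2 fun h => hrA (hE.snd_eq_A h hrB), fun h => (hT.isInner_snd h).2 hrB⟩]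
    exact ih.resolve_left hrA

theorem IsBlossomingTree.visitLabel_symm (hE : G.IsThreeOrientation E)
    (hT : G.IsBlossomingTree T E) {d : G.graph.Dart} (hd : d ∈ E) (hs : G.IsInner d.snd) :
    visitLabel T E d.symm = visitLabel T E d - 1 := by
  by_cases h : d ∈ T
  · exact hT.visitLabel_symm_of_mem hE h
  · exact hT.visitLabel_symm_of_notMem hE hd h hs

/-- Crossing to the head of `d` loses one, and rotating past incoming edges does not raise the
label. -/
theorem IsBlossomingTree.visitLabel_le_of_isFirstOutgoing (hE : G.IsThreeOrientation E)
    (hT : G.IsBlossomingTree T E) {d d' : G.graph.Dart} (hd : d ∈ E) (hs : G.IsInner d.snd)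
    (h : G.IsFirstOutgoing E d d') : visitLabel T E d' ≤ visitLabel T E d - 1 := by
  rw [← hT.visitLabel_symm hE hd hs]
  obtain ⟨-, k, hk, rfl, hmin⟩ := h
  have key : ∀ j ≤ k, visitLabel T E ((G.rot ^ j) d.symm) ≤ visitLabel T E d.symm := by
    intro j hj
    induction j with
    | zero => exact le_rfl
    | succ j ih =>
      rw [pow_succ', Equiv.Perm.mul_apply]
      refine (hT.visitLabel_rot_le hE (by rw [G.rot_pow_fst]; exact hs) ?_).trans (ih (by omega))
      rcases Nat.eq_zero_or_pos j with rfl | h0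
      · exact fun h' => (hE.orientation _).1 h' hd
      · exact hmin j h0 (by omega)
  exact key k le_rfl

/-- Labels decrease along leftmost paths. -/
theorem IsLeftmost.le_label_sub (hE : G.IsThreeOrientation E) (hT : G.IsBlossomingTree T E)
    {a : V} {P : G.graph.Walk a G.A} (hP : G.IsLeftmost E P) {i j : ℕ} (hij : i ≤ j)
    (hj : j ≤ P.length) :
    (j : ℤ) - i - 2 ≤ G.label T E (P.getVert i) - G.label T E (P.getVert j) := by
  have hlen := P.length_darts
  rcases hij.eq_or_lt with rfl | hij
  · omega
  have hiA : P.getVert i ≠ G.A := hP.getVert_ne_A hE (by omega)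
  by_cases hiB : P.getVert i = G.B
  · have h1 := hP.getVert_succ_eq_A hE (by omega) hiB
    have h2 : j = i + 1 := by
      by_contra hne
      exact hP.getVert_ne_A hE (by omega) h1
    rw [h2, h1, hiB, label_A, label_B]
    push_cast; omega
  have hi : i < P.darts.length := by omega
  have hfst : P.darts[i].fst = P.getVert i := SimpleGraph.Walk.getElem_darts_fst hi
  -- The loss of 2 in the bound comes from here: the label of a vertex may be smaller by two than
  -- that of the corner where the path leaves it.
  have hYi := (hT.label_mem hE (g := P.darts[i]) (by rw [hfst]; exact ⟨hiA, hiB⟩)).1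
  rw [hfst] at hYi
  have key : ∀ k (hk : k < P.darts.length), i ≤ k → P.getVert k ≠ G.B →
      (k : ℤ) - i ≤ visitLabel T E P.darts[i] - visitLabel T E P.darts[k] := by
    intro k hk hik hkB
    induction k, hik using Nat.le_induction with
    | base => simp
    | succ k hik ih =>
      have hkB' : P.getVert k ≠ G.B := fun h =>
        hP.getVert_ne_A hE hk (hP.getVert_succ_eq_A hE (by omega) h)
      have h1 := ih (by omega) hkB'
      have h2 := hT.visitLabel_le_of_isFirstOutgoing hE (hP.mem _ (List.getElem_mem _)) (by
        rw [SimpleGraph.Walk.getElem_darts_snd]; exact ⟨hP.getVert_ne_A hE hk, hkB⟩) (hP.first hk)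
      push_cast; linarith
  obtain ⟨k, rfl⟩ : ∃ k, j = k + 1 := ⟨j - 1, by omega⟩
  have hk : k < P.darts.length := by omega
  have hkE : P.darts[k] ∈ E := hP.mem _ (List.getElem_mem _)
  have hkf : P.darts[k].fst = P.getVert k := SimpleGraph.Walk.getElem_darts_fst hk
  have hks : P.darts[k].snd = P.getVert (k + 1) := SimpleGraph.Walk.getElem_darts_snd hk
  by_cases hjA : P.getVert (k + 1) = G.A
  · rw [hjA, label_A]
    by_cases hkB : P.getVert k = G.B
    -- When the path ends through `B`, the comparison is made at the stem into `B`, of label 3.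
    · have hik : i < k := by
        refine lt_of_le_of_ne (by omega) ?_
        rintro rfl
        exact hiB hkB
      obtain ⟨l, rfl⟩ : ∃ l, k = l + 1 := ⟨k - 1, by omega⟩
      have h1 := hT.visitLabel_of_snd_eq_B hE (d := P.darts[l])
        ((SimpleGraph.Walk.getElem_darts_snd _).trans hkB)
        (by rw [SimpleGraph.Walk.getElem_darts_fst]; exact hP.getVert_ne_A hE (by omega))
      have h2 := key l (by omega) (by omega) fun h =>
        hP.getVert_ne_A hE hk (hP.getVert_succ_eq_A hE (by omega) h)
      push_cast; linarith
    · have h1 := hT.visitLabel_of_snd_eq_A hE (d := P.darts[k]) (hks.trans hjA) (by rwa [hkf])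
      have h2 := key k hk (by omega) hkB
      push_cast; linarith
  · have hkB : P.getVert k ≠ G.B := fun h => hjA (hP.getVert_succ_eq_A hE hk h)
    have h2 := key k hk (by omega) hkB
    by_cases hjB : P.getVert (k + 1) = G.B
    · have h1 := hT.visitLabel_of_snd_eq_B hE (d := P.darts[k]) (hks.trans hjB)
        (by rw [hkf]; exact hP.getVert_ne_A hE hk)
      rw [hjB, label_B]
      push_cast; linarith
    · have h1 := hT.visitLabel_symm hE hkE (by rw [hks]; exact ⟨hjA, hjB⟩)
      have h3 := (hT.label_mem hE (g := P.darts[k].symm) (by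
        rw [show P.darts[k].symm.fst = P.getVert (k + 1) from hks]; exact ⟨hjA, hjB⟩)).2
      rw [show P.darts[k].symm.fst = P.getVert (k + 1) from hks] at h3
      push_cast; linarith

end PlantedTriangulation

/-! ### Diameter and label span of the two sides -/

namespace SimpleGraph

/-- Connectedness excludes the default value 0 of `diam`; a walk in the induced graph is also a walk
in `G`, so distances in `G` bound the diameter from below. -/
theorem Connected.exists_walk_length_le_diam {V : Type*} [Finite V] {G : SimpleGraph V}
    {S : Set V} (h : (G.induce S).Connected) {x y : V} (hx : x ∈ S) (hy : y ∈ S) :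
    ∃ W : G.Walk x y, W.length ≤ (G.induce S).diam := by
  have := h.nonempty
  obtain ⟨W, hW⟩ := h.exists_walk_length_eq_dist ⟨x, hx⟩ ⟨y, hy⟩
  refine ⟨W.map (Embedding.induce S).toHom, (Walk.length_map _ _).trans_le ?_⟩
  rw [hW]
  exact dist_le_diam (connected_iff_ediam_ne_top.1 h)

end SimpleGraph

namespace PlantedTriangulation

open RotationSystem

variable {V : Type*} {G : PlantedTriangulation V} {a : V} {C : G.graph.Walk a a}

theorem leftVertices_reverse : G.leftVertices C.reverse = G.rightVertices C := by
  simp only [leftVertices, rightVertices, leftFaces_reverse, SimpleGraph.Walk.support_reverse,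
    List.mem_reverse]

variable [Finite V]

/-- The vertices on one side of a cycle induce a connected graph. -/
theorem connected_induce_leftVertices :
    (G.graph.induce (G.leftVertices C)).Connected := by
  set S := G.leftVertices C with hS
  have ha : a ∈ S := Or.inl C.start_mem_support
  have hmem : ∀ d : G.graph.Dart, G.leftFace d ∈ G.leftFaces C → d.fst ∈ S :=
    fun d hd => Or.inr ⟨d, rfl, hd⟩
  have hadj : ∀ (d : G.graph.Dart) (h1 : d.fst ∈ S) (h2 : d.snd ∈ S),
      (G.graph.induce S).Reachable ⟨d.fst, h1⟩ ⟨d.snd, h2⟩ := fun d h1 h2 =>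
    SimpleGraph.Adj.reachable (G := G.graph.induce S) (u := ⟨d.fst, h1⟩) (v := ⟨d.snd, h2⟩) d.adj
  have hnext : ∀ (d : G.graph.Dart) (hd : G.leftFace d ∈ G.leftFaces C),
      ∃ h : d.snd ∈ S, (G.graph.induce S).Reachable ⟨d.fst, hmem d hd⟩ ⟨d.snd, h⟩ := fun d hd =>
    have h : d.snd ∈ S := by
      rw [← G.faceNext_fst]; exact hmem _ (by rwa [G.leftFace_faceNext])
    ⟨h, hadj d _ h⟩
  have hcyc : ∀ x (hx : x ∈ C.support),
      (G.graph.induce S).Reachable ⟨a, ha⟩ ⟨x, Or.inl hx⟩ := by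
    classical
    exact fun x hx => ⟨(C.takeUntil x hx).induce S fun y hy =>
      Or.inl (C.support_takeUntil_subset_support hx hy)⟩
  have hface : ∀ d d' (hd : G.leftFace d ∈ G.leftFaces C) (h : G.leftFace d' = G.leftFace d),
      (G.graph.induce S).Reachable ⟨d.fst, hmem d hd⟩
        ⟨d'.fst, hmem d' (h.symm ▸ hd)⟩ := by
    intro d d' hd h
    obtain ⟨h1, h2⟩ := hnext d hd
    obtain ⟨h3, h4⟩ := hnext (G.faceNext d) (by rwa [G.leftFace_faceNext])
    rcases leftFace_eq_iff'.1 h with rfl | rfl | rfl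
    · rfl
    · simp only [G.faceNext_fst]; exact h2
    · simp only [G.faceNext_fst] at h4 ⊢; exact h2.trans h4
  -- Induction over adjacent faces: faces sharing an edge share vertices, and the vertices of one
  -- face are joined along its boundary.
  have hleft : ∀ f ∈ G.leftFaces C, ∀ d (h : G.leftFace d = f) (hx : d.fst ∈ S),
      (G.graph.induce S).Reachable ⟨a, ha⟩ ⟨d.fst, hx⟩ := by
    rintro f ⟨d₀, hd₀, hf⟩
    induction hf with
    | refl =>
      intro d hd hx
      exact (hcyc _ (C.dart_fst_mem_support_of_mem_darts hd₀)).trans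
        (hface d₀ d ⟨d₀, hd₀, .refl⟩ hd)
    | @tail f g hf hfg ih =>
      intro d hd hx
      have hg : g ∈ G.leftFaces C := ⟨d₀, hd₀, hf.tail hfg⟩
      obtain ⟨d₁, -, rfl, rfl⟩ := hfg
      obtain ⟨h1, h2⟩ := hnext d₁ ⟨d₀, hd₀, hf⟩
      exact ((ih d₁ rfl _).trans h2).trans (hface d₁.symm d hg hd)
  have hreach : ∀ x : S, (G.graph.induce S).Reachable ⟨a, ha⟩ x := by
    rintro ⟨x, hx | ⟨d, rfl, hd⟩⟩
    · exact hcyc x hx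
    · exact hleft _ hd d rfl _
  exact { preconnected := fun x y => (hreach x).symm.trans (hreach y), nonempty := ⟨⟨a, ha⟩⟩ }

theorem connected_induce_rightVertices :
    (G.graph.induce (G.rightVertices C)).Connected := by
  rw [← leftVertices_reverse]; exact connected_induce_leftVertices

theorem le_labelSpan {T E : Set G.graph.Dart} {S : Set V} {x y : V} (hx : x ∈ S) (hy : y ∈ S) :
    G.label T E x - G.label T E y ≤ G.labelSpan T E S :=
  have hfin : (G.label T E '' S).Finite := Set.toFinite _
  sub_le_sub (le_csSup hfin.bddAbove (Set.mem_image_of_mem _ hx))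
    (csInf_le hfin.bddBelow (Set.mem_image_of_mem _ hy))

end PlantedTriangulation

/-! ### The short cycle and its two sides -/

theorem mainTheorem9 {V : Type*} [Finite V] (G : PlantedTriangulation V)
    (E : Set G.graph.Dart) (hE : G.IsMinimalThreeOrientation E)
    (T : Set G.graph.Dart) (hT : G.IsBlossomingTree T E)
    (e : G.graph.Dart) (he : e ∈ E)
    (P : G.graph.Walk e.fst G.A) (hP : G.IsLeftmostPath E e P)
    (Q : G.graph.Walk e.fst G.A) (hQ : Q.length = G.graph.dist e.fst G.A)
    (hw : G.windingNumber P Q < -2) :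
    ∃ (a : V) (C : G.graph.Walk a a), C.IsCycle ∧
      (C.length : ℚ) ≤ 6 * ((Q.support.length : ℚ) - 1) / (-(G.windingNumber P Q : ℚ) - 2) ∧
      ⌊-(G.windingNumber P Q : ℚ) / 3⌋ - 2 ≤ ((G.graph.induce (G.leftVertices C)).diam : ℤ) ∧
      ⌊-(G.windingNumber P Q : ℚ) / 3⌋ - 2 ≤ ((G.graph.induce (G.rightVertices C)).diam : ℤ) ∧
      ⌊-(G.windingNumber P Q : ℚ) / 3⌋ ≤ G.labelSpan T E (G.leftVertices C) ∧
      ⌊-(G.windingNumber P Q : ℚ) / 3⌋ ≤ G.labelSpan T E (G.rightVertices C) := by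
  obtain ⟨k, hk⟩ : ∃ k : ℕ, G.windingNumber P Q = -k :=
    ⟨(-G.windingNumber P Q).toNat, by omega⟩
  have hk3 : 3 ≤ k := by omega
  obtain ⟨m, hm1, hm2⟩ : ∃ m, 3 * m ≤ k ∧ k < 3 * m + 3 := ⟨k / 3, by omega, by omega⟩
  have hfloor : ⌊-(G.windingNumber P Q : ℚ) / 3⌋ = m := by
    have h1 : (3 * m : ℚ) ≤ k := by exact_mod_cast hm1
    have h2 : (k : ℚ) < 3 * m + 3 := by exact_mod_cast hm2
    rw [hk, Int.floor_eq_iff]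
    push_cast
    constructor <;> linarith
  have hL := hP.isLeftmost he
  obtain ⟨s, t, i, j, hexc, hij, hlen, hQm, hms, hmt, a, C, hC, hCl, hroot, hright, hPi, hPj⟩ :=
    PlantedTriangulation.exists_short_cycle hE hL (fun h => by
      have := hP.1
      rw [List.head?_eq_getElem?, List.getElem?_eq_getElem h] at this
      exact Option.some.inj this) hQ hk (by omega) hm1
  have hts := hexc.length_le hQ hij.le
  -- With `t - s ≤ j - i` this gives `j - i ≥ 2`, which makes up for the loss of 2 in `le_label_sub`
  -- on both sides.
  have hC3 := hC.three_le_length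
  have hsi := SimpleGraph.Walk.le_of_getVert_eq hQ (hexc.lt.le.trans hexc.le_length) hexc.left_le
    hexc.left_eq
  have hjt := SimpleGraph.Walk.sub_le_of_getVert_eq hQ hexc.le_length hexc.right_eq
  have hst := hexc.lt
  have htl := hexc.le_length
  have hjl := hexc.right_le
  have hAl : G.A ∈ G.leftVertices C :=
    Or.inr ⟨G.faceNext G.root, PlantedTriangulation.faceNext_root_fst, by
      rwa [PlantedTriangulation.leftFace_faceNext_root]⟩
  have hur : e.fst ∈ G.rightVertices C :=
    Or.inr ⟨G.rot e, G.rot_fst e, by rwa [G.leftFace_rot]⟩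
  have hil : P.getVert i ∈ G.leftVertices C := Or.inl hPi
  have hjr : P.getVert j ∈ G.rightVertices C := Or.inl hPj
  rw [hfloor]
  refine ⟨a, C, hC, ?_, ?_, ?_, ?_, ?_⟩
  · rw [hk, SimpleGraph.Walk.length_support, hCl]
    -- The choice of `m` gives `k - 2 ≤ 3 * m`, and `j - i ≤ t - s + 2` bounds the first factor.
    have h1 : (t - s + (j - i)) * (k - 2) ≤ 6 * Q.length := by
      calc (t - s + (j - i)) * (k - 2) ≤ (2 * (t - s) + 2) * (3 * m) :=
            Nat.mul_le_mul (by omega) (by omega)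
        _ ≤ 6 * (m * (t - s) + 2 * m) := by nlinarith
        _ ≤ _ := Nat.mul_le_mul_left _ hQm
    have h2 : ((t - s + (j - i) : ℕ) : ℚ) * (k - 2) ≤ 6 * Q.length := by
      have : ((k - 2 : ℕ) : ℚ) = k - 2 := by push_cast [show 2 ≤ k by omega]; ring
      rw [← this]
      exact_mod_cast h1
    have h3 : (3 : ℚ) ≤ k := by exact_mod_cast hk3
    push_cast at h2 ⊢
    rw [le_div_iff₀ (by linarith)]
    linarith
  · obtain ⟨W, hW⟩ := (PlantedTriangulation.connected_induce_leftVertices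
      (C := C)).exists_walk_length_le_diam hil hAl
    -- Along the geodesic the distance to `A` is `Q.length - s`, and `m + t ≤ Q.length`.
    have := SimpleGraph.Walk.sub_le_length_of_length_eq_dist hQ (s := s) (t := Q.length) (by omega)
      le_rfl (W.copy hexc.left_eq.symm Q.getVert_length.symm)
    rw [SimpleGraph.Walk.length_copy] at this
    omega
  · obtain ⟨W, hW⟩ := (PlantedTriangulation.connected_induce_rightVertices
      (C := C)).exists_walk_length_le_diam hur hjr
    have := SimpleGraph.Walk.sub_le_length_of_length_eq_dist hQ (s := 0) (t := t) (by omega)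
      htl (W.copy Q.getVert_zero.symm hexc.right_eq.symm)
    rw [SimpleGraph.Walk.length_copy] at this
    omega
  · have h1 := hL.le_label_sub hE.toIsThreeOrientation hT (i := i) (j := P.length) (by omega) le_rfl
    have h2 := PlantedTriangulation.le_labelSpan (T := T) (E := E) hil hAl
    rw [P.getVert_length] at h1
    omega
  · have h1 := hL.le_label_sub hE.toIsThreeOrientation hT (i := 0) (j := j) (by omega) hjl
    have h2 := PlantedTriangulation.le_labelSpan (T := T) (E := E) hur hjr
    rw [P.getVert_zero] at h1
    omega
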